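/- **Notation.** Let $n\ge 2$, let $B_n$ be the braid group with Artin generators $\sigma_1,\dots,\sigma_{n-1}$ and $B_n^+$ the submonoid they generate; for $I\subseteq\{1,\dots,n-1\}$ let $B_I^+$ be the submonoid generated by the $\sigma_i$, $i\in I$. For $\beta\in B_n^+$, $\beta\wedge B_I^+$ denotes the maximal right divisor of $\beta$ in $B_I^+$: the element $\beta'\in B_I^+$ with $\beta\beta'^{-1}\in B_n^+$ such that $\beta'\beta''^{-1}\in B_I^+$ for every $\beta''\in B_I^+$ with $\beta\beta''^{-1}\in B_n^+$. Let $\mathrm{Sh}$ be the shift $\sigma_i\mapsto\sigma_{i-1}$ and $D$ the flip $\sigma_i\mapsto\sigma_{n-i}$ of $B_n^+$. Let $\mathbf k=(k(1),\dots,k(n-1))$ be a permutation of $1,\dots,n-1$. Let $\Gamma_i$ be the upward vertical arc in the $n$-punctured disc (punctures on a horizontal line) between the punctures $k(i)$ and $k(i)+1$. The *normal finite Thurston-type ordering* $<$ of $B_n$ given by $\mathbf k$ is: $\alpha<\beta$ if, for the first $i$ such that $\alpha(\Gamma_i)$ and $\beta(\Gamma_i)$ are not isotopic, $\beta(\Gamma_i)$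 (pulled tight) lies to the left of $\alpha(\Gamma_i)$ at their first divergence; orientations are such that positive half twists move arcs to the left. The *Dehornoy ordering* $<_D$ is the one given by $(1,2,\dots,n-1)$. For $1\le j\le n-2$ put $$m_j=\max\{1,\,k(i)+1 : i\le j,\ k(i)<k(j+1)\},\qquad M_j=\min\{n,\,k(i): i\le j,\ k(i)>k(j+1)\},$$ and $B_{(j)}^+=\langle\sigma_{m_j},\dots,\sigma_{M_j-1}\rangle$, which $\mathrm{Sh}^{m_j-1}$ identifies with $B^+_{M_j-m_j+1}$. The restrictions of $<$ to $\langle\sigma_2,\dots,\sigma_{n-1}\rangle$ and $\langle\sigma_{m_j},\dots,\sigma_{M_j-1}\rangle$, moved by these shifts, are denoted $<_{\mathrm{res}}$ and $<_j$. **Codes and C-normal form.** For $n=2$ the code of the word $\sigma_1^a$ is the integer $a$. For $n\ge3$ a positive $n$-braid word $W$ is decomposed into subwords $W=A_mA_{m-1}\cdots A_0X_1X_2\cdots X_{n-2}$, where $A_i$ is a word in $\sigma_1,\dots,\sigma_{n-2}$ for odd $i$ and in $\sigma_2,\dots,\sigma_{n-1}$ for even $i$, and $X_j$ is a word in $\sigma_{m_j},\dots,\sigma_{M_j-1}$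 (subwords may be empty). Choosing recursively codes $\mathcal C_i$ of $D^{i-1}(A_i)$ with respect to $<_D$ on $B_{n-1}$ ($i>0$), $\mathcal C_0$ of $\mathrm{Sh}(A_0)$ with respect to $<_{\mathrm{res}}$, and $\mathcal C_{-j}$ of $\mathrm{Sh}^{m_j-1}(X_j)$ with respect to $<_j$, one gets a code $(\dots,\mathcal C_1,\mathcal C_0,\mathcal C_{-1},\dots,\mathcal C_{-(n-2)})$ of $W$ with respect to $<$, a left-infinite sequence in which $\mathcal C_i$ for $i>m$ is the code of the empty word. Codes are ordered by $<_{\mathrm{right}}$: for $n=2$ as integers, and for $n\ge 3$ by $\mathcal C<_{\mathrm{right}}\mathcal C'$ if for some $l$ one has $\mathcal C_i=\mathcal C'_i$ for all $i<l$ and $\mathcal C_l<_{\mathrm{right}}\mathcal C'_l$. The *C-normal form* $W(\beta;<)$ of $\beta\in B_n^+$ is the positive word representing $\beta$ which has a decomposition whose code is the $<_{\mathrm{right}}$-maximum of all codes of all positive words representing $\beta$. **Φ-normal form.** For $n=2$ the Φ-normal form $N(\sigma_1^p)$ is the word $\sigma_1^p$. For $n\ge3$ write $\beta=\beta_m\cdots\beta_0$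 with $\beta_i=(\beta\beta_0^{-1}\cdots\beta_{i-1}^{-1})\wedge\langle\sigma_2,\dots,\sigma_{n-1}\rangle$ for even $i$ and $\beta_i=(\beta\beta_0^{-1}\cdots\beta_{i-1}^{-1})\wedge\langle\sigma_1,\dots,\sigma_{n-2}\rangle$ for odd $i$; then $N(\beta)=N(\beta_m)\cdots N(\beta_0)$, where the Φ-normal form of $\beta_i$ is formed in $B_{n-1}^+$, through $\mathrm{Sh}$ for $i=0$, the identity for odd $i$ and $D$ for even $i>0$. **Tail-twisted Φ-normal form.** For $n=2$, $\widetilde N(\sigma_1^p;\mathbf k)$ is the word $\sigma_1^p$. For $n\ge3$ let $\mathbf k_0$ be the sequence of the numbers $k(i)-1$ with $k(i)>1$, and for $1\le j\le n-2$ let $\mathbf k_j$ be the sequence of the numbers $k(i)-(m_j-1)$ with $i>j$ and $m_j\le k(i)\le M_j$, both in order of increasing $i$. Put $$\beta_{\mathrm{Tail}}=\beta\wedge\langle\sigma_i : i\ne k(1)\rangle,\quad \beta_{T_0}=(\beta\beta_{\mathrm{Tail}}^{-1})\wedge\langle\sigma_2,\dots,\sigma_{n-1}\rangle,\quad \beta_{\mathrm{Main}}=\beta\beta_{\mathrm{Tail}}^{-1}\beta_{T_0}^{-1},$$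 $$\beta_{T_j}=(\beta_{\mathrm{Tail}}\,\beta_{T_{n-2}}^{-1}\beta_{T_{n-3}}^{-1}\cdots\beta_{T_{j+1}}^{-1})\wedge B_{(j)}^+\qquad(j=n-2,\dots,1).$$ Then $\widetilde N(\beta;\mathbf k)=N(\beta_{\mathrm{Main}})\,\widetilde N(\beta_{T_0};\mathbf k_0)\,\widetilde N(\beta_{T_1};\mathbf k_1)\cdots\widetilde N(\beta_{T_{n-2}};\mathbf k_{n-2})$, where the factors are formed on fewer strands through $\mathrm{Sh}$ and $\mathrm{Sh}^{m_j-1}$. **Proposition.** Let $n\ge 2$ and let $<$ be the normal finite Thurston-type ordering of $B_n$ given by a permutation $\mathbf k$ of $1,\dots,n-1$. For every $\beta\in B_n^+$, the $\mathbf k$-tail-twisted Φ-normal form $\widetilde N(\beta;\mathbf k)$ and the C-normal form $W(\beta;<)$ exist, are uniquely determined positive words representing $\beta$, and coincide: $\widetilde N(\beta;\mathbf k)=W(\beta;<)$. -/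

import Mathlib

namespace BraidNF

/-! ### Braid groups and positive braids -/

/-- Indices of the Artin generators `σ₁, …, σ_{n-1}` of the braid group on `n` strands. -/
abbrev Gen (n : ℕ) : Type := {i : ℕ // 1 ≤ i ∧ i < n}

/-- Artin's relations: `σᵢ σⱼ = σⱼ σᵢ` for `|i - j| ≥ 2`, `σᵢ σⱼ σᵢ = σⱼ σᵢ σⱼ` for `|i - j| = 1`. -/
def artinRels (n : ℕ) : Set (FreeGroup (Gen n)) :=
  {r | ∃ i j : Gen n,
    (i.1 + 2 ≤ j.1 ∧ r = FreeGroup.of i * FreeGroup.of j *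
      (FreeGroup.of j * FreeGroup.of i)⁻¹) ∨
    (i.1 + 1 = j.1 ∧ r = FreeGroup.of i * FreeGroup.of j * FreeGroup.of i *
      (FreeGroup.of j * FreeGroup.of i * FreeGroup.of j)⁻¹)}

/-- The braid group `B_n`. -/
abbrev Braid (n : ℕ) : Type := PresentedGroup (artinRels n)

/-- The generator `σᵢ` of `B_n` (with the dummy value `1` unless `1 ≤ i ≤ n - 1`). -/
def sigma (n i : ℕ) : Braid n :=
  if h : 1 ≤ i ∧ i < n then PresentedGroup.of ⟨i, h⟩ else 1

/-- For a set `S` of indices, the submonoid of `B_n` generated by the `σᵢ`, `i ∈ S`,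
`1 ≤ i ≤ n - 1`. -/
def parabolic (n : ℕ) (S : Set ℕ) : Submonoid (Braid n) :=
  Submonoid.closure {g | ∃ i ∈ S, 1 ≤ i ∧ i < n ∧ g = sigma n i}

/-- The positive braid monoid `B_n⁺`. -/
def positiveBraids (n : ℕ) : Submonoid (Braid n) := parabolic n Set.univ

/-- A positive `n`-braid word `σ_{i₁} ⋯ σ_{iₗ}` is the list `[i₁, …, iₗ]` of its indices. -/
def IsPositiveWord (n : ℕ) (W : List ℕ) : Prop := ∀ i ∈ W, 1 ≤ i ∧ i < n

/-- The braid represented by a positive word. -/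
def eval (n : ℕ) (W : List ℕ) : Braid n := (W.map (sigma n)).prod

theorem sigma_comm (n : ℕ) {i j : ℕ} (hi : 1 ≤ i) (hij : i + 2 ≤ j) (hj : j < n) :
    sigma n i * sigma n j = sigma n j * sigma n i := by
  have h1 : 1 ≤ i ∧ i < n := by omega
  have h2 : 1 ≤ j ∧ j < n := by omega
  rw [sigma, sigma, dif_pos h1, dif_pos h2, ← mul_inv_eq_one]
  exact (PresentedGroup.one_of_mem (rels := artinRels n)
    (x := FreeGroup.of (⟨i, h1⟩ : Gen n) * FreeGroup.of ⟨j, h2⟩ *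
      (FreeGroup.of ⟨j, h2⟩ * FreeGroup.of ⟨i, h1⟩)⁻¹)
    ⟨⟨i, h1⟩, ⟨j, h2⟩, Or.inl ⟨hij, rfl⟩⟩)

theorem sigma_braid (n : ℕ) {i : ℕ} (hi : 1 ≤ i) (hj : i + 1 < n) :
    sigma n i * sigma n (i + 1) * sigma n i =
      sigma n (i + 1) * sigma n i * sigma n (i + 1) := by
  have h1 : 1 ≤ i ∧ i < n := by omega
  have h2 : 1 ≤ i + 1 ∧ i + 1 < n := by omega
  rw [sigma, sigma, dif_pos h1, dif_pos h2, ← mul_inv_eq_one]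
  exact (PresentedGroup.one_of_mem (rels := artinRels n)
    (x := FreeGroup.of (⟨i, h1⟩ : Gen n) * FreeGroup.of ⟨i + 1, h2⟩ * FreeGroup.of ⟨i, h1⟩ *
      (FreeGroup.of ⟨i + 1, h2⟩ * FreeGroup.of ⟨i, h1⟩ * FreeGroup.of ⟨i + 1, h2⟩)⁻¹)
    ⟨⟨i, h1⟩, ⟨i + 1, h2⟩, Or.inr ⟨rfl, rfl⟩⟩)

/-- The homomorphism `B_s → B_n`, `σᵢ ↦ σ_{i+p}`, onto the subgroup generated by
`σ_{p+1}, …, σ_{p+s-1}`: the inverse of the `p`-fold shift map on that subgroup. -/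
def shiftHom (p s n : ℕ) (h : p + s ≤ n) : Braid s →* Braid n :=
  PresentedGroup.toGroup (f := fun i : Gen s => sigma n (i.1 + p)) (by
    rintro r ⟨⟨i, hi⟩, ⟨j, hj⟩, ⟨hij, rfl⟩ | ⟨hij, rfl⟩⟩
    · simp only [map_mul, map_inv, FreeGroup.lift_apply_of]
      rw [mul_inv_eq_one]
      exact sigma_comm n (by omega) (by simp only at hij; omega) (by omega)
    · simp only [map_mul, map_inv, FreeGroup.lift_apply_of]
      rw [mul_inv_eq_one]
      simp only at hij
      subst hij
      have := sigma_braid n (i := i + p) (by omega) (by omega)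
      rwa [show i + p + 1 = i + 1 + p by omega] at this)

/-! ### Normal finite Thurston-type orderings

The fundamental group of the `n`-punctured disc `D_n`, based at the leftmost boundary point, is free
on `x₁, …, x_n`, where `xᵢ` is the loop that passes below the punctures `1, …, i - 1` and runs
counterclockwise around the `i`-th one. With the vertical cuts joining the punctures to the
lower half of the boundary, a path is described by the reduced word of the cuts that it crosses,
`xᵢ` standing for a crossing of the `i`-th cut from left to right. We use the free group on
`x₀, x₁, x₂, …`, of which only `x₁, …, x_n` are involved for `B_n`. -/

/-- The automorphism of the free group induced by the half twist `σᵢ`: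
`xᵢ ↦ x_{i+1}`, `x_{i+1} ↦ x_{i+1}⁻¹ xᵢ x_{i+1}`, the other generators being fixed. The
orientation is such that positive half twists move arcs to the left. -/
def artinAut (i : ℕ) : MulAut (FreeGroup ℕ) :=
  MonoidHom.toMulEquiv
    (FreeGroup.lift fun j =>
      if j = i then FreeGroup.of (i + 1)
      else if j = i + 1 then (FreeGroup.of (i + 1))⁻¹ * FreeGroup.of i * FreeGroup.of (i + 1)
      else FreeGroup.of j)
    (FreeGroup.lift fun j =>
      if j = i then FreeGroup.of i * FreeGroup.of (i + 1) * (FreeGroup.of i)⁻¹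
      else if j = i + 1 then FreeGroup.of i
      else FreeGroup.of j)
    (by
      ext j
      by_cases h1 : j = i
      · subst h1; simp
      · by_cases h2 : j = i + 1
        · subst h2; simp [mul_assoc]
        · simp [h1, h2])
    (by
      ext j
      by_cases h1 : j = i
      · subst h1; simp [mul_assoc]
      · by_cases h2 : j = i + 1
        · subst h2; simp
        · simp [h1, h2])

theorem artinAut_of (i j : ℕ) : artinAut i (FreeGroup.of j) =
    if j = i then FreeGroup.of (i + 1)
    else if j = i + 1 then (FreeGroup.of (i + 1))⁻¹ * FreeGroup.of i * FreeGroup.of (i + 1)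
    else FreeGroup.of j := by
  simp [artinAut]

theorem artinAut_comm {i j : ℕ} (h : i + 2 ≤ j) :
    artinAut i * artinAut j = artinAut j * artinAut i := by
  apply MulEquiv.toMonoidHom_injective
  ext l
  by_cases h1 : l = i
  · subst h1
    simp [artinAut_of, show l ≠ j by omega, show l ≠ j + 1 by omega,
      show l + 1 ≠ j by omega]
  · by_cases h2 : l = i + 1
    · subst h2
      simp [artinAut_of, show i + 1 ≠ j by omega, show i ≠ j by omega, show i ≠ j + 1 by omega]
    · by_cases h3 : l = j
      · subst h3
        simp [artinAut_of, h1, h2, show l + 1 ≠ i by omega]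
      · by_cases h4 : l = j + 1
        · subst h4
          simp [artinAut_of, show j + 1 ≠ i by omega, show j ≠ i by omega, show j ≠ i + 1 by omega]
        · simp [artinAut_of, h1, h2, h3, h4]

theorem artinAut_braid (i : ℕ) :
    artinAut i * artinAut (i + 1) * artinAut i =
      artinAut (i + 1) * artinAut i * artinAut (i + 1) := by
  apply MulEquiv.toMonoidHom_injective
  ext l
  by_cases h1 : l = i
  · subst h1
    simp [artinAut_of, show l + 1 + 1 ≠ l by omega, show l ≠ l + 1 + 1 by omega]
  · by_cases h2 : l = i + 1
    · subst h2
      simp [artinAut_of, show i + 1 + 1 ≠ i by omega, show i ≠ i + 1 + 1 by omega, mul_assoc]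
    · by_cases h3 : l = i + 1 + 1
      · subst h3
        simp [artinAut_of, show i + 1 + 1 ≠ i by omega, show i ≠ i + 1 + 1 by omega, mul_assoc]
      · simp [artinAut_of, h1, h2, h3]

/-- The left action of `B_n` on the fundamental group of the punctured disc. -/
def braidAction (n : ℕ) : Braid n →* MulAut (FreeGroup ℕ) :=
  PresentedGroup.toGroup (f := fun i : Gen n => artinAut i.1) (by
    rintro r ⟨⟨i, hi⟩, ⟨j, hj⟩, ⟨hij, rfl⟩ | ⟨hij, rfl⟩⟩
    · simp only [map_mul, map_inv, FreeGroup.lift_apply_of]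
      rw [mul_inv_eq_one]
      exact artinAut_comm hij
    · simp only [map_mul, map_inv, FreeGroup.lift_apply_of]
      rw [mul_inv_eq_one]
      simp only at hij
      subst hij
      exact artinAut_braid i)

/-- The class of the vertical arc between the `c`-th and the `(c+1)`-st puncture, oriented
upwards and closed up along the boundary to the left: `x₁ x₂ ⋯ x_c`. -/
def arc (c : ℕ) : FreeGroup ℕ := ((List.range' 1 c).map FreeGroup.of).prod

/-- Position of a side of the cut disc, in counterclockwise order starting at the base point
(position `0`): the left side of the `i`-th cut, through which one leaves by crossing `xᵢ`, has
position `2 i + 1`, its right side, through which one leaves by crossing `xᵢ⁻¹`, has position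
`2 i + 2`. -/
def sidePos (a : ℕ × Bool) : ℕ := if a.2 then 2 * a.1 + 1 else 2 * a.1 + 2

/-- Strict counterclockwise cyclic order: entering the cut disc at the boundary position `e`,
the exit `q` lies to the left of the exit `p`. -/
def LeftOf (e p q : ℕ) : Prop := (e < p ∧ p < q) ∨ (p < q ∧ q < e) ∨ (q < e ∧ e < p)

/-- For paths given by reduced words, both entering the cut disc at the position `e`: the second
path is to the left of the first one at their first divergence. A path that ends does so at the
position `0` of the copy of the cut disc in which it is. -/
def DivergesLeft : ℕ → List (ℕ × Bool) → List (ℕ × Bool) → Prop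
  | _, [], [] => False
  | e, [], b :: _ => LeftOf e 0 (sidePos b)
  | e, a :: _, [] => LeftOf e (sidePos a) 0
  | e, a :: u, b :: v =>
      (a = b ∧ DivergesLeft (sidePos (a.1, !a.2)) u v) ∨
      (a ≠ b ∧ LeftOf e (sidePos a) (sidePos b))

/-- The normal finite Thurston-type ordering of `B_n` given by the permutation
`k = (k(1), …, k(n-1))` of `1, …, n-1`, that is, by the curve diagram whose `i`-th arc is the
vertical arc between the punctures `k(i)` and `k(i) + 1`: `α < β` if, for the first `i` such that
the `α`- and the `β`-image of the `i`-th arc differ, the latter diverges to the left. -/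
def normalLT (n : ℕ) (k : List ℕ) (α β : Braid n) : Prop :=
  ∃ (k₁ : List ℕ) (c : ℕ) (k₂ : List ℕ), k = k₁ ++ c :: k₂ ∧
    (∀ d ∈ k₁, braidAction n α (arc d) = braidAction n β (arc d)) ∧
    DivergesLeft 0 (braidAction n α (arc c)).toWord (braidAction n β (arc c)).toWord

/-- `k` is (the one-line notation of) a permutation of `1, …, n-1`. -/
def IsPermutation (n : ℕ) (k : List ℕ) : Prop := k.Perm (List.range' 1 (n - 1))

/-- The Dehornoy ordering, given by the trivial permutation. -/
def dehornoyLT (n : ℕ) : Braid n → Braid n → Prop := normalLT n (List.range' 1 (n - 1))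

/-- The restriction of an ordering of `B_n` to `⟨σ_{p+1}, …, σ_{p+s-1}⟩`, seen as an ordering of
`B_s` by the identification through the `p`-fold shift. -/
def restrictLT {n : ℕ} (lt : Braid n → Braid n → Prop) (p s : ℕ) : Braid s → Braid s → Prop :=
  fun α β => ∃ h : p + s ≤ n, lt (shiftHom p s n h α) (shiftHom p s n h β)

/-! ### Codes and the C-normal form -/

/-- `k(i)`, for `1 ≤ i ≤ n - 1`. -/
def kAt (k : List ℕ) (i : ℕ) : ℕ := k.getD (i - 1) 0

/-- `m_j = max {1, k(i) + 1 | 1 ≤ i ≤ j, k(i) < k(j+1)}`. -/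
def lowerEnd (k : List ℕ) (j : ℕ) : ℕ :=
  (((k.take j).filter fun a => a < kAt k (j + 1)).map (· + 1)).foldr max 1

/-- `M_j = min {n, k(i) | 1 ≤ i ≤ j, k(i) > k(j+1)}`. -/
def upperEnd (n : ℕ) (k : List ℕ) (j : ℕ) : ℕ :=
  ((k.take j).filter fun a => kAt k (j + 1) < a).foldr min n

/-- The number `M_j - m_j + 1` of strands in the interval `I_j = {m_j, …, M_j}`. -/
def strands (n : ℕ) (k : List ℕ) (j : ℕ) : ℕ := upperEnd n k j - lowerEnd k j + 1

/-- Word-level inverse of the `p`-fold shift: `σᵢ ↦ σ_{i+p}`. -/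
def unshift (p : ℕ) (V : List ℕ) : List ℕ := V.map (· + p)

/-- The subword of an `(n+1)`-braid word that is identified with the `n`-braid word `V` when it
stands at place `i ≥ 0`: through the shift for `i = 0`, through the identity for odd `i`, and
through the flip `D(σ_a) = σ_{n+1-a}` of `B_{n+1}` for even `i > 0`. -/
def place (n i : ℕ) (V : List ℕ) : List ℕ :=
  if i = 0 then unshift 1 V else if i % 2 = 1 then V else V.map fun a => n + 1 - a

/-- The word `A_m A_{m-1} ⋯ A_0`. -/
def descWord (A : ℕ → List ℕ) (m : ℕ) : List ℕ := ((List.range (m + 1)).reverse.map A).flatten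

/-- The word `X_1 X_2 ⋯ X_r`. -/
def ascWord (X : ℕ → List ℕ) (r : ℕ) : List ℕ := ((List.range' 1 r).map X).flatten

/-- Codes: integers for 2-braid words, left-infinite sequences of codes otherwise. In `seq c`, the
entries are numbered from the right, starting with `c 0`. -/
inductive Code : Type
  | num : ℕ → Code
  | seq : (ℕ → Code) → Code

/-- The lexicographical ordering from the right. -/
inductive Code.RightLT : Code → Code → Prop
  | num {a b : ℕ} : a < b → Code.RightLT (.num a) (.num b)
  | seq {c d : ℕ → Code} (l : ℕ) : (∀ i < l, c i = d i) → Code.RightLT (c l) (d l) →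
      Code.RightLT (.seq c) (.seq d)

/-- The sequence `(…, C_1, C_0, C_{-1}, …, C_{-r})`, where `C i` is `C_i` for `i ≥ 0` and `E j` is
`C_{-j}` for `1 ≤ j ≤ r`. -/
def mkCode (r : ℕ) (C E : ℕ → Code) : Code :=
  .seq fun p => if p < r then E (r - p) else C (p - r)

/-- `IsCode n lt W c`: for the normal finite Thurston-type ordering `lt` of `B_n`, `c` is the code
of the positive `n`-braid word `W` for some tower of subword decompositions of `W`.

In the recursive case the word of an `(n+1)`-braid is decomposed as
`A_m ⋯ A_1 A_0 X_1 ⋯ X_{n-1}`, where `A_i = place n i (V i)` and `X_j` is the letterwise shift of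
the `(M_j - m_j + 1)`-braid word `Y j`; `A_i` is empty for `i > m`. -/
inductive IsCode : (n : ℕ) → (Braid n → Braid n → Prop) → List ℕ → Code → Prop
  | two (lt : Braid 2 → Braid 2 → Prop) (hlt : lt = dehornoyLT 2) (a : ℕ) :
      IsCode 2 lt (List.replicate a 1) (.num a)
  | step {n : ℕ} (hn : 2 ≤ n) (lt : Braid (n + 1) → Braid (n + 1) → Prop)
      (k : List ℕ) (hk : IsPermutation (n + 1) k) (hlt : lt = normalLT (n + 1) k)
      (m : ℕ) (V Y : ℕ → List ℕ) (C E : ℕ → Code)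
      (hVm : ∀ i, m < i → V i = [])
      (hC0 : IsCode n (restrictLT lt 1 n) (V 0) (C 0))
      (hC : ∀ i, 1 ≤ i → IsCode n (dehornoyLT n) (V i) (C i))
      (hE : ∀ j, 1 ≤ j → j ≤ n - 1 →
        IsCode (strands (n + 1) k j)
          (restrictLT lt (lowerEnd k j - 1) (strands (n + 1) k j)) (Y j) (E j)) :
      IsCode (n + 1) lt
        (descWord (fun i => place n i (V i)) m ++
          ascWord (fun j => unshift (lowerEnd k j - 1) (Y j)) (n - 1))
        (mkCode (n - 1) C E)

/-- `W` is the C-normal form `W(β; lt)` of `β`: the positive word representing `β` that has a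
tower of subword decompositions whose code is the largest, from the right, among the codes of all
positive words representing `β`. -/
def IsCNormalForm (n : ℕ) (lt : Braid n → Braid n → Prop) (β : Braid n) (W : List ℕ) : Prop :=
  ∃ c, IsCode n lt W c ∧ eval n W = β ∧
    ∀ W' c', IsCode n lt W' c' → eval n W' = β → c' = c ∨ Code.RightLT c' c

/-! ### The tail-twisted Φ-normal form -/

/-- `γ = β ∧ B_S⁺`: `γ` is the maximal right divisor of `β` that belongs to the submonoid
generated by the `σᵢ`, `i ∈ S`. -/
structure IsMaxRightDivisor {n : ℕ} (S : Set ℕ) (β γ : Braid n) : Prop where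
  mem : γ ∈ parabolic n S
  dvd : β * γ⁻¹ ∈ positiveBraids n
  max : ∀ δ ∈ parabolic n S, β * δ⁻¹ ∈ positiveBraids n → γ * δ⁻¹ ∈ parabolic n S

/-- `β b_0⁻¹ b_1⁻¹ ⋯ b_{i-1}⁻¹`. -/
def remainder {n : ℕ} (β : Braid n) (b : ℕ → Braid n) : ℕ → Braid n
  | 0 => β
  | i + 1 => remainder β b i * (b i)⁻¹

/-- For `n`-braids, the index set `I = {2, …, n-1}` for even `i` and `J = {1, …, n-2}` for odd
`i`. -/
def altSet (n i : ℕ) : Set ℕ :=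
  if i % 2 = 0 then {a | 2 ≤ a ∧ a ≤ n - 1} else {a | 1 ≤ a ∧ a ≤ n - 2}

/-- `IsPhiNormalForm n β W`: the word `W` is Dehornoy's Φ-normal form of `β ∈ B_n⁺`. In the
recursive case `β = b_m ⋯ b_0` is the alternate decomposition, and `V i` is the Φ-normal form of
the `n`-braid identified with `b i`. -/
inductive IsPhiNormalForm : (n : ℕ) → Braid n → List ℕ → Prop
  | two (p : ℕ) : IsPhiNormalForm 2 (sigma 2 1 ^ p) (List.replicate p 1)
  | step {n : ℕ} (hn : 2 ≤ n) (β : Braid (n + 1)) (m : ℕ) (b : ℕ → Braid (n + 1))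
      (V : ℕ → List ℕ)
      (hb : ∀ i ≤ m, IsMaxRightDivisor (altSet (n + 1) i) (remainder β b i) (b i))
      (hm : remainder β b (m + 1) = 1)
      (hVb : ∀ i ≤ m, eval (n + 1) (place n i (V i)) = b i)
      (hV : ∀ i ≤ m, IsPhiNormalForm n (eval n (V i)) (V i)) :
      IsPhiNormalForm (n + 1) β (descWord (fun i => place n i (V i)) m)

/-- The permutation `k_0`: the values `k(i) > 1`, in order, lowered by `1`. -/
def restPerm (k : List ℕ) : List ℕ := (k.filter fun a => 1 < a).map (· - 1)

/-- The permutation `k_j`: the values `k(i)`, `i > j`, `m_j ≤ k(i) ≤ M_j`, in order, lowered by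
`m_j - 1`. -/
def tailPerm (n : ℕ) (k : List ℕ) (j : ℕ) : List ℕ :=
  ((k.drop j).filter fun a => lowerEnd k j ≤ a ∧ a ≤ upperEnd n k j).map
    (· - (lowerEnd k j - 1))

/-- `β_Tail t_r⁻¹ t_{r-1}⁻¹ ⋯ t_{j+1}⁻¹`. -/
def tailRemainder {n : ℕ} (tail : Braid n) (t : ℕ → Braid n) (r j : ℕ) : Braid n :=
  tail * ((List.range' (j + 1) (r - j)).reverse.map fun l => (t l)⁻¹).prod

/-- `IsTailTwistedNormalForm n k β W`: the word `W` is the `k`-tail-twisted Φ-normal form of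
`β ∈ B_n⁺`. In the recursive case `tail`, `t 0`, `main`, `t j` are `β_Tail`, `β_{T_0}`, `β_Main`,
`β_{T_j}`; the words `V 0` and `V j` are the tail-twisted normal forms of the braids identified
by shifting with `t 0` and `t j`. -/
inductive IsTailTwistedNormalForm : (n : ℕ) → List ℕ → Braid n → List ℕ → Prop
  | two (k : List ℕ) (p : ℕ) :
      IsTailTwistedNormalForm 2 k (sigma 2 1 ^ p) (List.replicate p 1)
  | step {n : ℕ} (hn : 2 ≤ n) (k : List ℕ) (β tail main : Braid (n + 1))
      (t : ℕ → Braid (n + 1)) (N : List ℕ) (V : ℕ → List ℕ)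
      (htail : IsMaxRightDivisor {a | 1 ≤ a ∧ a ≤ n ∧ a ≠ kAt k 1} β tail)
      (ht0 : IsMaxRightDivisor {a | 2 ≤ a ∧ a ≤ n} (β * tail⁻¹) (t 0))
      (hmain : main = β * tail⁻¹ * (t 0)⁻¹)
      (ht : ∀ j, 1 ≤ j → j ≤ n - 1 →
        IsMaxRightDivisor {a | lowerEnd k j ≤ a ∧ a ≤ upperEnd (n + 1) k j - 1}
          (tailRemainder tail t (n - 1) j) (t j))
      (hN : IsPhiNormalForm (n + 1) main N)
      (hV0t : eval (n + 1) (unshift 1 (V 0)) = t 0)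
      (hV0 : IsTailTwistedNormalForm n (restPerm k) (eval n (V 0)) (V 0))
      (hVt : ∀ j, 1 ≤ j → j ≤ n - 1 →
        eval (n + 1) (unshift (lowerEnd k j - 1) (V j)) = t j)
      (hV : ∀ j, 1 ≤ j → j ≤ n - 1 →
        IsTailTwistedNormalForm (strands (n + 1) k j) (tailPerm (n + 1) k j)
          (eval (strands (n + 1) k j) (V j)) (V j)) :
      IsTailTwistedNormalForm (n + 1) k β
        (N ++ unshift 1 (V 0) ++ ascWord (fun j => unshift (lowerEnd k j - 1) (V j)) (n - 1))

end BraidNF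

namespace BraidNF

/-! ### Positive words up to the braid relations -/

/-! Both normal forms are greedy from the right, and the point is that their greedy choices agree.
Codes are compared from the right, so the largest code makes the last tail factor as large as
possible, then the preceding tail factors, then `A_0`, `A_1`, and so on. The tail-twisted form takes
at each of these places the maximal right divisor of what is left in the relevant standard
submonoid. If a competing word has the same code entries to the right of some place, it has the same
factors there, and its factor at that place right-divides the maximal one. So it suffices that
passing to a right divisor never increases the code. To let this run by induction on the number of
strands, the claim is strengthened from words representing `β` to words representing right divisors
of `β`: this is `Dominates`, proved in `IsTailTwistedNormalForm.exists_code`.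

Four ingredients support this argument. Divisibility: Garside's lemma, `garsideUpTo`, gives
cancellation and least common multiples of generators in the presented positive monoid; an action on
fractions with central denominators embeds this monoid into the braid group (`wordEqv_of_eval_eq`),
and maximal right divisors follow (`exists_isMaxRightDivisor`). Orderings: they matter only through
their permutations. Restriction filters and shifts the permutation (`restrictLT_normalLT`), and an
ordering determines its permutation (`normalLT_injective`), so a code relative to an ordering can be
read relative to `k`. Tail: its factors exhaust it (`tailRemainder_zero`), and each of them is
maximal even when the rest of `β` stands in front (`IsMaxRightDivisor.of_tail`). Main part: its
factors are coded with the Dehornoy ordering but written in Φ-normal form. The Φ-normal form is the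
tail-twisted form of the trivial permutation (`IsPhiNormalForm.isTailTwistedNormalForm`), so the
induction hypothesis covers them too.

Finally a code determines its word (`IsCode.word_unique`) and strict comparison is asymmetric, so
the word with the largest code is unique. -/

/-- Indices of commuting generators. -/
def Far (i j : ℕ) : Prop := i + 2 ≤ j ∨ j + 2 ≤ i

/-- Indices of neighbouring generators. -/
def Near (i j : ℕ) : Prop := i + 1 = j ∨ j + 1 = i

theorem Far.symm {i j : ℕ} (h : Far i j) : Far j i := Or.symm h

theorem Near.symm {i j : ℕ} (h : Near i j) : Near j i := Or.symm h

/-- One application of a braid relation inside a positive word. -/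
inductive WordStep : List ℕ → List ℕ → Prop
  | comm {i j : ℕ} (h : Far i j) (W : List ℕ) : WordStep (i :: j :: W) (j :: i :: W)
  | braid {i j : ℕ} (h : Near i j) (W : List ℕ) : WordStep (i :: j :: i :: W) (j :: i :: j :: W)
  | cons (a : ℕ) {W W' : List ℕ} : WordStep W W' → WordStep (a :: W) (a :: W')

/-- Equivalence of positive words under the braid relations. -/
def WordEqv : List ℕ → List ℕ → Prop := Relation.ReflTransGen WordStep

theorem WordStep.symm {W W' : List ℕ} (h : WordStep W W') : WordStep W' W := by
  induction h with
  | comm h W => exact .comm h.symm W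
  | braid h W => exact .braid h.symm W
  | cons a _ ih => exact .cons a ih

namespace WordEqv

theorem refl (W : List ℕ) : WordEqv W W := Relation.ReflTransGen.refl

theorem trans {U V W : List ℕ} (h : WordEqv U V) (h' : WordEqv V W) : WordEqv U W :=
  Relation.ReflTransGen.trans h h'

theorem symm {U V : List ℕ} (h : WordEqv U V) : WordEqv V U :=
  Relation.ReflTransGen.head_induction_on h (.refl _) fun h' _ ih =>
    WordEqv.trans ih (Relation.ReflTransGen.single h'.symm)

theorem cons (a : ℕ) {U V : List ℕ} (h : WordEqv U V) : WordEqv (a :: U) (a :: V) :=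
  Relation.ReflTransGen.lift (a :: ·) (fun _ _ => WordStep.cons a) _ _ h

theorem comm {i j : ℕ} (h : Far i j) (W : List ℕ) : WordEqv (i :: j :: W) (j :: i :: W) :=
  Relation.ReflTransGen.single (.comm h W)

theorem braid {i j : ℕ} (h : Near i j) (W : List ℕ) :
    WordEqv (i :: j :: i :: W) (j :: i :: j :: W) :=
  Relation.ReflTransGen.single (.braid h W)

theorem append_left (U : List ℕ) {V W : List ℕ} (h : WordEqv V W) :
    WordEqv (U ++ V) (U ++ W) := by
  induction U with
  | nil => exact h
  | cons a U ih => exact ih.cons a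

end WordEqv

theorem WordStep.append_right {V W : List ℕ} (h : WordStep V W) (U : List ℕ) :
    WordStep (V ++ U) (W ++ U) := by
  induction h with
  | comm h W => exact .comm h _
  | braid h W => exact .braid h _
  | cons a _ ih => exact .cons a ih

theorem WordStep.length_eq {V W : List ℕ} (h : WordStep V W) : V.length = W.length := by
  induction h with
  | comm h W => rfl
  | braid h W => rfl
  | cons a _ ih => simp [ih]

theorem WordStep.mem {V W : List ℕ} (h : WordStep V W) {a : ℕ} (ha : a ∈ V) : a ∈ W := by
  induction h with
  | comm h W => simp only [List.mem_cons] at ha ⊢; tauto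
  | braid h W => simp only [List.mem_cons] at ha ⊢; tauto
  | cons b _ ih =>
    rcases List.mem_cons.1 ha with rfl | ha
    · simp
    · exact List.mem_cons_of_mem _ (ih ha)

theorem WordStep.reverse {V W : List ℕ} (h : WordStep V W) :
    WordEqv V.reverse W.reverse := by
  induction h with
  | comm h W =>
    simp only [List.reverse_cons, List.append_assoc, List.cons_append, List.nil_append]
    exact (WordEqv.comm h.symm []).append_left _
  | braid h W =>
    simp only [List.reverse_cons, List.append_assoc, List.cons_append, List.nil_append]
    exact (WordEqv.braid h []).append_left _
  | cons b _ ih =>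
    simp only [List.reverse_cons]
    exact Relation.ReflTransGen.lift (· ++ [b]) (fun _ _ h => h.append_right _) _ _ ih

theorem WordStep.map {V W : List ℕ} (h : WordStep V W) {f : ℕ → ℕ}
    (hfar : ∀ i ∈ V, ∀ j ∈ V, Far i j → Far (f i) (f j))
    (hnear : ∀ i ∈ V, ∀ j ∈ V, Near i j → Near (f i) (f j)) :
    WordStep (V.map f) (W.map f) := by
  induction h with
  | comm h W => exact .comm (hfar _ (by simp) _ (by simp) h) _
  | braid h W => exact .braid (hnear _ (by simp) _ (by simp) h) _
  | cons b _ ih =>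
    exact .cons _ (ih (fun i hi j hj => hfar i (by simp [hi]) j (by simp [hj]))
      (fun i hi j hj => hnear i (by simp [hi]) j (by simp [hj])))

namespace WordEqv

theorem append {U U' V V' : List ℕ} (h : WordEqv U U') (h' : WordEqv V V') :
    WordEqv (U ++ V) (U' ++ V') :=
  (Relation.ReflTransGen.lift (· ++ V) (fun _ _ h => h.append_right _) _ _ h).trans
    (h'.append_left _)

theorem length_eq {V W : List ℕ} (h : WordEqv V W) : V.length = W.length := by
  induction h with
  | refl => rfl
  | tail _ h ih => exact ih.trans h.length_eq

theorem mem {V W : List ℕ} (h : WordEqv V W) {a : ℕ} (ha : a ∈ V) : a ∈ W := by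
  induction h with
  | refl => exact ha
  | tail _ h ih => exact h.mem ih

theorem reverse {V W : List ℕ} (h : WordEqv V W) : WordEqv V.reverse W.reverse := by
  induction h with
  | refl => exact .refl _
  | tail _ h ih => exact ih.trans h.reverse

/-- Compatibility of `f` is needed only on the letters of `V`, because braid relations create no new
letters. This matters later, when `f` is a one-sided inverse that is meaningful only on an image. -/
theorem map {V W : List ℕ} (h : WordEqv V W) {f : ℕ → ℕ}
    (hfar : ∀ i ∈ V, ∀ j ∈ V, Far i j → Far (f i) (f j))
    (hnear : ∀ i ∈ V, ∀ j ∈ V, Near i j → Near (f i) (f j)) :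
    WordEqv (V.map f) (W.map f) := by
  induction h with
  | refl => exact .refl _
  | tail h0 h ih =>
    have hm : ∀ {a}, a ∈ _ → a ∈ V := fun ha => WordEqv.mem (WordEqv.symm h0) ha
    exact ih.trans (Relation.ReflTransGen.single (h.map
      (fun i hi j hj => hfar i (hm hi) j (hm hj)) (fun i hi j hj => hnear i (hm hi) j (hm hj))))

/-- A letter that commutes with all letters of a word can be moved through the word. -/
theorem move {a : ℕ} {W : List ℕ} (h : ∀ b ∈ W, Far a b) (U : List ℕ) :
    WordEqv (W ++ a :: U) (a :: (W ++ U)) := by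
  induction W with
  | nil => exact .refl _
  | cons b W ih =>
    exact ((ih fun c hc => h c (by simp [hc])).cons b).trans
      (comm (h b (by simp)).symm _)

end WordEqv

/-! ### Garside's lemma -/

/-- The conclusion of Garside's lemma for an equivalence of `i :: X` and `j :: Y`. -/
def Resolved (i j : ℕ) (X Y : List ℕ) : Prop :=
  (i = j ∧ WordEqv X Y) ∨
  (Far i j ∧ ∃ Z, WordEqv X (j :: Z) ∧ WordEqv Y (i :: Z)) ∨
  (Near i j ∧ ∃ Z, WordEqv X (j :: i :: Z) ∧ WordEqv Y (i :: j :: Z))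

theorem Resolved.symm {i j : ℕ} {X Y : List ℕ} (h : Resolved i j X Y) : Resolved j i Y X := by
  rcases h with ⟨rfl, h⟩ | ⟨h, Z, h1, h2⟩ | ⟨h, Z, h1, h2⟩
  · exact .inl ⟨rfl, h.symm⟩
  · exact .inr (.inl ⟨h.symm, Z, h2, h1⟩)
  · exact .inr (.inr ⟨h.symm, Z, h2, h1⟩)

theorem Resolved.congr {i j : ℕ} {X X' Y Y' : List ℕ} (h : Resolved i j X Y)
    (hX : WordEqv X' X) (hY : WordEqv Y' Y) : Resolved i j X' Y' := by
  rcases h with ⟨rfl, h⟩ | ⟨h, Z, h1, h2⟩ | ⟨h, Z, h1, h2⟩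
  · exact .inl ⟨rfl, hX.trans (h.trans hY.symm)⟩
  · exact .inr (.inl ⟨h, Z, hX.trans h1, hY.trans h2⟩)
  · exact .inr (.inr ⟨h, Z, hX.trans h1, hY.trans h2⟩)

/-- A relation at the head of the word is itself one of the two nontrivial alternatives; a relation
further down leaves the head unchanged. -/
theorem WordStep.resolved {U V : List ℕ} (h : WordStep U V) {i j : ℕ} {X Y : List ℕ}
    (hU : U = i :: X) (hV : V = j :: Y) : Resolved i j X Y := by
  cases h with
  | comm h W =>
    obtain ⟨rfl, rfl⟩ := List.cons.inj hU
    obtain ⟨rfl, rfl⟩ := List.cons.inj hV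
    exact .inr (.inl ⟨h, W, .refl _, .refl _⟩)
  | braid h W =>
    obtain ⟨rfl, rfl⟩ := List.cons.inj hU
    obtain ⟨rfl, rfl⟩ := List.cons.inj hV
    exact .inr (.inr ⟨h, W, .refl _, .refl _⟩)
  | cons a h =>
    obtain ⟨rfl, rfl⟩ := List.cons.inj hU
    obtain ⟨rfl, rfl⟩ := List.cons.inj hV
    exact .inl ⟨rfl, Relation.ReflTransGen.single h⟩

/-- Garside's lemma for words of length at most `L + 1`. -/
def GarsideUpTo (L : ℕ) : Prop :=
  ∀ (i j : ℕ) (X Y : List ℕ), X.length < L → WordEqv (i :: X) (j :: Y) → Resolved i j X Y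

namespace GarsideUpTo

theorem cancel {L : ℕ} (G : GarsideUpTo L) {i : ℕ} {X Y : List ℕ} (hL : X.length < L)
    (h : WordEqv (i :: X) (i :: Y)) : WordEqv X Y := by
  rcases G i i X Y hL h with ⟨_, h⟩ | ⟨h, _⟩ | ⟨h, _⟩
  · exact h
  · unfold Far at h; omega
  · unfold Near at h; omega

theorem far {L : ℕ} (G : GarsideUpTo L) {i j : ℕ} {X Y : List ℕ}
    (hL : X.length < L) (hij : Far i j) (h : WordEqv (i :: X) (j :: Y)) :
    ∃ Z, WordEqv X (j :: Z) ∧ WordEqv Y (i :: Z) := by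
  rcases G i j X Y hL h with ⟨h, _⟩ | ⟨h, h'⟩ | ⟨h, _⟩
  · unfold Far at hij; omega
  · exact h'
  · unfold Far at hij; unfold Near at h; omega

theorem near {L : ℕ} (G : GarsideUpTo L) {i j : ℕ} {X Y : List ℕ}
    (hL : X.length < L) (hij : Near i j) (h : WordEqv (i :: X) (j :: Y)) :
    ∃ Z, WordEqv X (j :: i :: Z) ∧ WordEqv Y (i :: j :: Z) := by
  rcases G i j X Y hL h with ⟨h, _⟩ | ⟨h, h'⟩ | ⟨h, h'⟩
  · unfold Near at hij; omega
  · unfold Far at h; unfold Near at hij; omega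
  · exact h'

end GarsideUpTo

theorem eq_or_far_or_near (i j : ℕ) : i = j ∨ Far i j ∨ Near i j := by
  unfold Far Near; omega

/-- Two neighbours of `k` either coincide or lie on opposite sides of it. In the second case
repeated use of `G` expresses everything through one word `S`, and only relations among three
consecutive generators remain to be applied. -/
theorem Resolved.of_near_of_near {L : ℕ} (G : GarsideUpTo L) {i j k : ℕ} {X V Y Z Z' : List ℕ}
    (hL : V.length ≤ L) (hik : Near i k) (hkj : Near k j) (hX : WordEqv X (k :: i :: Z))
    (hV : WordEqv V (i :: k :: Z)) (hV' : WordEqv V (j :: k :: Z'))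
    (hY : WordEqv Y (k :: j :: Z')) : Resolved i j X Y := by
  have l1 := hV.length_eq
  have l2 := hV'.length_eq
  simp only [List.length_cons] at l1 l2
  have e := hV.symm.trans hV'
  rcases eq_or_far_or_near i j with rfl | hij | hij
  · have e1 := G.cancel (by omega) (G.cancel (by simp; omega) e)
    exact .inl ⟨rfl, hX.trans (((e1.cons _).cons _).trans hY.symm)⟩
  · obtain ⟨U, h1, h2⟩ := G.far (by simp; omega) hij e
    have l3 := h1.length_eq
    simp only [List.length_cons] at l3
    obtain ⟨T, h3, h4⟩ := G.near (by omega) hkj h1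
    obtain ⟨T', h5, h6⟩ := G.near (by omega) hik.symm h2
    have l4 := h3.length_eq
    have l5 := h4.length_eq
    simp only [List.length_cons] at l4 l5
    have e2 := G.cancel (by simp; omega) (h4.symm.trans h6)
    obtain ⟨S, h7, h8⟩ := G.far (by omega) hij.symm e2
    refine .inr (.inl ⟨hij, k :: j :: i :: k :: S, ?_, ?_⟩)
    · refine hX.trans ((((h3.trans ((h7.cons k).cons j)).cons i).cons k).trans ?_)
      refine (((WordEqv.comm hij (k :: i :: S)).cons k)).trans ?_
      refine ((((WordEqv.braid hik S).cons j).cons k)).trans ?_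
      exact WordEqv.braid hkj (i :: k :: S)
    · refine hY.trans ((((h5.trans ((h8.cons k).cons i)).cons j).cons k).trans ?_)
      refine (((WordEqv.comm hij.symm (k :: j :: S)).cons k)).trans ?_
      refine ((((WordEqv.braid hkj.symm S).cons i).cons k)).trans ?_
      refine (WordEqv.braid hik.symm (j :: k :: S)).trans ?_
      exact ((WordEqv.comm hij (k :: S)).cons k).cons i
  · unfold Near at hik hkj hij; omega

/-- Here `i = j` is impossible. Either `i` and `j` commute, or the three generators are consecutive
with `i` in the middle. -/
theorem Resolved.of_near_of_far {L : ℕ} (G : GarsideUpTo L) {i j k : ℕ} {X V Y Z Z' : List ℕ}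
    (hL : V.length ≤ L) (hik : Near i k) (hkj : Far k j) (hX : WordEqv X (k :: i :: Z))
    (hV : WordEqv V (i :: k :: Z)) (hV' : WordEqv V (j :: Z'))
    (hY : WordEqv Y (k :: Z')) : Resolved i j X Y := by
  have l1 := hV.length_eq
  have l2 := hV'.length_eq
  simp only [List.length_cons] at l1 l2
  have e := hV.symm.trans hV'
  rcases eq_or_far_or_near i j with rfl | hij | hij
  · unfold Near at hik; unfold Far at hkj; omega
  · obtain ⟨U, h1, h2⟩ := G.far (by simp; omega) hij e
    have l3 := h1.length_eq
    simp only [List.length_cons] at l3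
    obtain ⟨T, h3, h4⟩ := G.far (by omega) hkj h1
    refine .inr (.inl ⟨hij, k :: i :: T, ?_, ?_⟩)
    · refine hX.trans (((h3.cons i).cons k).trans ?_)
      exact ((WordEqv.comm hij T).cons k).trans (WordEqv.comm hkj (i :: T))
    · refine hY.trans (((h2.trans (h4.cons i)).cons k).trans ?_)
      exact WordEqv.braid hik.symm T
  · obtain ⟨U, h1, h2⟩ := G.near (by simp; omega) hij e
    have l3 := h1.length_eq
    simp only [List.length_cons] at l3
    obtain ⟨T, h3, h4⟩ := G.far (by omega) hkj h1
    have l4 := h4.length_eq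
    simp only [List.length_cons] at l4
    obtain ⟨S, h5, h6⟩ := G.near (by omega) hik h4
    refine .inr (.inr ⟨hij, k :: i :: j :: S, ?_, ?_⟩)
    · refine hX.trans ((((h3.trans (h6.cons j)).cons i).cons k).trans ?_)
      refine (((WordEqv.braid hij (k :: S)).cons k)).trans ?_
      refine (WordEqv.comm hkj (i :: j :: k :: S)).trans ?_
      refine (((((WordEqv.comm hkj.symm S).cons i).cons k).cons j)).trans ?_
      exact (WordEqv.braid hik.symm (j :: S)).cons j
    · refine hY.trans (((h2.trans ((h5.cons j).cons i)).cons k).trans ?_)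
      refine ((((WordEqv.comm hkj.symm (i :: S)).cons i).cons k)).trans ?_
      refine (WordEqv.braid hik.symm (j :: i :: S)).trans ?_
      refine (((WordEqv.braid hij S).cons k).cons i).trans ?_
      exact ((WordEqv.comm hkj (i :: j :: S)).cons i)

theorem Resolved.of_far_of_far {L : ℕ} (G : GarsideUpTo L) {i j k : ℕ} {X V Y Z Z' : List ℕ}
    (hL : V.length ≤ L) (hik : Far i k) (hkj : Far k j) (hX : WordEqv X (k :: Z))
    (hV : WordEqv V (i :: Z)) (hV' : WordEqv V (j :: Z'))
    (hY : WordEqv Y (k :: Z')) : Resolved i j X Y := by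
  have l1 := hV.length_eq
  simp only [List.length_cons] at l1
  have e := hV.symm.trans hV'
  rcases eq_or_far_or_near i j with rfl | hij | hij
  · exact .inl ⟨rfl, hX.trans (((G.cancel (by omega) e).cons k).trans hY.symm)⟩
  · obtain ⟨U, h1, h2⟩ := G.far (by omega) hij e
    exact .inr (.inl ⟨hij, k :: U,
      hX.trans ((h1.cons k).trans (.comm hkj U)),
      hY.trans ((h2.cons k).trans (.comm hik.symm U))⟩)
  · obtain ⟨U, h1, h2⟩ := G.near (by omega) hij e
    exact .inr (.inr ⟨hij, k :: U,
      hX.trans ((h1.cons k).trans ((WordEqv.comm hkj _).trans ((WordEqv.comm hik.symm U).cons j))),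
      hY.trans ((h2.cons k).trans ((WordEqv.comm hik.symm _).trans ((WordEqv.comm hkj U).cons i)))⟩)

/-- The two resolutions express `V` in two ways. Since the head `k` has been removed, `V` is short
enough for `G` to compare these expressions. The case of a commuting pair followed by a neighbouring
pair is the opposite case read backwards. -/
theorem Resolved.trans {L : ℕ} (G : GarsideUpTo L) {i j k : ℕ} {X V Y : List ℕ}
    (hL : V.length ≤ L) (h : Resolved i k X V) (h' : Resolved k j V Y) : Resolved i j X Y := by
  rcases h with ⟨rfl, h⟩ | ⟨hik, Z, hX, hV⟩ | ⟨hik, Z, hX, hV⟩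
  · exact h'.congr h (.refl _)
  · rcases h' with ⟨rfl, h'⟩ | ⟨hkj, Z', hV', hY⟩ | ⟨hkj, Z', hV', hY⟩
    · exact .inr (.inl ⟨hik, Z, hX, h'.symm.trans hV⟩)
    · exact .of_far_of_far G hL hik hkj hX hV hV' hY
    · exact (Resolved.of_near_of_far G hL hkj.symm hik.symm hY hV' hV hX).symm
  · rcases h' with ⟨rfl, h'⟩ | ⟨hkj, Z', hV', hY⟩ | ⟨hkj, Z', hV', hY⟩
    · exact .inr (.inr ⟨hik, Z, hX, h'.symm.trans hV⟩)
    · exact .of_near_of_far G hL hik hkj hX hV hV' hY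
    · exact .of_near_of_near G hL hik hkj hX hV hV' hY

/-- Double induction: on the length, and inside it on the number of relations applied. The last
relation of the chain is resolved directly and composed with the resolution of the shorter chain. -/
theorem garsideUpTo (L : ℕ) : GarsideUpTo L := by
  induction L with
  | zero => intro i j X Y h; omega
  | succ L G =>
    intro i j X Y hL h
    suffices ∀ U, WordEqv (i :: X) U → ∀ j Y, U = j :: Y → Resolved i j X Y from
      this _ h _ _ rfl
    intro U hU
    induction hU with
    | refl =>
      intro j Y h
      obtain ⟨rfl, rfl⟩ := List.cons.inj h
      exact .inl ⟨rfl, .refl _⟩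
    | @tail V W hV hVW ih =>
      intro j Y hW
      have l := WordEqv.length_eq hV
      cases V with
      | nil => simp at l
      | cons k V =>
        simp only [List.length_cons] at l
        exact (ih k V rfl).trans G (by omega) (hVW.resolved rfl hW)

/-- Garside's lemma. -/
theorem WordEqv.resolved {i j : ℕ} {X Y : List ℕ} (h : WordEqv (i :: X) (j :: Y)) :
    Resolved i j X Y :=
  garsideUpTo _ i j X Y (Nat.lt_succ_self _) h

theorem WordEqv.cancel {i : ℕ} {X Y : List ℕ} (h : WordEqv (i :: X) (i :: Y)) : WordEqv X Y :=
  (garsideUpTo _).cancel (Nat.lt_succ_self _) h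

theorem WordEqv.append_cancel {U X Y : List ℕ} (h : WordEqv (U ++ X) (U ++ Y)) :
    WordEqv X Y := by
  induction U with
  | nil => exact h
  | cons a U ih => exact ih h.cancel

/-! ### The positive monoid and its embedding into the braid group -/

/-- The congruence of the braid relations. -/
def wordCon : Con (FreeMonoid ℕ) where
  r U V := WordEqv U.toList V.toList
  iseqv := ⟨fun _ => .refl _, fun h => h.symm, fun h h' => h.trans h'⟩
  mul' h h' := by simpa using h.append h'

/-- The monoid of positive braids on infinitely many strands, defined by generators and
relations. -/
abbrev PosMonoid : Type := wordCon.Quotient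

/-- The class of a positive word. -/
def PosMonoid.mk (W : List ℕ) : PosMonoid := (FreeMonoid.ofList W : FreeMonoid ℕ)

namespace PosMonoid

theorem mk_eq_mk {U V : List ℕ} : mk U = mk V ↔ WordEqv U V := Con.eq wordCon

theorem mk_append (U V : List ℕ) : mk (U ++ V) = mk U * mk V := rfl

theorem mk_cons (a : ℕ) (V : List ℕ) : mk (a :: V) = mk [a] * mk V := rfl

theorem exists_mk (x : PosMonoid) : ∃ W, x = mk W :=
  Con.induction_on x fun W => ⟨W.toList, rfl⟩

theorem mul_left_cancel {x y z : PosMonoid} (h : x * y = x * z) : y = z := by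
  obtain ⟨X, rfl⟩ := exists_mk x
  obtain ⟨Y, rfl⟩ := exists_mk y
  obtain ⟨Z, rfl⟩ := exists_mk z
  rw [← mk_append, ← mk_append, mk_eq_mk] at h
  exact mk_eq_mk.2 h.append_cancel

/-! ### The central element of the positive monoid -/

/-- The braid `σ₁ σ₂ ⋯ σ_{n-1}`. -/
def delta (n : ℕ) : PosMonoid := mk (List.range' 1 (n - 1))

/-- Moving left, `σ_i` commutes with the letters beyond `i + 1`, becomes `σ_{i+1}` by a single braid
relation at `σ_i σ_{i+1}`, and commutes with the letters below `i`. -/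
theorem delta_mul_gen {n i : ℕ} (hi : 1 ≤ i) (hn : i + 1 < n) :
    delta n * mk [i] = mk [i + 1] * delta n := by
  have e : List.range' 1 (n - 1) =
      List.range' 1 (i - 1) ++ i :: (i + 1) :: List.range' (i + 2) (n - 2 - i) := by
    have h1 : n - 1 = (i - 1) + ((n - 2 - i) + 1 + 1) := by omega
    rw [h1, ← List.range'_append_1, show 1 + (i - 1) = i by omega, List.range'_succ,
      List.range'_succ]
  rw [delta, e, ← mk_append, ← mk_append, mk_eq_mk]
  simp only [List.append_assoc, List.cons_append, List.nil_append]
  refine (WordEqv.append_left _ (((WordEqv.move (a := i) (U := []) ?_).cons (i + 1)).cons i)).trans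
    ((WordEqv.append_left _ (WordEqv.braid (.inl rfl) _)).trans ?_)
  · intro b hb
    rw [List.mem_range'_1] at hb
    unfold Far; omega
  · rw [List.append_nil]
    apply WordEqv.move
    intro b hb
    rw [List.mem_range'_1] at hb
    unfold Far; omega

/-- Split off the last letter `σ_{n-1}` of the second `δ`. Moving the first `δ` across the rest
turns it into `σ_2 ⋯ σ_{n-1}`, which the leading `σ_1` completes to `δ`. This closes the rotation of
the generators by `δ` into a cycle. -/
theorem gen_mul_delta_sq {n : ℕ} (hn : 2 ≤ n) :
    mk [1] * (delta n * delta n) = delta n * delta n * mk [n - 1] := by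
  obtain ⟨m, rfl⟩ : ∃ m, n = m + 2 := ⟨n - 2, by omega⟩
  have e1 : delta (m + 2) = mk [1] * mk (List.range' 2 m) := by
    rw [delta, show m + 2 - 1 = m + 1 by omega, List.range'_succ, mk_cons]
  have e2 : delta (m + 2) = mk (List.range' 1 m) * mk [m + 1] := by
    rw [delta, show m + 2 - 1 = m + 1 by omega, List.range'_1_concat, mk_append, add_comm]
  have e3 : ∀ l ≤ m, delta (m + 2) * mk (List.range' 1 l) =
      mk (List.range' 2 l) * delta (m + 2) := by
    intro l hl
    induction l with
    | zero => exact (mul_one _).trans (one_mul _).symm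
    | succ l ih =>
      rw [List.range'_1_concat, List.range'_1_concat, mk_append, mk_append, ← mul_assoc,
        ih (by omega), mul_assoc, delta_mul_gen (i := 1 + l) (by omega) (by omega), mul_assoc,
        show 1 + l + 1 = 2 + l by omega]
  calc mk [1] * (delta (m + 2) * delta (m + 2))
      = mk [1] * (delta (m + 2) * mk (List.range' 1 m) * mk [m + 1]) := by
        conv_lhs => rw [show delta (m + 2) * delta (m + 2) =
          delta (m + 2) * (mk (List.range' 1 m) * mk [m + 1]) by rw [← e2]]
        rw [mul_assoc (delta (m + 2))]
    _ = mk [1] * mk (List.range' 2 m) * delta (m + 2) * mk [m + 1] := by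
        rw [e3 m le_rfl]; simp only [mul_assoc]
    _ = _ := by rw [← e1]; rfl

/-- The central element `(σ₁ ⋯ σ_{n-1})ⁿ`. -/
def fullTwist (n : ℕ) : PosMonoid := delta n ^ n

theorem delta_pow_mul_gen {n i : ℕ} (hi : 1 ≤ i) (l : ℕ) (hn : i + l < n) :
    delta n ^ l * mk [i] = mk [i + l] * delta n ^ l := by
  induction l with
  | zero => simp
  | succ l ih =>
    rw [pow_succ', mul_assoc, ih (by omega), ← mul_assoc, delta_mul_gen (i := i + l) (by omega) (by omega),
      mul_assoc, add_assoc]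

/-- On its way from right to left through `δ^n` the generator climbs from index `i` to `n - 1`, is
sent to index `1` by `δ²`, and climbs back to `i` through the remaining `i - 1` factors. -/
theorem fullTwist_comm {n i : ℕ} (hi : 1 ≤ i) (hn : i < n) : Commute (fullTwist n) (mk [i]) := by
  have e : fullTwist n = delta n ^ (i - 1) * (delta n * delta n) * delta n ^ (n - 1 - i) := by
    rw [fullTwist, ← sq, ← pow_add, ← pow_add]; congr 1; omega
  have h1 := delta_pow_mul_gen hi (n - 1 - i) (n := n) (by omega)
  have h2 := delta_pow_mul_gen (n := n) le_rfl (i - 1) (by omega)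
  rw [show i + (n - 1 - i) = n - 1 by omega] at h1
  rw [show 1 + (i - 1) = i by omega] at h2
  rw [Commute, SemiconjBy, e, mul_assoc _ _ (mk [i]), h1, ← mul_assoc, mul_assoc _ _ (mk [n - 1]),
    ← gen_mul_delta_sq (n := n) (by omega), ← mul_assoc, h2]
  simp only [mul_assoc]

/-- `δ` begins with `σ_1`, and `δ^(i-1)` carries `σ_1` to `σ_i`. The cofactor serves as the
numerator of the inverse of `σ_i`. -/
theorem gen_dvd_fullTwist {n i : ℕ} (hi : 1 ≤ i) (hn : i < n) : ∃ h, fullTwist n = mk [i] * h := by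
  have h2 := delta_pow_mul_gen (n := n) le_rfl (i - 1) (by omega)
  rw [show 1 + (i - 1) = i by omega] at h2
  have e1 : delta n = mk [1] * mk (List.range' 2 (n - 2)) := by
    rw [delta, show n - 1 = n - 2 + 1 by omega, List.range'_succ, mk_cons]
  refine ⟨delta n ^ (i - 1) * (mk (List.range' 2 (n - 2)) * delta n ^ (n - i)), ?_⟩
  rw [← mul_assoc, ← h2, mul_assoc, ← mul_assoc (mk [1]), ← e1, ← pow_succ', ← pow_add, fullTwist]
  congr 1; omega

/-! ### Embedding of the positive monoid into the braid group -/

/-- Fractions with denominators the powers of the central element. -/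
def fracSetoid (n : ℕ) : Setoid (PosMonoid × ℕ) where
  r x y := fullTwist n ^ y.2 * x.1 = fullTwist n ^ x.2 * y.1
  iseqv := ⟨fun _ => rfl, fun h => h.symm, fun {x y z} h h' => by
    apply mul_left_cancel (x := fullTwist n ^ y.2)
    rw [← mul_assoc, ← pow_add, add_comm, pow_add, mul_assoc, h, ← mul_assoc, ← pow_add,
      add_comm, pow_add, mul_assoc, h', ← mul_assoc, ← pow_add, add_comm, pow_add, mul_assoc]⟩

/-- The set of fractions. -/
abbrev Frac (n : ℕ) : Type := Quotient (fracSetoid n)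

/-- Left multiplication of fractions. -/
def fracMul {n : ℕ} (x : PosMonoid) (c : ℕ) (hx : Commute (fullTwist n) x) : Frac n → Frac n :=
  Quotient.map (fun y => (x * y.1, y.2 + c)) fun y z (h : _ = _) => by
    show fullTwist n ^ (z.2 + c) * (x * y.1) = fullTwist n ^ (y.2 + c) * (x * z.1)
    rw [← mul_assoc, ← mul_assoc, (hx.pow_left _).eq, (hx.pow_left _).eq, mul_assoc, mul_assoc,
      add_comm, pow_add, mul_assoc, h, add_comm _ c, pow_add, mul_assoc]

theorem commute_of_mul_eq {w x h : PosMonoid} (hx : Commute w x) (e : w = x * h) :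
    Commute w h := by
  apply mul_left_cancel (x := x)
  rw [← mul_assoc, ← hx.eq, mul_assoc, ← e, ← mul_assoc, ← e]

/-- The permutation of the fractions by which a generator acts. -/
noncomputable def fracPerm {n : ℕ} (i : Gen n) : Equiv.Perm (Frac n) :=
  have hc := fullTwist_comm i.2.1 i.2.2
  have he := (gen_dvd_fullTwist i.2.1 i.2.2).choose_spec
  -- A pair `(x, a)` stands for `x` divided by the `a`-th power of the central element. Hence the
  -- inverse of a generator multiplies by its cofactor in the central element and raises the
  -- exponent by one.
  { toFun := fracMul (mk [i.1]) 0 hc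
    invFun := fracMul (gen_dvd_fullTwist i.2.1 i.2.2).choose 1 (commute_of_mul_eq hc he)
    left_inv := by
      rintro ⟨x⟩
      refine Quotient.sound (show _ = _ from ?_)
      have : (gen_dvd_fullTwist i.2.1 i.2.2).choose * mk [i.1] = fullTwist n := by
        apply mul_left_cancel (x := mk [i.1])
        rw [← mul_assoc, ← he, hc.eq]
      simp only
      rw [← mul_assoc _ (mk [i.1]), this, ← mul_assoc, ← pow_succ, add_zero]
    right_inv := by
      rintro ⟨x⟩
      refine Quotient.sound (show _ = _ from ?_)
      simp only
      rw [← mul_assoc (mk [i.1]), ← he, ← mul_assoc, ← pow_succ, add_zero] }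

theorem fracPerm_mk {n : ℕ} (i : Gen n) (x : PosMonoid) (a : ℕ) :
    fracPerm i (Quotient.mk _ (x, a)) = Quotient.mk _ (mk [i.1] * x, a) := rfl

/-- The action of the braid group on fractions. -/
noncomputable def fracAction (n : ℕ) : Braid n →* Equiv.Perm (Frac n) :=
  PresentedGroup.toGroup (f := fracPerm) (by
    rintro r ⟨i, j, ⟨hij, rfl⟩ | ⟨hij, rfl⟩⟩ <;>
    · simp only [map_mul, map_inv, FreeGroup.lift_apply_of]
      rw [mul_inv_eq_one]
      ext ⟨x, a⟩
      refine congrArg (fun y => Quotient.mk (fracSetoid n) (y, a)) ?_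
      obtain ⟨X, rfl⟩ := exists_mk x
      simp only [← mk_append, mk_eq_mk, List.cons_append, List.nil_append]
      first
      | exact WordEqv.comm (.inl hij) X
      | exact WordEqv.braid (.inl hij) X)

end PosMonoid

theorem eval_cons (n a : ℕ) (W : List ℕ) : eval n (a :: W) = sigma n a * eval n W := by
  simp [eval]

theorem eval_nil (n : ℕ) : eval n [] = 1 := by simp [eval]

theorem eval_append (n : ℕ) (U V : List ℕ) : eval n (U ++ V) = eval n U * eval n V := by
  simp [eval]

/-- The image of the fraction `(1, 0)` remembers the class of the word; this is how the action
separates positive braids. -/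
theorem PosMonoid.fracAction_eval {n : ℕ} {W : List ℕ} (hW : IsPositiveWord n W) :
    fracAction n (eval n W) (Quotient.mk _ (1, 0)) = Quotient.mk _ (mk W, 0) := by
  induction W with
  | nil => rw [eval_nil, map_one]; rfl
  | cons a W ih =>
    have ha := hW a (by simp)
    rw [eval_cons, map_mul, Equiv.Perm.mul_apply, ih fun b hb => hW b (by simp [hb]), sigma,
      dif_pos ha, fracAction, PresentedGroup.toGroup.of, fracPerm_mk, ← mk_cons]

/-- The presented monoid of positive braids embeds into the braid group. -/
theorem wordEqv_of_eval_eq {n : ℕ} {U V : List ℕ} (hU : IsPositiveWord n U)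
    (hV : IsPositiveWord n V) (h : eval n U = eval n V) : WordEqv U V := by
  have h1 := PosMonoid.fracAction_eval hU
  rw [h, PosMonoid.fracAction_eval hV] at h1
  have h2 : _ = _ := Quotient.exact h1
  simp only [pow_zero, one_mul] at h2
  exact PosMonoid.mk_eq_mk.1 h2.symm

theorem sigma_mul_comm_of_far {n i j : ℕ} (hi : 1 ≤ i ∧ i < n) (hj : 1 ≤ j ∧ j < n)
    (h : Far i j) : sigma n i * sigma n j = sigma n j * sigma n i := by
  rcases h with h | h
  · exact sigma_comm n hi.1 h hj.2
  · exact (sigma_comm n hj.1 h hi.2).symm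

theorem WordEqv.eval_eq {n : ℕ} {U V : List ℕ} (h : WordEqv U V) (hU : IsPositiveWord n U) :
    eval n U = eval n V := by
  induction h with
  | refl => rfl
  | @tail V W hUV h ih =>
    refine ih.trans ?_
    have hV : IsPositiveWord n V := fun a ha => hU a (WordEqv.mem (WordEqv.symm hUV) ha)
    clear ih hUV
    induction h with
    | @comm i j h W =>
      simp only [eval_cons, ← mul_assoc]
      rw [sigma_mul_comm_of_far (hV i (by simp)) (hV j (by simp)) h]
    | @braid i j h W =>
      simp only [eval_cons, ← mul_assoc]
      have hi := hV i (by simp)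
      have hj := hV j (by simp)
      rcases h with rfl | rfl
      · rw [sigma_braid n hi.1 hj.2]
      · rw [sigma_braid n hj.1 hi.2]
    | cons a _ ih =>
      rw [eval_cons, eval_cons, ih fun b hb => hV b (by simp [hb])]

/-! ### Restrictions of normal orderings, and their injectivity -/

theorem not_normalLT_nil (n : ℕ) (α β : Braid n) : ¬ normalLT n [] α β := by
  rintro ⟨k₁, c, k₂, h, _⟩
  simp at h

/-- A recursive description of the ordering, so that orderings can be compared by induction along
the list of arcs. -/
theorem normalLT_cons (n c : ℕ) (k : List ℕ) (α β : Braid n) :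
    normalLT n (c :: k) α β ↔
      (braidAction n α (arc c) = braidAction n β (arc c) ∧ normalLT n k α β) ∨
      DivergesLeft 0 (braidAction n α (arc c)).toWord (braidAction n β (arc c)).toWord := by
  constructor
  · rintro ⟨k₁, d, k₂, h, h1, h2⟩
    cases k₁ with
    | nil =>
      obtain ⟨rfl, rfl⟩ := List.cons.inj h
      exact .inr h2
    | cons a k₁ =>
      obtain ⟨rfl, rfl⟩ := List.cons.inj h
      exact .inl ⟨h1 _ (by simp), k₁, d, k₂, rfl, fun x hx => h1 x (by simp [hx]), h2⟩
  · rintro (⟨h0, k₁, d, k₂, rfl, h1, h2⟩ | h)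
    · refine ⟨c :: k₁, d, k₂, rfl, fun x hx => ?_, h2⟩
      rcases List.mem_cons.1 hx with rfl | hx
      · exact h0
      · exact h1 x hx
    · exact ⟨[], c, k, rfl, by simp, h⟩

theorem divergesLeft_cons_same (e : ℕ) (a : ℕ × Bool) (u v : List (ℕ × Bool)) :
    DivergesLeft e (a :: u) (a :: v) ↔ DivergesLeft (sidePos (a.1, !a.2)) u v := by
  simp [DivergesLeft]

theorem not_divergesLeft_self (e : ℕ) (u : List (ℕ × Bool)) : ¬ DivergesLeft e u u := by
  induction u generalizing e with
  | nil => simp [DivergesLeft]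
  | cons a u ih => rw [divergesLeft_cons_same]; exact ih _

/-! ### Reduced words of arcs, and shifts of paths -/

theorem arc_succ (c : ℕ) : arc (c + 1) = arc c * FreeGroup.of (c + 1) := by
  simp [arc, List.range'_1_concat, add_comm]

/-- The reduced word of an arc. -/
def arcWord (c : ℕ) : List (ℕ × Bool) := (List.range' 1 c).map fun i => (i, true)

theorem arcWord_succ (c : ℕ) : arcWord (c + 1) = arcWord c ++ [(c + 1, true)] := by
  simp [arcWord, List.range'_1_concat, add_comm]

theorem mk_arcWord (c : ℕ) : FreeGroup.mk (arcWord c) = arc c := by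
  induction c with
  | zero => rfl
  | succ c ih => rw [arcWord_succ, arc_succ, ← FreeGroup.mul_mk, ih]; rfl

theorem isReduced_of_forall {u : List (ℕ × Bool)} (h : ∀ a ∈ u, a.2 = true) :
    FreeGroup.IsReduced u := by
  induction u with
  | nil => simp
  | cons a u ih =>
    have h1 := ih fun b hb => h b (by simp [hb])
    cases u with
    | nil => simp
    | cons b u =>
      rw [FreeGroup.IsReduced, List.isChain_cons_cons]
      exact ⟨fun _ => (h a (by simp)).trans (h b (by simp)).symm, h1⟩

theorem isReduced_map_add {u : List (ℕ × Bool)} (h : FreeGroup.IsReduced u) (p : ℕ) :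
    FreeGroup.IsReduced (u.map fun a => (a.1 + p, a.2)) := by
  rw [FreeGroup.IsReduced, List.isChain_map]
  exact h.imp fun a b h e => h (by simpa using e)

/-- The shift of the generators of the free group. -/
def freeShift (p : ℕ) : FreeGroup ℕ →* FreeGroup ℕ := FreeGroup.map (· + p)

theorem arc_add (p c : ℕ) : arc (c + p) = arc p * freeShift p (arc c) := by
  induction c with
  | zero => simp [arc]
  | succ c ih =>
    rw [show c + 1 + p = c + p + 1 by omega, arc_succ, ih, arc_succ, map_mul, mul_assoc]
    simp [freeShift, show c + p + 1 = c + 1 + p by omega]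

theorem toWord_freeShift (p : ℕ) (w : FreeGroup ℕ) :
    (freeShift p w).toWord = w.toWord.map fun a => (a.1 + p, a.2) := by
  conv_lhs => rw [← FreeGroup.mk_toWord (x := w), freeShift, FreeGroup.map.mk,
    FreeGroup.toWord_mk]
  exact (isReduced_map_add FreeGroup.isReduced_toWord p).reduce_eq

/-- Nothing cancels: the letters of the arc have indices at most `p`, those of the shifted word have
larger ones. -/
theorem toWord_arc_mul_freeShift (p : ℕ) {w : FreeGroup ℕ} (hw : ∀ a ∈ w.toWord, 1 ≤ a.1) :
    (arc p * freeShift p w).toWord =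
      arcWord p ++ w.toWord.map fun a => (a.1 + p, a.2) := by
  rw [← mk_arcWord]
  conv_lhs => rw [← FreeGroup.mk_toWord (x := freeShift p w), toWord_freeShift,
    FreeGroup.mul_mk, FreeGroup.toWord_mk]
  refine FreeGroup.IsReduced.reduce_eq ?_
  rw [FreeGroup.IsReduced, List.isChain_append]
  refine ⟨isReduced_of_forall (by simp [arcWord]),
    isReduced_map_add FreeGroup.isReduced_toWord p, ?_⟩
  intro x hx y hy e
  have h1 := List.mem_of_mem_getLast? hx
  have h2 := List.mem_of_mem_head? hy
  simp only [arcWord, List.mem_map, List.mem_range'_1] at h1 h2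
  obtain ⟨i, hi, rfl⟩ := h1
  obtain ⟨a, ha, rfl⟩ := h2
  have := hw a ha
  simp only at e
  omega

/-- The position at which the cut disc is entered after the word of an arc. -/
def arcEntry (p : ℕ) : ℕ := if p = 0 then 0 else 2 * p + 2

theorem divergesLeft_arcWord_append (p : ℕ) (u v : List (ℕ × Bool)) :
    DivergesLeft 0 (arcWord p ++ u) (arcWord p ++ v) ↔ DivergesLeft (arcEntry p) u v := by
  induction p generalizing u v with
  | zero => rfl
  | succ p ih =>
    rw [arcWord_succ, List.append_assoc, List.append_assoc, ih]
    simp only [List.cons_append, List.nil_append]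
    rw [divergesLeft_cons_same]
    simp [sidePos, arcEntry]

theorem sidePos_add (a : ℕ × Bool) (p : ℕ) : sidePos (a.1 + p, a.2) = sidePos a + 2 * p := by
  obtain ⟨a, _ | _⟩ := a <;> simp [sidePos] <;> ring

theorem three_le_sidePos {a : ℕ × Bool} (h : 1 ≤ a.1) : 3 ≤ sidePos a := by
  obtain ⟨a, _ | _⟩ := a <;> simp only [sidePos] at h ⊢ <;> simp <;> omega

/-- All sides of cuts move by `2 * p` while the end position `0` stays put. Positions from `3` on
lie above `0` both before and after the shift, so no cyclic comparison changes. -/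
theorem divergesLeft_map_add (p : ℕ) {e : ℕ} (he : 3 ≤ e) {u v : List (ℕ × Bool)}
    (hu : ∀ a ∈ u, 1 ≤ a.1) (hv : ∀ a ∈ v, 1 ≤ a.1) :
    DivergesLeft (e + 2 * p) (u.map fun a => (a.1 + p, a.2)) (v.map fun a => (a.1 + p, a.2)) ↔
      DivergesLeft e u v := by
  induction u generalizing e v with
  | nil =>
    cases v with
    | nil => simp [DivergesLeft]
    | cons b v =>
      have := three_le_sidePos (hv b (by simp))
      simp only [List.map_nil, List.map_cons, DivergesLeft, sidePos_add, LeftOf]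
      omega
  | cons a u ih =>
    have ha := three_le_sidePos (hu a (by simp))
    cases v with
    | nil =>
      simp only [List.map_nil, List.map_cons, DivergesLeft, sidePos_add, LeftOf]
      omega
    | cons b v =>
      have hb := three_le_sidePos (hv b (by simp))
      have e1 : ((a.1 + p, a.2) = (b.1 + p, b.2)) ↔ a = b := by
        rw [Prod.ext_iff, Prod.ext_iff]; simp
      have h3 : 3 ≤ sidePos (a.1, !a.2) := three_le_sidePos (a := (a.1, !a.2)) (hu a (by simp))
      have := ih (e := sidePos (a.1, !a.2)) (v := v) h3 (fun c hc => hu c (by simp [hc]))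
        (fun c hc => hv c (by simp [hc]))
      rw [← sidePos_add (a.1, !a.2)] at this
      simp only [List.map_cons, DivergesLeft, sidePos_add, LeftOf, ne_eq, e1, this]
      have : ∀ x y : ℕ, (e + 2 * p < x + 2 * p ∧ x + 2 * p < y + 2 * p ∨
          x + 2 * p < y + 2 * p ∧ y + 2 * p < e + 2 * p ∨
          y + 2 * p < e + 2 * p ∧ e + 2 * p < x + 2 * p) ↔
          (e < x ∧ x < y ∨ x < y ∧ y < e ∨ y < e ∧ e < x) := by intro x y; omega
      rw [this]

/-- The shifted paths enter through the right side of the `p`-th cut instead of at the base point,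
but in both situations the entry precedes all sides that can be crossed. The words must be nonempty
because a path ending at once would end at its own entry position `0` before the shift, but not
after it if `p > 0`. -/
theorem divergesLeft_arcEntry (p : ℕ) {u v : List (ℕ × Bool)} (hu0 : u ≠ []) (hv0 : v ≠ [])
    (hu : ∀ a ∈ u, 1 ≤ a.1) (hv : ∀ a ∈ v, 1 ≤ a.1) :
    DivergesLeft (arcEntry p) (u.map fun a => (a.1 + p, a.2))
      (v.map fun a => (a.1 + p, a.2)) ↔ DivergesLeft 0 u v := by
  obtain ⟨a, u, rfl⟩ := List.exists_cons_of_ne_nil hu0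
  obtain ⟨b, v, rfl⟩ := List.exists_cons_of_ne_nil hv0
  have ha := three_le_sidePos (hu a (by simp))
  have hb := three_le_sidePos (hv b (by simp))
  have e1 : ((a.1 + p, a.2) = (b.1 + p, b.2)) ↔ a = b := by
    rw [Prod.ext_iff, Prod.ext_iff]; simp
  have h3 : 3 ≤ sidePos (a.1, !a.2) := three_le_sidePos (a := (a.1, !a.2)) (hu a (by simp))
  have := divergesLeft_map_add p (e := sidePos (a.1, !a.2)) (u := u) (v := v) h3
    (fun c hc => hu c (by simp [hc])) (fun c hc => hv c (by simp [hc]))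
  rw [← sidePos_add (a.1, !a.2)] at this
  simp only [List.map_cons, DivergesLeft, sidePos_add, LeftOf, ne_eq, e1, this, arcEntry]
  have : ((if p = 0 then 0 else 2 * p + 2) < sidePos a + 2 * p ∧
      sidePos a + 2 * p < sidePos b + 2 * p ∨
      sidePos a + 2 * p < sidePos b + 2 * p ∧
      sidePos b + 2 * p < (if p = 0 then 0 else 2 * p + 2) ∨
      sidePos b + 2 * p < (if p = 0 then 0 else 2 * p + 2) ∧
      (if p = 0 then 0 else 2 * p + 2) < sidePos a + 2 * p) ↔
      (0 < sidePos a ∧ sidePos a < sidePos b ∨ sidePos a < sidePos b ∧ sidePos b < 0 ∨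
      sidePos b < 0 ∧ 0 < sidePos a) := by split_ifs <;> omega
  rw [this]

/-! ### Action of shifted braids on arcs -/

theorem braid_induction {n : ℕ} {P : Braid n → Prop} (one : P 1)
    (mul : ∀ x y, P x → P y → P (x * y)) (inv : ∀ x, P x → P x⁻¹)
    (gen : ∀ i : Gen n, P (PresentedGroup.of i)) (x : Braid n) : P x := by
  have h : x ∈ Subgroup.closure (Set.range (PresentedGroup.of (rels := artinRels n))) := by
    rw [PresentedGroup.closure_range_of]; trivial
  induction h using Subgroup.closure_induction with
  | mem x hx => obtain ⟨i, rfl⟩ := hx; exact gen i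
  | one => exact one
  | mul x y _ _ hx hy => exact mul x y hx hy
  | inv x _ hx => exact inv x hx

theorem braidAction_of {n : ℕ} (i : Gen n) :
    braidAction n (PresentedGroup.of i) = artinAut i.1 := PresentedGroup.toGroup.of _

theorem shiftHom_of {p s n : ℕ} (h : p + s ≤ n) (i : Gen s) :
    shiftHom p s n h (PresentedGroup.of i) = sigma n (i.1 + p) := PresentedGroup.toGroup.of _

theorem braidAction_sigma {n i : ℕ} (h : 1 ≤ i ∧ i < n) :
    braidAction n (sigma n i) = artinAut i := by
  rw [sigma, dif_pos h, braidAction_of]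

theorem artinAut_freeShift (i p : ℕ) (w : FreeGroup ℕ) :
    artinAut (i + p) (freeShift p w) = freeShift p (artinAut i w) := by
  suffices (artinAut (i + p)).toMonoidHom.comp (freeShift p) =
      (freeShift p).comp (artinAut i).toMonoidHom from DFunLike.congr_fun this w
  ext j
  simp only [freeShift, MonoidHom.coe_comp, Function.comp_apply, FreeGroup.map.of,
    MulEquiv.toMonoidHom_eq_coe, MonoidHom.coe_coe, artinAut_of]
  by_cases h1 : j = i
  · subst h1; simp [show j + p + 1 = j + 1 + p by omega]
  · by_cases h2 : j = i + 1
    · subst h2; simp [show i + 1 + p = i + p + 1 by omega]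
    · simp [h1, h2, show j + p ≠ i + p + 1 by omega]

theorem braidAction_shiftHom {p s n : ℕ} (h : p + s ≤ n) (α : Braid s) (w : FreeGroup ℕ) :
    braidAction n (shiftHom p s n h α) (freeShift p w) = freeShift p (braidAction s α w) := by
  induction α using braid_induction generalizing w with
  | one => simp
  | mul x y hx hy => simp only [map_mul, MulAut.mul_apply, hx, hy]
  | inv x hx =>
    rw [map_inv, map_inv, MulAut.inv_apply, MulEquiv.symm_apply_eq, hx, map_inv,
      MulAut.apply_inv_self]
  | gen i =>
    rw [shiftHom_of, braidAction_sigma (by have := i.2; omega), braidAction_of,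
      artinAut_freeShift]

/-- The half twist preserves the product `x_i x_{i+1}` and every other generator, and an arc
contains both of these two letters or neither, unless it stops exactly at `i`. -/
theorem artinAut_arc {i c : ℕ} (hi : 1 ≤ i) (h : c ≠ i) : artinAut i (arc c) = arc c := by
  rcases lt_or_gt_of_ne h with h | h
  · induction c with
    | zero => simp [arc]
    | succ c ih =>
      rw [arc_succ, map_mul, ih (by omega) (by omega), artinAut_of, if_neg (by omega),
        if_neg (by omega)]
  · induction c with
    | zero => omega
    | succ c ih =>
      rcases Nat.lt_or_ge i c with h' | h'
      · rw [arc_succ, map_mul, ih (by omega) h', artinAut_of, if_neg (by omega),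
          if_neg (by omega)]
      · obtain rfl : c = i := by omega
        obtain ⟨d, rfl⟩ : ∃ d, c = d + 1 := ⟨c - 1, by omega⟩
        have : ∀ e < d + 1, artinAut (d + 1) (arc e) = arc e := by
          intro e he
          induction e with
          | zero => simp [arc]
          | succ e ih =>
            rw [arc_succ, map_mul, ih (by omega), artinAut_of, if_neg (by omega),
              if_neg (by omega)]
        rw [arc_succ, arc_succ, map_mul, map_mul, this d (by omega), artinAut_of, artinAut_of,
          if_pos rfl, if_neg (by omega), if_pos rfl]
        group

theorem artinAut_arc_self {i : ℕ} (hi : 1 ≤ i) :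
    artinAut i (arc i) = arc (i - 1) * FreeGroup.of (i + 1) := by
  obtain ⟨d, rfl⟩ : ∃ d, i = d + 1 := ⟨i - 1, by omega⟩
  rw [arc_succ, map_mul, artinAut_arc hi (by omega), artinAut_of, if_pos rfl,
    Nat.add_sub_cancel]

theorem braidAction_shiftHom_arc {p s n : ℕ} (h : p + s ≤ n) (α : Braid s) {c : ℕ}
    (hc : c ≤ p ∨ p + s ≤ c) : braidAction n (shiftHom p s n h α) (arc c) = arc c := by
  induction α using braid_induction with
  | one => simp
  | mul x y hx hy => simp only [map_mul, MulAut.mul_apply, hx, hy]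
  | inv x hx => rw [map_inv, map_inv, MulAut.inv_apply, MulEquiv.symm_apply_eq, hx]
  | gen i =>
    have := i.2
    rw [shiftHom_of, braidAction_sigma (by omega), artinAut_arc (by omega) (by omega)]

theorem braidAction_shiftHom_arc_add {p s n : ℕ} (h : p + s ≤ n) (α : Braid s) (c : ℕ) :
    braidAction n (shiftHom p s n h α) (arc (c + p)) =
      arc p * freeShift p (braidAction s α (arc c)) := by
  rw [arc_add, map_mul, braidAction_shiftHom_arc h α (.inl le_rfl), braidAction_shiftHom]

/-- The auxiliary generator `x_0` stays out of the picture: the subgroup on the remaining generators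
is preserved. This yields the index bound under which side positions can be compared after shifts.
-/
theorem braidAction_freeShift_one {s : ℕ} (α : Braid s) :
    ∃ φ : MulAut (FreeGroup ℕ), ∀ w, braidAction s α (freeShift 1 w) = freeShift 1 (φ w) := by
  induction α using braid_induction with
  | one => exact ⟨1, by simp⟩
  | mul x y hx hy =>
    obtain ⟨φ, hφ⟩ := hx
    obtain ⟨ψ, hψ⟩ := hy
    exact ⟨φ * ψ, by simp [hφ, hψ]⟩
  | inv x hx =>
    obtain ⟨φ, hφ⟩ := hx
    refine ⟨φ⁻¹, fun w => ?_⟩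
    rw [map_inv, MulAut.inv_apply, MulEquiv.symm_apply_eq, hφ, MulAut.apply_inv_self]
  | gen i =>
    refine ⟨artinAut (i.1 - 1), fun w => ?_⟩
    have := i.2.1
    rw [braidAction_of, ← artinAut_freeShift, Nat.sub_add_cancel this]

theorem toWord_braidAction_arc {s : ℕ} (α : Braid s) {c : ℕ} (hc : 1 ≤ c) :
    (braidAction s α (arc c)).toWord ≠ [] ∧
      ∀ a ∈ (braidAction s α (arc c)).toWord, 1 ≤ a.1 := by
  constructor
  · rw [Ne, FreeGroup.toWord_eq_nil_iff, EmbeddingLike.map_eq_one_iff, ← FreeGroup.toWord_eq_nil_iff,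
      ← mk_arcWord, FreeGroup.toWord_mk,
      (isReduced_of_forall (by simp [arcWord])).reduce_eq, arcWord]
    simp; omega
  · have h0 : ∀ c, ∃ w, arc c = freeShift 1 w := by
      intro c
      induction c with
      | zero => exact ⟨1, by simp [arc]⟩
      | succ c ih =>
        obtain ⟨w, hw⟩ := ih
        exact ⟨w * FreeGroup.of c, by rw [arc_succ, hw, map_mul]; simp [freeShift]⟩
    obtain ⟨w, hw⟩ := h0 c
    obtain ⟨φ, hφ⟩ := braidAction_freeShift_one α
    rw [hw, hφ, toWord_freeShift]
    intro a ha
    obtain ⟨b, _, rfl⟩ := List.mem_map.1 ha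
    exact Nat.le_add_left 1 b.1

/-- Arcs outside the block of strands are fixed by both braids, so they decide nothing and can be
dropped. For an arc inside the block both images share the prefix `arc p` followed by shifted words,
and neither prefix nor shift affects the divergence. -/
theorem restrictLT_normalLT {n p s : ℕ} (h : p + s ≤ n) (k : List ℕ) :
    restrictLT (normalLT n k) p s =
      normalLT s ((k.filter fun c => p < c ∧ c < p + s).map (· - p)) := by
  funext α β
  have e : restrictLT (normalLT n k) p s α β =
      normalLT n k (shiftHom p s n h α) (shiftHom p s n h β) :=
    propext ⟨fun ⟨_, h⟩ => h, fun h' => ⟨h, h'⟩⟩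
  rw [e]
  induction k with
  | nil => exact propext (iff_of_false (not_normalLT_nil _ _ _) (not_normalLT_nil _ _ _))
  | cons c k ih =>
    have ih := ih (propext ⟨fun ⟨_, h⟩ => h, fun h' => ⟨h, h'⟩⟩)
    rw [normalLT_cons, ih]
    by_cases hc : p < c ∧ c < p + s
    · rw [List.filter_cons_of_pos (by simpa using hc), List.map_cons, normalLT_cons]
      obtain ⟨d, rfl⟩ : ∃ d, c = d + p := ⟨c - p, by omega⟩
      have hα := toWord_braidAction_arc α (c := d) (by omega)
      have hβ := toWord_braidAction_arc β (c := d) (by omega)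
      rw [braidAction_shiftHom_arc_add, braidAction_shiftHom_arc_add, Nat.add_sub_cancel,
        toWord_arc_mul_freeShift p hα.2, toWord_arc_mul_freeShift p hβ.2,
        divergesLeft_arcWord_append, divergesLeft_arcEntry p hα.1 hβ.1 hα.2 hβ.2, mul_right_inj,
        (show Function.Injective (freeShift p) from
          FreeGroup.map_injective (add_left_injective p)).eq_iff]
    · rw [List.filter_cons_of_neg (by simpa using hc), braidAction_shiftHom_arc h α (by omega),
        braidAction_shiftHom_arc h β (by omega)]
      simp [not_divergesLeft_self]

theorem normalLT_append {n : ℕ} {l k : List ℕ} {α β : Braid n}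
    (h : ∀ c ∈ l, braidAction n α (arc c) = braidAction n β (arc c)) :
    normalLT n (l ++ k) α β ↔ normalLT n k α β := by
  induction l with
  | nil => rfl
  | cons c l ih =>
    rw [List.cons_append, normalLT_cons, ih fun d hd => h d (by simp [hd]), h c (by simp)]
    simp [not_divergesLeft_self]

theorem exists_append_of_ne {k k' : List ℕ} (hl : k.length = k'.length) (h : k ≠ k') :
    ∃ l c c' t t', c ≠ c' ∧ k = l ++ c :: t ∧ k' = l ++ c' :: t' := by
  induction k generalizing k' with
  | nil => cases k' <;> simp_all
  | cons a k ih =>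
    cases k' with
    | nil => simp at hl
    | cons b k' =>
      by_cases hab : a = b
      · subst hab
        obtain ⟨l, c, c', t, t', hc, rfl, rfl⟩ := ih (by simpa using hl) (by simpa using h)
        exact ⟨a :: l, c, c', t, t', hc, rfl, rfl⟩
      · exact ⟨[], a, b, k, k', hab, rfl, rfl⟩

theorem toWord_arc (c : ℕ) : (arc c).toWord = arcWord c := by
  rw [← mk_arcWord, FreeGroup.toWord_mk]
  exact (isReduced_of_forall (by simp [arcWord])).reduce_eq

theorem toWord_artinAut_arc {c : ℕ} (hc : 1 ≤ c) :
    (artinAut c (arc c)).toWord = arcWord (c - 1) ++ [(c + 1, true)] := by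
  rw [artinAut_arc_self hc, ← mk_arcWord, FreeGroup.of, FreeGroup.mul_mk, FreeGroup.toWord_mk]
  refine (isReduced_of_forall fun a ha => ?_).reduce_eq
  simp only [arcWord, List.mem_append, List.mem_map, List.mem_singleton] at ha
  rcases ha with ⟨i, _, rfl⟩ | rfl <;> rfl

/-- A normal finite Thurston-type ordering determines the permutation. -/
theorem normalLT_injective {n : ℕ} {k k' : List ℕ} (hk : IsPermutation n k)
    (hk' : IsPermutation n k') (h : normalLT n k = normalLT n k') : k = k' := by
  by_contra hne
  have hm : ∀ a ∈ k, 1 ≤ a ∧ a < n := fun a ha => by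
    have := hk.mem_iff.1 ha; rw [List.mem_range'_1] at this; omega
  have hm' : ∀ a ∈ k', 1 ≤ a ∧ a < n := fun a ha => by
    have := hk'.mem_iff.1 ha; rw [List.mem_range'_1] at this; omega
  have nd : k.Nodup := hk.nodup_iff.2 List.nodup_range'
  have nd' : k'.Nodup := hk'.nodup_iff.2 List.nodup_range'
  obtain ⟨l, c, c', t, t', hc, rfl, rfl⟩ :=
    exists_append_of_ne (hk.length_eq.trans hk'.length_eq.symm) hne
  have bc := hm c (by simp)
  have bc' := hm' c' (by simp)
  have hl : ∀ d ∈ l, braidAction n (sigma n c') (arc d) = braidAction n (sigma n c) (arc d) := by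
    intro d hd
    have h1 : d ≠ c := by
      rintro rfl
      exact (List.disjoint_of_nodup_append nd) hd (by simp)
    have h2 : d ≠ c' := by
      rintro rfl
      exact (List.disjoint_of_nodup_append nd') hd (by simp)
    rw [braidAction_sigma bc, braidAction_sigma bc', artinAut_arc bc.1 h1, artinAut_arc bc'.1 h2]
  -- The test pair is `σ_{c'}` and `σ_c`. At the first place where the permutations differ, `k`
  -- looks at arc `c`, which only `σ_c` moves, and to the left; `k'` looks at arc `c'`, which only
  -- `σ_{c'}` moves. Hence `σ_{c'} < σ_c` holds for `k` but fails for `k'`.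
  have e := congrFun (congrFun h (sigma n c')) (sigma n c)
  rw [normalLT_append hl, normalLT_append hl, normalLT_cons, normalLT_cons,
    braidAction_sigma bc, braidAction_sigma bc', artinAut_arc bc'.1 hc, artinAut_arc bc.1 hc.symm,
    toWord_arc, toWord_arc, toWord_artinAut_arc bc.1, toWord_artinAut_arc bc'.1] at e
  have w : ∀ {c}, 1 ≤ c → arcWord c = arcWord (c - 1) ++ [(c, true)] := by
    intro c hc
    conv_lhs => rw [show c = c - 1 + 1 by omega, arcWord_succ]
    rw [Nat.sub_add_cancel hc]
  rw [w bc.1, w bc'.1, divergesLeft_arcWord_append, divergesLeft_arcWord_append] at e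
  have h1 : DivergesLeft (arcEntry (c - 1)) [(c, true)] [(c + 1, true)] := by
    simp only [DivergesLeft, LeftOf, sidePos, arcEntry]
    right
    refine ⟨by simp, ?_⟩
    simp only [if_true]
    split_ifs <;> omega
  have h2 : ¬ DivergesLeft (arcEntry (c' - 1)) [(c' + 1, true)] [(c', true)] := by
    simp only [DivergesLeft, LeftOf, sidePos, arcEntry]
    simp only [if_true]
    rw [not_or]
    refine ⟨by simp, fun h => ?_⟩
    obtain ⟨-, h⟩ := h
    split_ifs at h <;> omega
  have h3 : artinAut c' (arc c') ≠ arc c' := by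
    intro h
    have := congrArg FreeGroup.toWord h
    rw [toWord_arc, toWord_artinAut_arc bc'.1, w bc'.1] at this
    simp at this
  have := e.mp (.inr h1)
  rcases this with ⟨h, _⟩ | h
  · exact h3 h
  · exact h2 h

/-! ### Divisibility of positive braids -/

theorem mem_parabolic {n : ℕ} {S : Set ℕ} {γ : Braid n} :
    γ ∈ parabolic n S ↔ ∃ W, IsPositiveWord n W ∧ (∀ a ∈ W, a ∈ S) ∧ eval n W = γ := by
  constructor
  · intro h
    induction h using Submonoid.closure_induction with
    | mem x hx =>
      obtain ⟨i, hi, h1, h2, rfl⟩ := hx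
      exact ⟨[i], by simp [IsPositiveWord, h1, h2], by simp [hi], by simp [eval]⟩
    | one => exact ⟨[], by simp [IsPositiveWord], by simp, eval_nil n⟩
    | mul x y _ _ hx hy =>
      obtain ⟨U, hU, hU', rfl⟩ := hx
      obtain ⟨V, hV, hV', rfl⟩ := hy
      refine ⟨U ++ V, fun a ha => ?_, fun a ha => ?_, eval_append n U V⟩
      · exact (List.mem_append.1 ha).elim (hU a) (hV a)
      · exact (List.mem_append.1 ha).elim (hU' a) (hV' a)
  · rintro ⟨W, hW, hW', rfl⟩
    refine Submonoid.list_prod_mem _ fun x hx => ?_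
    obtain ⟨a, ha, rfl⟩ := List.mem_map.1 hx
    exact Submonoid.subset_closure ⟨a, hW' a ha, (hW a ha).1, (hW a ha).2, rfl⟩

theorem mem_positiveBraids {n : ℕ} {γ : Braid n} :
    γ ∈ positiveBraids n ↔ ∃ W, IsPositiveWord n W ∧ eval n W = γ := by
  rw [positiveBraids, mem_parabolic]; simp

theorem parabolic_mono {n : ℕ} {S T : Set ℕ} (h : ∀ a ∈ S, 1 ≤ a → a < n → a ∈ T) :
    parabolic n S ≤ parabolic n T :=
  Submonoid.closure_mono fun _ ⟨i, hi, h1, h2, e⟩ => ⟨i, h i hi h1 h2, h1, h2, e⟩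

theorem parabolic_le {n : ℕ} {S : Set ℕ} : parabolic n S ≤ positiveBraids n :=
  parabolic_mono fun _ _ _ _ => trivial

theorem eval_mem {n : ℕ} {W : List ℕ} (h : IsPositiveWord n W) :
    eval n W ∈ positiveBraids n := mem_positiveBraids.2 ⟨W, h, rfl⟩

theorem sigma_mem {n i : ℕ} {S : Set ℕ} (hi : i ∈ S) (h : 1 ≤ i ∧ i < n) :
    sigma n i ∈ parabolic n S := Submonoid.subset_closure ⟨i, hi, h.1, h.2, rfl⟩

/-- The length homomorphism. -/
def lengthHom (n : ℕ) : Braid n →* Multiplicative ℤ :=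
  PresentedGroup.toGroup (f := fun _ => Multiplicative.ofAdd 1) (by
    rintro r ⟨i, j, ⟨hij, rfl⟩ | ⟨hij, rfl⟩⟩ <;>
    · simp only [map_mul, map_inv, FreeGroup.lift_apply_of]
      rw [mul_inv_eq_one])

theorem lengthHom_eval {n : ℕ} {W : List ℕ} (h : IsPositiveWord n W) :
    lengthHom n (eval n W) = Multiplicative.ofAdd (W.length : ℤ) := by
  induction W with
  | nil => simp [eval_nil]
  | cons a W ih =>
    rw [eval_cons, map_mul, ih fun b hb => h b (by simp [hb]), sigma, dif_pos (h a (by simp)),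
      lengthHom, PresentedGroup.toGroup.of, ← ofAdd_add, List.length_cons]
    push_cast
    rw [add_comm]

theorem length_eq_of_eval_eq {n : ℕ} {U V : List ℕ} (hU : IsPositiveWord n U)
    (hV : IsPositiveWord n V) (h : eval n U = eval n V) : U.length = V.length :=
  (wordEqv_of_eval_eq hU hV h).length_eq

theorem IsPositiveWord.append {n : ℕ} {U V : List ℕ} (hU : IsPositiveWord n U)
    (hV : IsPositiveWord n V) : IsPositiveWord n (U ++ V) :=
  fun a ha => (List.mem_append.1 ha).elim (hU a) (hV a)

theorem isPositiveWord_nil (n : ℕ) : IsPositiveWord n [] := by simp [IsPositiveWord]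

theorem eq_nil_of_eval_eq_one {n : ℕ} {W : List ℕ} (h : IsPositiveWord n W)
    (e : eval n W = 1) : W = [] := by
  have := length_eq_of_eval_eq h (isPositiveWord_nil n) (e.trans (eval_nil n).symm)
  exact List.length_eq_zero_iff.1 this

theorem eq_one_of_mul_eq_one {n : ℕ} {x y : Braid n} (hx : x ∈ positiveBraids n)
    (hy : y ∈ positiveBraids n) (h : x * y = 1) : x = 1 ∧ y = 1 := by
  obtain ⟨U, hU, rfl⟩ := mem_positiveBraids.1 hx
  obtain ⟨V, hV, rfl⟩ := mem_positiveBraids.1 hy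
  rw [← eval_append] at h
  have := List.append_eq_nil_iff.1 (eq_nil_of_eval_eq_one (hU.append hV) h)
  rw [this.1, this.2, eval_nil]
  exact ⟨rfl, rfl⟩

theorem eq_one_of_inv_mem {n : ℕ} {x : Braid n} (hx : x ∈ positiveBraids n)
    (hx' : x⁻¹ ∈ positiveBraids n) : x = 1 :=
  (eq_one_of_mul_eq_one hx hx' (mul_inv_cancel x)).1

/-- Factors of an element of a standard submonoid belong to it. -/
theorem mem_parabolic_of_mul_mem {n : ℕ} {S : Set ℕ} {x y : Braid n} (hx : x ∈ positiveBraids n)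
    (hy : y ∈ positiveBraids n) (h : x * y ∈ parabolic n S) :
    x ∈ parabolic n S ∧ y ∈ parabolic n S := by
  obtain ⟨U, hU, rfl⟩ := mem_positiveBraids.1 hx
  obtain ⟨V, hV, rfl⟩ := mem_positiveBraids.1 hy
  obtain ⟨W, hW, hWS, e⟩ := mem_parabolic.1 h
  rw [← eval_append] at e
  have := wordEqv_of_eval_eq hW (hU.append hV) e
  have hm : ∀ a ∈ U ++ V, a ∈ S := fun a ha => hWS a (this.symm.mem ha)
  exact ⟨mem_parabolic.2 ⟨U, hU, fun a ha => hm a (by simp [ha]), rfl⟩,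
    mem_parabolic.2 ⟨V, hV, fun a ha => hm a (by simp [ha]), rfl⟩⟩

theorem eval_reverse_cons {n a : ℕ} {W : List ℕ} :
    eval n (a :: W).reverse = eval n W.reverse * sigma n a := by
  rw [List.reverse_cons, eval_append, eval_cons, eval_nil, mul_one]

theorem IsPositiveWord.reverse {n : ℕ} {W : List ℕ} (h : IsPositiveWord n W) :
    IsPositiveWord n W.reverse := fun a ha => h a (List.mem_reverse.1 ha)

/-- Common multiples of two generators are multiples of their least common multiple. -/
theorem exists_lcm {n i j : ℕ} (hi : 1 ≤ i ∧ i < n) (hj : 1 ≤ j ∧ j < n) {x y : Braid n}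
    (hx : x ∈ positiveBraids n) (hy : y ∈ positiveBraids n)
    (h : x * sigma n i = y * sigma n j) :
    ∃ z ∈ positiveBraids n, ∃ p ∈ parabolic n {i, j}, ∃ q ∈ parabolic n {i, j},
      x = z * p ∧ y = z * q := by
  obtain ⟨X, hX, rfl⟩ := mem_positiveBraids.1 hx
  obtain ⟨Y, hY, rfl⟩ := mem_positiveBraids.1 hy
  -- Garside's lemma concerns leading letters, whereas divisors here stand on the right; hence the
  -- reversal.
  have e : WordEqv (i :: X.reverse) (j :: Y.reverse) := by
    rw [← List.reverse_reverse X, ← List.reverse_reverse Y, ← eval_reverse_cons,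
      ← eval_reverse_cons] at h
    have := wordEqv_of_eval_eq (n := n) ?_ ?_ h
    · simpa using this.reverse
    · exact IsPositiveWord.reverse fun a ha => (List.mem_cons.1 ha).elim (· ▸ hi) (hX.reverse a)
    · exact IsPositiveWord.reverse fun a ha => (List.mem_cons.1 ha).elim (· ▸ hj) (hY.reverse a)
  have si : sigma n i ∈ parabolic n {i, j} := sigma_mem (by simp) hi
  have sj : sigma n j ∈ parabolic n {i, j} := sigma_mem (by simp) hj
  have key : ∀ {U V : List ℕ}, IsPositiveWord n U → WordEqv U.reverse V →
      eval n U = eval n V.reverse := by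
    intro U V hU h
    have := h.reverse
    rw [List.reverse_reverse] at this
    exact this.eval_eq hU
  have pos : ∀ {U V Z : List ℕ}, IsPositiveWord n U → WordEqv U.reverse V →
      (∀ a ∈ Z, a ∈ V) → IsPositiveWord n Z.reverse := by
    intro U V Z hU h hZ a ha
    exact hU.reverse a (h.symm.mem (hZ a (List.mem_reverse.1 ha)))
  rcases e.resolved with ⟨rfl, _⟩ | ⟨_, Z, h1, h2⟩ | ⟨_, Z, h1, h2⟩
  · refine ⟨_, eval_mem hX, 1, one_mem _, 1, one_mem _, (mul_one _).symm, ?_⟩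
    rw [mul_one]; exact (mul_right_cancel h).symm
  · refine ⟨eval n Z.reverse, eval_mem (pos hX h1 (by simp +contextual)), _, sj, _, si, ?_, ?_⟩
    · rw [key hX h1, eval_reverse_cons]
    · rw [key hY h2, eval_reverse_cons]
  · refine ⟨eval n Z.reverse, eval_mem (pos hX h1 (by simp +contextual)),
      _, mul_mem si sj, _, mul_mem sj si, ?_, ?_⟩
    · rw [key hX h1, eval_reverse_cons, eval_reverse_cons, mul_assoc]
    · rw [key hY h2, eval_reverse_cons, eval_reverse_cons, mul_assoc]

/-- The two divisors divide each other, and a positive braid with positive inverse is trivial by its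
length. -/
theorem IsMaxRightDivisor.unique {n : ℕ} {S : Set ℕ} {β γ γ' : Braid n}
    (h : IsMaxRightDivisor S β γ) (h' : IsMaxRightDivisor S β γ') : γ = γ' := by
  have h1 := h.max γ' h'.mem h'.dvd
  have h2 := h'.max γ h.mem h.dvd
  have := eq_one_of_inv_mem (parabolic_le h1) (by simpa using parabolic_le h2)
  exact mul_inv_eq_one.1 this

theorem mem_parabolic_cases {n : ℕ} {S : Set ℕ} {δ : Braid n} (h : δ ∈ parabolic n S) :
    δ = 1 ∨ ∃ δ' ∈ parabolic n S, ∃ j ∈ S, (1 ≤ j ∧ j < n) ∧ δ = δ' * sigma n j := by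
  obtain ⟨W, hW, hWS, rfl⟩ := mem_parabolic.1 h
  rcases List.eq_nil_or_concat' W with rfl | ⟨V, j, rfl⟩
  · exact .inl (eval_nil n)
  · refine .inr ⟨eval n V, mem_parabolic.2 ⟨V, fun a ha => hW a (by simp [ha]),
      fun a ha => hWS a (by simp [ha]), rfl⟩, j, hWS j (by simp), hW j (by simp), ?_⟩
    rw [eval_append, eval_cons, eval_nil, mul_one]

/-- Existence of maximal right divisors in standard submonoids. -/
theorem exists_isMaxRightDivisor {n : ℕ} (S : Set ℕ) {β : Braid n}
    (hβ : β ∈ positiveBraids n) : ∃ γ, IsMaxRightDivisor S β γ := by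
  obtain ⟨W, hW, rfl⟩ := mem_positiveBraids.1 hβ
  clear hβ
  induction hL : W.length using Nat.strong_induction_on generalizing W with
  | _ L ih =>
  subst hL
  have step : ∀ {i}, 1 ≤ i ∧ i < n → eval n W * (sigma n i)⁻¹ ∈ positiveBraids n →
      ∃ γ, IsMaxRightDivisor S (eval n W * (sigma n i)⁻¹) γ := by
    intro i hi h
    obtain ⟨V, hV, e⟩ := mem_positiveBraids.1 h
    rw [← e]
    have hp : IsPositiveWord n (V ++ [i]) := hV.append (by simp [IsPositiveWord, hi])
    have := length_eq_of_eval_eq hp hW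
      (by rw [eval_append, e, eval_cons, eval_nil, mul_one, inv_mul_cancel_right])
    rw [List.length_append, List.length_singleton] at this
    exact ih _ (by omega) _ hV rfl
  set β := eval n W
  by_cases hex : ∃ i ∈ S, (1 ≤ i ∧ i < n) ∧ β * (sigma n i)⁻¹ ∈ positiveBraids n
  · obtain ⟨i, hiS, hi, hβi⟩ := hex
    obtain ⟨γ', hγ'⟩ := step hi hβi
    -- Any right divisor `σ_i` with `i` in `S` may be used: for another last letter `j`, the
    -- analogous candidate `γj * sigma n j` turns out to be the same braid.
    refine ⟨γ' * sigma n i, mul_mem hγ'.mem (sigma_mem hiS hi), ?_, ?_⟩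
    · have := hγ'.dvd
      rwa [mul_assoc, ← mul_inv_rev] at this
    · intro δ hδ hβδ
      rcases mem_parabolic_cases hδ with rfl | ⟨δ', hδ', j, hjS, hj, rfl⟩
      · simpa using mul_mem hγ'.mem (sigma_mem hiS hi)
      have e1 : β * (δ' * sigma n j)⁻¹ = β * (sigma n j)⁻¹ * δ'⁻¹ := by group
      rw [e1] at hβδ
      have hβj : β * (sigma n j)⁻¹ ∈ positiveBraids n := by
        have := mul_mem hβδ (parabolic_le hδ')
        rwa [inv_mul_cancel_right] at this
      obtain ⟨z, hz, p, hp, q, hq, hzp, hzq⟩ := exists_lcm hi hj hβi hβj (by simp)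
      have hij : parabolic n {i, j} ≤ parabolic n S :=
        parabolic_mono fun a ha _ _ => by rcases ha with rfl | rfl <;> assumption
      have hpq : p * sigma n i = q * sigma n j := by
        apply mul_left_cancel (a := z)
        rw [← mul_assoc, ← mul_assoc, ← hzp, ← hzq]; simp
      -- The braids `p` and `q` complete `σ_i` and `σ_j` to a common left multiple. Replacing the
      -- right factor `p` of `γ'` by `q` gives a right divisor of `β * (sigma n j)⁻¹`, which
      -- therefore right-divides `γj`.
      have h1 : γ' * p⁻¹ ∈ parabolic n S := hγ'.max p (hij hp) (by
        rw [hzp, mul_inv_cancel_right]; exact hz)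
      obtain ⟨γj, hγj⟩ := step hj hβj
      have h2 : γj * (γ' * p⁻¹ * q)⁻¹ ∈ parabolic n S := by
        refine hγj.max _ (mul_mem h1 (hij hq)) ?_
        have := hγ'.dvd
        rw [hzp] at this
        rw [hzq]
        have e : z * q * (γ' * p⁻¹ * q)⁻¹ = z * p * γ'⁻¹ := by group
        rwa [e]
      -- Exchanging `q` back for `p`, any surplus of `γj` would enlarge the maximal divisor `γ'`.
      have h3 : γj * (γ' * p⁻¹ * q)⁻¹ = 1 := by
        apply eq_one_of_inv_mem (parabolic_le h2)
        have := hγ'.max _ (mul_mem h2 hγ'.mem) (by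
          have := hγj.dvd
          rw [hzq] at this
          rw [hzp]
          have e : z * p * (γj * (γ' * p⁻¹ * q)⁻¹ * γ')⁻¹ = z * q * γj⁻¹ := by group
          rwa [e])
        have e : γ' * (γj * (γ' * p⁻¹ * q)⁻¹ * γ')⁻¹ = (γj * (γ' * p⁻¹ * q)⁻¹)⁻¹ := by group
        rw [e] at this
        exact parabolic_le this
      have h4 := hγj.max δ' hδ' hβδ
      have e : γ' * sigma n i * (δ' * sigma n j)⁻¹ = γj * δ'⁻¹ := by
        have e5 : sigma n i = p⁻¹ * (q * sigma n j) := by rw [← hpq]; group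
        rw [mul_inv_eq_one.1 h3, e5]; group
      rwa [e]
  · refine ⟨1, one_mem _, by simpa using eval_mem hW, fun δ hδ hβδ => ?_⟩
    rcases mem_parabolic_cases hδ with rfl | ⟨δ', hδ', j, hjS, hj, rfl⟩
    · simp
    · exfalso
      refine hex ⟨j, hjS, hj, ?_⟩
      have := mul_mem hβδ (parabolic_le hδ')
      rwa [mul_inv_rev, ← mul_assoc, inv_mul_cancel_right] at this

/-- After division by the maximal right divisor no divisors are left. -/
theorem IsMaxRightDivisor.eq_one {n : ℕ} {S : Set ℕ} {β γ δ : Braid n}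
    (h : IsMaxRightDivisor S β γ) (hδ : δ ∈ parabolic n S)
    (hd : β * γ⁻¹ * δ⁻¹ ∈ positiveBraids n) : δ = 1 := by
  have := h.max (δ * γ) (mul_mem hδ h.mem) (by rwa [mul_inv_rev, ← mul_assoc])
  rw [mul_inv_rev, mul_inv_cancel_left] at this
  exact eq_one_of_inv_mem (parabolic_le hδ) (parabolic_le this)

theorem IsMaxRightDivisor.one {n : ℕ} {S : Set ℕ} {β : Braid n} (hβ : β ∈ positiveBraids n)
    (h : ∀ δ ∈ parabolic n S, β * δ⁻¹ ∈ positiveBraids n → δ = 1) :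
    IsMaxRightDivisor S β 1 :=
  ⟨one_mem _, by simpa using hβ, fun δ hδ hd => by rw [h δ hδ hd]; simp⟩

theorem isMaxRightDivisor_one_one {n : ℕ} (S : Set ℕ) : IsMaxRightDivisor S (1 : Braid n) 1 :=
  .one (one_mem _) fun δ hδ h =>
    eq_one_of_inv_mem (parabolic_le hδ) (by simpa using h)

/-- An element of the submonoid is its own maximal right divisor. -/
theorem IsMaxRightDivisor.self {n : ℕ} {S : Set ℕ} {β : Braid n} (h : β ∈ parabolic n S) :
    IsMaxRightDivisor S β β :=
  ⟨h, by simp, fun δ hδ hd => (mem_parabolic_of_mul_mem hd (parabolic_le hδ) (by simpa)).1⟩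

/-! ### Letter maps -/

/-- `f` maps the letters of positive `s`-braid words bijectively to the letters of `n`-braid words
that belong to `S`, preserving the braid relations. -/
structure LetterMap (s n : ℕ) (S : Set ℕ) (f : ℕ → ℕ) : Prop where
  maps : ∀ a, 1 ≤ a → a < s → f a ∈ S ∧ 1 ≤ f a ∧ f a < n
  surj : ∀ b ∈ S, 1 ≤ b → b < n → ∃ a, (1 ≤ a ∧ a < s) ∧ f a = b
  inj : ∀ a b, 1 ≤ a → a < s → 1 ≤ b → b < s → f a = f b → a = b
  far : ∀ a b, 1 ≤ a → a < s → 1 ≤ b → b < s → (Far (f a) (f b) ↔ Far a b)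
  near : ∀ a b, 1 ≤ a → a < s → 1 ≤ b → b < s → (Near (f a) (f b) ↔ Near a b)

theorem letterMap_shift {p s n : ℕ} (h : p + s ≤ n) :
    LetterMap s n {a | p + 1 ≤ a ∧ a ≤ p + s - 1} (· + p) where
  maps a h1 h2 := by simp only [Set.mem_ofPred_eq]; omega
  surj b hb h1 h2 := ⟨b - p, by simp only [Set.mem_ofPred_eq] at hb; omega⟩
  inj a b _ _ _ _ e := by simpa using e
  far a b _ _ _ _ := by unfold Far; omega
  near a b _ _ _ _ := by unfold Near; omega

/-- The letter map of `place`. -/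
def placeMap (n i : ℕ) : ℕ → ℕ :=
  if i = 0 then (· + 1) else if i % 2 = 1 then id else fun a => n + 1 - a

theorem place_eq_map (n i : ℕ) (V : List ℕ) : place n i V = V.map (placeMap n i) := by
  unfold place placeMap unshift
  split_ifs <;> simp

theorem letterMap_place (n i : ℕ) : LetterMap n (n + 1) (altSet (n + 1) i) (placeMap n i) := by
  unfold altSet placeMap
  by_cases h0 : i = 0
  · subst h0
    have := letterMap_shift (p := 1) (s := n) (n := n + 1) (by omega)
    simpa [show 1 + n - 1 = n by omega] using this
  · rw [if_neg h0]
    by_cases h1 : i % 2 = 1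
    · rw [if_pos h1, if_neg (by omega)]
      constructor
      · intro a h1 h2; simp only [Set.mem_ofPred_eq, id]; omega
      · intro b hb h1 h2
        simp only [Set.mem_ofPred_eq] at hb
        exact ⟨b, by omega, rfl⟩
      all_goals intros; simp_all
    · rw [if_neg h1, if_pos (by omega)]
      constructor
      · intro a h1 h2; simp only [Set.mem_ofPred_eq]; omega
      · intro b hb h1 h2
        simp only [Set.mem_ofPred_eq] at hb
        exact ⟨n + 1 - b, by omega, by omega⟩
      · intro a b _ _ _ _ e; omega
      · intros; unfold Far; omega
      · intros; unfold Near; omega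

namespace LetterMap

variable {s n : ℕ} {S : Set ℕ} {f : ℕ → ℕ}

theorem isPositiveWord (h : LetterMap s n S f) {V : List ℕ} (hV : IsPositiveWord s V) :
    IsPositiveWord n (V.map f) := by
  intro a ha
  obtain ⟨b, hb, rfl⟩ := List.mem_map.1 ha
  exact (h.maps b (hV b hb).1 (hV b hb).2).2

theorem mem_set (h : LetterMap s n S f) {V : List ℕ} (hV : IsPositiveWord s V) :
    ∀ a ∈ V.map f, a ∈ S := by
  intro a ha
  obtain ⟨b, hb, rfl⟩ := List.mem_map.1 ha
  exact (h.maps b (hV b hb).1 (hV b hb).2).1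

theorem eval_mem (h : LetterMap s n S f) {V : List ℕ} (hV : IsPositiveWord s V) :
    eval n (V.map f) ∈ parabolic n S :=
  mem_parabolic.2 ⟨_, h.isPositiveWord hV, h.mem_set hV, rfl⟩

theorem exists_word (h : LetterMap s n S f) {γ : Braid n} (hγ : γ ∈ parabolic n S) :
    ∃ V, IsPositiveWord s V ∧ eval n (V.map f) = γ := by
  obtain ⟨W, hW, hWS, rfl⟩ := mem_parabolic.1 hγ
  clear hγ
  suffices ∃ V, IsPositiveWord s V ∧ V.map f = W by
    obtain ⟨V, hV, e⟩ := this
    exact ⟨V, hV, by rw [e]⟩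
  induction W with
  | nil => exact ⟨[], isPositiveWord_nil s, rfl⟩
  | cons a W ih =>
    have hp : IsPositiveWord n W := fun b hb => hW b (by simp [hb])
    have hS : ∀ b ∈ W, b ∈ S := fun b hb => hWS b (by simp [hb])
    obtain ⟨V, hV, e⟩ := ih hp hS
    obtain ⟨b, hb, rfl⟩ := h.surj a (hWS a (by simp)) (hW a (by simp)).1 (hW a (by simp)).2
    refine ⟨b :: V, fun c hc => ?_, by rw [List.map_cons, e]⟩
    rcases List.mem_cons.1 hc with rfl | hc
    · exact hb
    · exact hV c hc

theorem eval_map_eq (h : LetterMap s n S f) {U V : List ℕ} (hU : IsPositiveWord s U)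
    (e : eval s U = eval s V) (hV : IsPositiveWord s V) :
    eval n (U.map f) = eval n (V.map f) := by
  refine ((wordEqv_of_eval_eq hU hV e).map ?_ ?_).eval_eq (h.isPositiveWord hU)
  · intro i hi j hj
    exact (h.far i j (hU i hi).1 (hU i hi).2 (hU j hj).1 (hU j hj).2).2
  · intro i hi j hj
    exact (h.near i j (hU i hi).1 (hU i hi).2 (hU j hj).1 (hU j hj).2).2

/-- Relations can be transported back: every word in a chain of braid relations uses only letters of
the first word, and on those letters `f` has an inverse preserving both kinds of relation. -/
theorem eval_eq (h : LetterMap s n S f) {U V : List ℕ} (hU : IsPositiveWord s U)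
    (hV : IsPositiveWord s V) (e : eval n (U.map f) = eval n (V.map f)) :
    eval s U = eval s V := by
  have hg : ∀ a, 1 ≤ a ∧ a < s → Function.invFunOn f {a | 1 ≤ a ∧ a < s} (f a) = a := by
    intro a ha
    have hex : ∃ b ∈ {a | 1 ≤ a ∧ a < s}, f b = f a := ⟨a, ha, rfl⟩
    have h1 := Function.invFunOn_mem hex
    exact h.inj _ _ h1.1 h1.2 ha.1 ha.2 (Function.invFunOn_eq hex)
  have hm : ∀ {W}, IsPositiveWord s W →
      (W.map f).map (Function.invFunOn f {a | 1 ≤ a ∧ a < s}) = W := by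
    intro W hW
    rw [List.map_map]
    conv_rhs => rw [← List.map_id W]
    exact List.map_congr_left fun a ha => hg a (hW a ha)
  have := (wordEqv_of_eval_eq (h.isPositiveWord hU) (h.isPositiveWord hV) e).map
    (f := Function.invFunOn f {a | 1 ≤ a ∧ a < s}) ?_ ?_
  · rw [hm hU, hm hV] at this
    exact this.eval_eq hU
  · intro i hi j hj
    obtain ⟨a, ha, rfl⟩ := List.mem_map.1 hi
    obtain ⟨b, hb, rfl⟩ := List.mem_map.1 hj
    rw [hg a (hU a ha), hg b (hU b hb)]
    exact (h.far a b (hU a ha).1 (hU a ha).2 (hU b hb).1 (hU b hb).2).1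
  · intro i hi j hj
    obtain ⟨a, ha, rfl⟩ := List.mem_map.1 hi
    obtain ⟨b, hb, rfl⟩ := List.mem_map.1 hj
    rw [hg a (hU a ha), hg b (hU b hb)]
    exact (h.near a b (hU a ha).1 (hU a ha).2 (hU b hb).1 (hU b hb).2).1

/-- The quotient is a factor of an element of the standard submonoid, so it lies in that submonoid
and can be pulled back. -/
theorem dvd_of_dvd (h : LetterMap s n S f) {U V : List ℕ} (hU : IsPositiveWord s U)
    (hV : IsPositiveWord s V)
    (hd : eval n (U.map f) * (eval n (V.map f))⁻¹ ∈ positiveBraids n) :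
    eval s U * (eval s V)⁻¹ ∈ positiveBraids s := by
  have h1 := (mem_parabolic_of_mul_mem (S := S) hd (parabolic_le (h.eval_mem hV))
    (by simpa using h.eval_mem hU)).1
  obtain ⟨Q, hQ, e⟩ := h.exists_word h1
  rw [eq_mul_inv_iff_mul_eq, ← eval_append, ← List.map_append] at e
  have := h.eval_eq (hQ.append hV) hU e
  rw [← this, eval_append, mul_inv_cancel_right]
  exact BraidNF.eval_mem hQ

theorem dvd_map (h : LetterMap s n S f) {U V : List ℕ} (hU : IsPositiveWord s U)
    (hV : IsPositiveWord s V) {T T' : Set ℕ} (hT : ∀ a ∈ T, 1 ≤ a → a < s → f a ∈ T')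
    (hd : eval s U * (eval s V)⁻¹ ∈ parabolic s T) :
    eval n (U.map f) * (eval n (V.map f))⁻¹ ∈ parabolic n T' := by
  obtain ⟨Q, hQ, hQT, e⟩ := mem_parabolic.1 hd
  rw [eq_mul_inv_iff_mul_eq, ← eval_append] at e
  rw [← h.eval_map_eq (hQ.append hV) e hU, List.map_append, eval_append, mul_inv_cancel_right]
  refine mem_parabolic.2 ⟨_, h.isPositiveWord hQ, fun a ha => ?_, rfl⟩
  obtain ⟨b, hb, rfl⟩ := List.mem_map.1 ha
  exact hT b (hQT b hb) (hQ b hb).1 (hQ b hb).2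

/-- Letter maps preserve maximal right divisors. -/
theorem isMaxRightDivisor (h : LetterMap s n S f) {U V : List ℕ} (hU : IsPositiveWord s U)
    (hV : IsPositiveWord s V) {T T' : Set ℕ}
    (hT : ∀ a, 1 ≤ a → a < s → (f a ∈ T' ↔ a ∈ T)) (hT' : ∀ b ∈ T', 1 ≤ b → b < n → b ∈ S)
    (hm : IsMaxRightDivisor T (eval s U) (eval s V)) :
    IsMaxRightDivisor T' (eval n (U.map f)) (eval n (V.map f)) where
  mem := by
    have := h.dvd_map hV (isPositiveWord_nil s) (T := T) (T' := T')
      (fun a ha h1 h2 => (hT a h1 h2).2 ha) (by simpa [eval_nil] using hm.mem)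
    simpa [eval_nil] using this
  dvd := h.dvd_map hU hV (fun _ _ _ _ => trivial) hm.dvd
  max := by
    intro δ hδ hd
    obtain ⟨D, hD, rfl⟩ := h.exists_word (parabolic_mono hT' hδ)
    refine h.dvd_map hV hD (T := T) (fun a ha h1 h2 => (hT a h1 h2).2 ha)
      (hm.max _ ?_ (h.dvd_of_dvd hU hD hd))
    obtain ⟨E, hE, hET, e⟩ := mem_parabolic.1 hδ
    have hw := wordEqv_of_eval_eq hE (h.isPositiveWord hD) e
    refine mem_parabolic.2 ⟨D, hD, fun a ha => ?_, rfl⟩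
    exact (hT a (hD a ha).1 (hD a ha).2).1 (hET _ (hw.symm.mem (List.mem_map_of_mem ha)))

end LetterMap

/-! ### The intervals attached to a permutation -/

theorem le_foldr_max (b : ℕ) (l : List ℕ) : b ≤ l.foldr max b ∧ ∀ a ∈ l, a ≤ l.foldr max b := by
  induction l with
  | nil => simp
  | cons a l ih =>
    simp only [List.foldr_cons, List.mem_cons, forall_eq_or_imp]
    exact ⟨le_trans ih.1 (le_max_right _ _), le_max_left _ _,
      fun x hx => le_trans (ih.2 x hx) (le_max_right _ _)⟩

theorem foldr_max_le {b x : ℕ} {l : List ℕ} (hb : b ≤ x) (h : ∀ a ∈ l, a ≤ x) :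
    l.foldr max b ≤ x := by
  induction l with
  | nil => exact hb
  | cons a l ih => exact max_le (h a (by simp)) (ih fun c hc => h c (by simp [hc]))

theorem foldr_min_mem (b : ℕ) (l : List ℕ) : l.foldr min b = b ∨ l.foldr min b ∈ l := by
  induction l with
  | nil => simp
  | cons a l ih =>
    simp only [List.foldr_cons, List.mem_cons]
    rcases min_choice a (l.foldr min b) with h | h <;> rw [h]
    · simp
    · tauto

theorem foldr_min_le (b : ℕ) (l : List ℕ) : l.foldr min b ≤ b ∧ ∀ a ∈ l, l.foldr min b ≤ a := by
  induction l with
  | nil => simp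
  | cons a l ih =>
    simp only [List.foldr_cons, List.mem_cons, forall_eq_or_imp]
    exact ⟨le_trans (min_le_right _ _) ih.1, min_le_left _ _,
      fun x hx => le_trans (min_le_right _ _) (ih.2 x hx)⟩

theorem one_le_lowerEnd (k : List ℕ) (j : ℕ) : 1 ≤ lowerEnd k j := (le_foldr_max _ _).1

theorem lt_lowerEnd {k : List ℕ} {j a : ℕ} (ha : a ∈ k.take j) (h : a < kAt k (j + 1)) :
    a < lowerEnd k j :=
  (le_foldr_max _ _).2 (a + 1)
    (List.mem_map_of_mem (f := (· + 1)) (List.mem_filter.2 ⟨ha, by simpa using h⟩))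

theorem lowerEnd_le {k : List ℕ} {j x : ℕ} (hx : 1 ≤ x)
    (h : ∀ a ∈ k.take j, a < kAt k (j + 1) → a < x) : lowerEnd k j ≤ x := by
  refine foldr_max_le hx fun a ha => ?_
  obtain ⟨b, hb, rfl⟩ := List.mem_map.1 ha
  have := List.mem_filter.1 hb
  exact h b this.1 (by simpa using this.2)

theorem upperEnd_le (n : ℕ) (k : List ℕ) (j : ℕ) : upperEnd n k j ≤ n := (foldr_min_le _ _).1

theorem upperEnd_le_of_mem {n : ℕ} {k : List ℕ} {j a : ℕ} (ha : a ∈ k.take j)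
    (h : kAt k (j + 1) < a) : upperEnd n k j ≤ a :=
  (foldr_min_le _ _).2 a (List.mem_filter.2 ⟨ha, by simpa using h⟩)

theorem upperEnd_cases (n : ℕ) (k : List ℕ) (j : ℕ) :
    upperEnd n k j = n ∨ (upperEnd n k j ∈ k.take j ∧ kAt k (j + 1) < upperEnd n k j) := by
  rcases foldr_min_mem n ((k.take j).filter fun a => kAt k (j + 1) < a) with h | h
  · exact .inl h
  · have := List.mem_filter.1 h
    exact .inr ⟨this.1, of_decide_eq_true this.2⟩

theorem mem_take_iff_kAt {k : List ℕ} {j a : ℕ} (hj : j ≤ k.length) :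
    a ∈ k.take j ↔ ∃ i, i < j ∧ kAt k (i + 1) = a := by
  rw [List.mem_take_iff_getElem]
  simp only [lt_inf_iff, kAt, Nat.add_sub_cancel]
  constructor
  · rintro ⟨i, hi, rfl⟩
    exact ⟨i, hi.1, List.getD_eq_getElem _ _ hi.2⟩
  · rintro ⟨i, hi, rfl⟩
    have hi' : i < k.length := by omega
    exact ⟨i, ⟨hi, hi'⟩, (List.getD_eq_getElem _ _ hi').symm⟩

namespace IsPermutation

theorem length {n : ℕ} {k : List ℕ} (h : IsPermutation n k) : k.length = n - 1 := by
  rw [List.Perm.length_eq h, List.length_range']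

theorem mem_iff {n : ℕ} {k : List ℕ} (h : IsPermutation n k) {a : ℕ} :
    a ∈ k ↔ 1 ≤ a ∧ a < n := by
  rw [List.Perm.mem_iff h, List.mem_range'_1]; omega

theorem nodup {n : ℕ} {k : List ℕ} (h : IsPermutation n k) : k.Nodup :=
  (List.Perm.nodup_iff h).2 List.nodup_range'

theorem kAt_bounds {n : ℕ} {k : List ℕ} (h : IsPermutation n k) {j : ℕ} (hj : j < n - 1) :
    1 ≤ kAt k (j + 1) ∧ kAt k (j + 1) < n := by
  have hl : j < k.length := by rw [h.length]; exact hj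
  rw [← h.mem_iff, kAt, Nat.add_sub_cancel, List.getD_eq_getElem _ _ hl]
  exact List.getElem_mem hl

theorem kAt_inj {n : ℕ} {k : List ℕ} (h : IsPermutation n k) {i j : ℕ} (hi : i < n - 1)
    (hj : j < n - 1) (e : kAt k (i + 1) = kAt k (j + 1)) : i = j := by
  rw [← h.length] at hi hj
  rw [kAt, kAt, Nat.add_sub_cancel, Nat.add_sub_cancel, List.getD_eq_getElem _ _ hi,
    List.getD_eq_getElem _ _ hj] at e
  exact (List.Nodup.getElem_inj_iff h.nodup).1 e

theorem exists_kAt {n : ℕ} {k : List ℕ} (h : IsPermutation n k) {a : ℕ} (ha : 1 ≤ a ∧ a < n) :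
    ∃ i, i < n - 1 ∧ kAt k (i + 1) = a := by
  have := h.mem_iff.2 ha
  rw [← h.length, ← mem_take_iff_kAt le_rfl, List.take_length]
  exact this

theorem lowerEnd_le_kAt {n : ℕ} {k : List ℕ} (h : IsPermutation n k) {j : ℕ} (hj : j < n - 1) :
    lowerEnd k j ≤ kAt k (j + 1) :=
  lowerEnd_le (h.kAt_bounds hj).1 fun _ _ h => h

theorem kAt_lt_upperEnd {n : ℕ} {k : List ℕ} (h : IsPermutation n k) {j : ℕ} (hj : j < n - 1) :
    kAt k (j + 1) < upperEnd n k j := by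
  rcases upperEnd_cases n k j with e | e
  · rw [e]; exact (h.kAt_bounds hj).2
  · exact e.2

theorem strands_bounds {n : ℕ} {k : List ℕ} (h : IsPermutation n k) {j : ℕ} (hj : j < n - 1) :
    2 ≤ strands n k j ∧ lowerEnd k j - 1 + strands n k j = upperEnd n k j := by
  have h1 := h.lowerEnd_le_kAt hj
  have h2 := h.kAt_lt_upperEnd hj
  have h3 := one_le_lowerEnd k j
  unfold strands
  omega

/-- The ends of `I_j` are cut exactly by the earlier values on either side of `k(j+1)`; an earlier
value cannot equal `k(j+1)` itself. -/
theorem not_mem_of_mem_take {n : ℕ} {k : List ℕ} (h : IsPermutation n k) {j a : ℕ}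
    (hj : j < n - 1) (ha : a ∈ k.take j) : a < lowerEnd k j ∨ upperEnd n k j ≤ a := by
  obtain ⟨i, hi, rfl⟩ := (mem_take_iff_kAt (by rw [h.length]; omega)).1 ha
  rcases lt_trichotomy (kAt k (i + 1)) (kAt k (j + 1)) with e | e | e
  · exact .inl (lt_lowerEnd ha e)
  · have := h.kAt_inj (by omega) hj e; omega
  · exact .inr (upperEnd_le_of_mem ha e)

theorem filter_shift {n : ℕ} {k : List ℕ} (h : IsPermutation n k) {p s : ℕ} (hps : p + s ≤ n) :
    IsPermutation s ((k.filter fun c => p < c ∧ c < p + s).map (· - p)) := by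
  refine (List.perm_ext_iff_of_nodup ?_ List.nodup_range').2 fun a => ?_
  · refine (h.nodup.filter _).map_on fun x hx y hy e => ?_
    have h1 := (List.mem_filter.1 hx).2
    have h2 := (List.mem_filter.1 hy).2
    simp only [decide_eq_true_eq] at h1 h2
    omega
  · simp only [List.mem_map, List.mem_filter, decide_eq_true_eq, h.mem_iff, List.mem_range'_1]
    constructor
    · rintro ⟨b, hb, rfl⟩; omega
    · intro ha; exact ⟨a + p, by omega, by omega⟩

theorem restPerm_eq {n : ℕ} {k : List ℕ} (h : IsPermutation (n + 1) k) :
    restPerm k = (k.filter fun c => 1 < c ∧ c < 1 + n).map (· - 1) := by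
  unfold restPerm
  congr 1
  refine List.filter_congr fun a ha => ?_
  have := h.mem_iff.1 ha
  rw [decide_eq_decide]; omega

/-- Two discrepancies vanish: the first `j` values never lie in the interval, and the end `M_j` is
either `n`, hence no value at all, or one of the first `j` values. -/
theorem tailPerm_eq {n : ℕ} {k : List ℕ} (h : IsPermutation n k) {j : ℕ} (hj : j < n - 1) :
    tailPerm n k j = (k.filter fun c => lowerEnd k j - 1 < c ∧
      c < lowerEnd k j - 1 + strands n k j).map (· - (lowerEnd k j - 1)) := by
  have h3 := one_le_lowerEnd k j
  rw [(h.strands_bounds hj).2]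
  unfold tailPerm
  congr 1
  conv_rhs => rw [← List.take_append_drop j k, List.filter_append]
  have e : ((k.take j).filter fun c =>
      lowerEnd (k.take j ++ k.drop j) j - 1 < c ∧
        c < upperEnd n (k.take j ++ k.drop j) j) = [] := by
    rw [List.filter_eq_nil_iff]
    intro a ha
    rw [List.take_append_drop]
    have := h.not_mem_of_mem_take hj ha
    simp only [decide_eq_true_eq]
    omega
  rw [e, List.nil_append, List.take_append_drop]
  refine List.filter_congr fun a ha => ?_
  have h1 : a ≠ upperEnd n k j := by
    rintro rfl
    rcases upperEnd_cases n k j with e | e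
    · have := h.mem_iff.1 (List.mem_of_mem_drop ha); omega
    · have nd := h.nodup
      rw [← List.take_append_drop j k] at nd
      exact List.disjoint_of_nodup_append nd e.1 ha
  rw [decide_eq_decide]; omega

theorem restPerm {n : ℕ} {k : List ℕ} (h : IsPermutation (n + 1) k) :
    IsPermutation n (restPerm k) := by
  rw [h.restPerm_eq]; exact h.filter_shift (by omega)

theorem tailPerm {n : ℕ} {k : List ℕ} (h : IsPermutation n k) {j : ℕ} (hj : j < n - 1) :
    IsPermutation (strands n k j) (tailPerm n k j) := by
  rw [h.tailPerm_eq hj]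
  exact h.filter_shift (by rw [(h.strands_bounds hj).2]; exact upperEnd_le n k j)

theorem restrictLT_one {n : ℕ} {k : List ℕ} (h : IsPermutation (n + 1) k) :
    restrictLT (normalLT (n + 1) k) 1 n = normalLT n (BraidNF.restPerm k) := by
  rw [restrictLT_normalLT (by omega), h.restPerm_eq]

theorem restrictLT_interval {n : ℕ} {k : List ℕ} (h : IsPermutation n k) {j : ℕ}
    (hj : j < n - 1) :
    restrictLT (normalLT n k) (lowerEnd k j - 1) (strands n k j) =
      normalLT (strands n k j) (BraidNF.tailPerm n k j) := by
  rw [restrictLT_normalLT, h.tailPerm_eq hj]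
  rw [(h.strands_bounds hj).2]; exact upperEnd_le n k j

theorem letterMap_interval {n : ℕ} {k : List ℕ} (h : IsPermutation n k) {j : ℕ}
    (hj : j < n - 1) :
    LetterMap (strands n k j) n {a | lowerEnd k j ≤ a ∧ a ≤ upperEnd n k j - 1}
      (· + (lowerEnd k j - 1)) := by
  have h1 := (h.strands_bounds hj).2
  have h2 := one_le_lowerEnd k j
  have := letterMap_shift (p := lowerEnd k j - 1) (s := strands n k j) (n := n)
    (by rw [h1]; exact upperEnd_le n k j)
  rwa [h1, Nat.sub_add_cancel h2] at this

/-- The interval `I_j` does not contain `k(1)`. -/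
theorem interval_ne {n : ℕ} {k : List ℕ} (h : IsPermutation n k) {j a : ℕ} (hj1 : 1 ≤ j)
    (hj : j < n - 1) (ha : lowerEnd k j ≤ a ∧ a ≤ upperEnd n k j - 1) : a ≠ kAt k 1 := by
  rintro rfl
  have := h.not_mem_of_mem_take hj
    ((mem_take_iff_kAt (by rw [h.length]; omega)).2 ⟨0, hj1, rfl⟩)
  have := h.kAt_lt_upperEnd hj
  simp only [zero_add] at *
  omega

end IsPermutation

/-! ### The decomposition of the tail -/

theorem tailRemainder_self {n : ℕ} (tail : Braid n) (t : ℕ → Braid n) (r : ℕ) :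
    tailRemainder tail t r r = tail := by simp [tailRemainder]

theorem tailRemainder_of_lt {n : ℕ} (tail : Braid n) (t : ℕ → Braid n) {r j : ℕ} (h : j < r) :
    tailRemainder tail t r j = tailRemainder tail t r (j + 1) * (t (j + 1))⁻¹ := by
  rw [tailRemainder, tailRemainder, show r - j = r - (j + 1) + 1 by omega, List.range'_succ]
  simp [mul_assoc]

theorem commute_of_far {n a : ℕ} {S : Set ℕ} (ha : 1 ≤ a ∧ a < n) (h : ∀ b ∈ S, Far a b)
    {t : Braid n} (ht : t ∈ parabolic n S) : sigma n a * t = t * sigma n a := by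
  obtain ⟨W, hW, hWS, rfl⟩ := mem_parabolic.1 ht
  clear ht
  induction W with
  | nil => simp [eval_nil]
  | cons b W ih =>
    rw [eval_cons, ← mul_assoc, sigma_mul_comm_of_far ha (hW b (by simp)) (h b (hWS b (by simp))),
      mul_assoc, ih (fun c hc => hW c (by simp [hc])) (fun c hc => hWS c (by simp [hc])),
      mul_assoc]

theorem sigma_ne_one {n a : ℕ} (ha : 1 ≤ a ∧ a < n) : sigma n a ≠ 1 := by
  intro h
  have := eq_nil_of_eval_eq_one (n := n) (W := [a]) (by simp [IsPositiveWord, ha])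
    (by rw [eval_cons, eval_nil, mul_one, h])
  simp at this

theorem tailRemainder_mem {n r : ℕ} {S : Set ℕ} {T : ℕ → Set ℕ} {tail : Braid n}
    {t : ℕ → Braid n} (hS : tail ∈ parabolic n S)
    (ht : ∀ j, 1 ≤ j → j ≤ r → IsMaxRightDivisor (T j) (tailRemainder tail t r j) (t j))
    {j : ℕ} (hj : j ≤ r) : tailRemainder tail t r j ∈ parabolic n S := by
  obtain ⟨d, rfl⟩ : ∃ d, r = j + d := ⟨r - j, by omega⟩
  induction d generalizing j with
  | zero => rwa [add_zero, tailRemainder_self]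
  | succ d ih =>
    have h1 := ih (j := j + 1) (by rwa [show j + 1 + d = j + (d + 1) by omega]) (by omega)
    rw [show j + 1 + d = j + (d + 1) by omega] at h1
    have h2 := ht (j + 1) (by omega) (by omega)
    rw [tailRemainder_of_lt _ _ (by omega)]
    exact (mem_parabolic_of_mul_mem h2.dvd (parabolic_le h2.mem) (by simpa using h1)).1

/-- The factors `β_{T_j}`, `j ≥ 1`, exhaust the tail. -/
theorem tailRemainder_zero {n : ℕ} {k : List ℕ} (hk : IsPermutation (n + 1) k)
    {tail : Braid (n + 1)} {t : ℕ → Braid (n + 1)}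
    (htail : tail ∈ parabolic (n + 1) {a | 1 ≤ a ∧ a ≤ n ∧ a ≠ kAt k 1})
    (ht : ∀ j, 1 ≤ j → j ≤ n - 1 →
      IsMaxRightDivisor {a | lowerEnd k j ≤ a ∧ a ≤ upperEnd (n + 1) k j - 1}
        (tailRemainder tail t (n - 1) j) (t j)) :
    tailRemainder tail t (n - 1) 0 = 1 := by
  have hk0 := fun {j} (hj : j < n) => hk.kAt_bounds (j := j) (by omega)
  rcases mem_parabolic_cases (tailRemainder_mem htail ht (Nat.zero_le _)) with
    h | ⟨δ, hδ, a, ⟨ha1, ha2, hac⟩, -, e⟩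
  · exact h
  exfalso
  -- Suppose that the remainder ends in `σ_a`. Take the least `j` for which `k(j+1)` lies on the
  -- same side of `k(1)` as `a`. All values at places between `1` and `j+1` are then on the other
  -- side, so `a` belongs to the interval of `j`.
  have hex : ∃ j, 1 ≤ j ∧ j < n ∧ (kAt k (j + 1) < kAt k 1 ↔ a < kAt k 1) := by
    obtain ⟨i, hi, rfl⟩ := hk.exists_kAt (a := a) (by omega)
    rcases Nat.eq_zero_or_pos i with rfl | h
    · exact absurd rfl hac
    · exact ⟨i, h, by omega, Iff.rfl⟩
  classical
  obtain ⟨hj1, hj2, hj3⟩ := Nat.find_spec hex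
  have hmin := fun {l} => Nat.find_min hex (m := l)
  generalize Nat.find hex = j at *
  have hne := hk.kAt_inj (i := j) (j := 0) (by omega) (by omega)
  simp only [zero_add] at hne
  have htake : ∀ b ∈ k.take j, (a < kAt k 1 → kAt k 1 ≤ b) ∧ (kAt k 1 < a → b ≤ kAt k 1) := by
    intro b hb
    obtain ⟨i, hi, rfl⟩ := (mem_take_iff_kAt (by rw [hk.length]; omega)).1 hb
    rcases Nat.eq_zero_or_pos i with rfl | hpos
    · simp
    · have := hmin hi
      simp only [not_and] at this
      have := this hpos (by omega)
      omega
  have hc := hk0 (j := 0) (by omega)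
  simp only [zero_add] at hc
  have haj : lowerEnd k j ≤ a ∧ a ≤ upperEnd (n + 1) k j - 1 := by
    constructor
    · refine lowerEnd_le ha1 fun b hb h => ?_
      have := htake b hb
      omega
    · rcases upperEnd_cases (n + 1) k j with e | ⟨e1, e2⟩
      · omega
      · have := htake _ e1
        omega
  -- For `0 < l < j` the letters of `t l` are separated from `a` by `k(1)`, hence commute with
  -- `σ_a`. Multiplying these factors back in keeps `σ_a` at the right end.
  have key : ∀ l, l < j → ∃ ξ ∈ positiveBraids (n + 1),
      tailRemainder tail t (n - 1) l = ξ * sigma (n + 1) a := by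
    intro l hl
    induction l with
    | zero => exact ⟨δ, parabolic_le hδ, e⟩
    | succ l ih =>
      obtain ⟨ξ, hξ, e⟩ := ih (by omega)
      have h1 := ht (l + 1) (by omega) (by omega)
      rw [tailRemainder_of_lt _ _ (by omega), mul_inv_eq_iff_eq_mul] at e
      refine ⟨ξ * t (l + 1), mul_mem hξ (parabolic_le h1.mem), ?_⟩
      rw [e, mul_assoc, mul_assoc, commute_of_far (by omega) _ h1.mem]
      rintro b ⟨hb1, hb2⟩
      have h2 := hmin hl
      simp only [not_and] at h2
      have h2 := h2 (by omega) (by omega)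
      have hm : kAt k 1 ∈ k.take (l + 1) :=
        (mem_take_iff_kAt (by rw [hk.length]; omega)).2 ⟨0, by omega, rfl⟩
      have h3 := hk.kAt_inj (i := l + 1) (j := 0) (by omega) (by omega)
      simp only [zero_add] at h3
      have h4 := hk.kAt_lt_upperEnd (j := l + 1) (by omega)
      rcases lt_trichotomy (kAt k 1) (kAt k (l + 1 + 1)) with h | h | h
      · have := lt_lowerEnd hm h
        unfold Far; omega
      · omega
      · have := upperEnd_le_of_mem (n := n + 1) hm h
        unfold Far; omega
  -- Just after the division by `t j` the remainder still ends in `σ_a`, against the maximality of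
  -- `t j`.
  obtain ⟨i, rfl⟩ : ∃ i, j = i + 1 := ⟨j - 1, by omega⟩
  obtain ⟨ξ, hξ, e'⟩ := key i (by omega)
  have h1 := ht (i + 1) (by omega) (by omega)
  rw [tailRemainder_of_lt _ _ (by omega)] at e'
  refine sigma_ne_one (n := n + 1) (a := a) (by omega)
    (h1.eq_one (sigma_mem haj (by omega)) ?_)
  rw [e', mul_inv_cancel_right]
  exact hξ

/-! ### Existence and uniqueness of the normal forms -/

theorem descWord_zero (A : ℕ → List ℕ) : descWord A 0 = A 0 := by simp [descWord]

theorem descWord_succ (A : ℕ → List ℕ) (m : ℕ) :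
    descWord A (m + 1) = A (m + 1) ++ descWord A m := by
  simp [descWord, List.range_succ]

theorem ascWord_zero (X : ℕ → List ℕ) : ascWord X 0 = [] := by simp [ascWord]

theorem ascWord_succ (X : ℕ → List ℕ) (r : ℕ) : ascWord X (r + 1) = ascWord X r ++ X (r + 1) := by
  simp [ascWord, List.range'_1_concat, add_comm]

theorem descWord_congr {A B : ℕ → List ℕ} {m : ℕ} (h : ∀ i ≤ m, A i = B i) :
    descWord A m = descWord B m := by
  unfold descWord
  congr 1
  refine List.map_congr_left fun i hi => h i ?_
  simp only [List.mem_reverse, List.mem_range] at hi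
  omega

theorem ascWord_congr {X Y : ℕ → List ℕ} {r : ℕ} (h : ∀ j, 1 ≤ j → j ≤ r → X j = Y j) :
    ascWord X r = ascWord Y r := by
  unfold ascWord
  congr 1
  refine List.map_congr_left fun i hi => ?_
  rw [List.mem_range'_1] at hi
  exact h i hi.1 (by omega)

theorem descWord_of_nil {A : ℕ → List ℕ} {m l : ℕ} (hml : m ≤ l)
    (h : ∀ i, m < i → A i = []) : descWord A l = descWord A m := by
  obtain ⟨d, rfl⟩ := Nat.exists_eq_add_of_le hml
  induction d with
  | zero => rfl
  | succ d ih =>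
    rw [← add_assoc, descWord_succ, h _ (by omega), List.nil_append, ih (by omega)]

theorem isPositiveWord_descWord {n m : ℕ} {A : ℕ → List ℕ}
    (h : ∀ i ≤ m, IsPositiveWord n (A i)) : IsPositiveWord n (descWord A m) := by
  induction m with
  | zero => rw [descWord_zero]; exact h 0 le_rfl
  | succ m ih =>
    rw [descWord_succ]
    exact (h _ le_rfl).append (ih fun i hi => h i (by omega))

theorem isPositiveWord_ascWord {n r : ℕ} {X : ℕ → List ℕ}
    (h : ∀ j, 1 ≤ j → j ≤ r → IsPositiveWord n (X j)) : IsPositiveWord n (ascWord X r) := by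
  induction r with
  | zero => rw [ascWord_zero]; exact isPositiveWord_nil n
  | succ r ih =>
    rw [ascWord_succ]
    exact (ih fun j h1 h2 => h j h1 (by omega)).append (h _ (by omega) le_rfl)

theorem remainder_mul_eval {n m : ℕ} {β : Braid n} {b : ℕ → Braid n} {A : ℕ → List ℕ}
    (h : ∀ i ≤ m, eval n (A i) = b i) : remainder β b (m + 1) * eval n (descWord A m) = β := by
  induction m with
  | zero => rw [descWord_zero, h 0 le_rfl]; simp [remainder]
  | succ m ih =>
    rw [descWord_succ, eval_append, h _ le_rfl, remainder, ← mul_assoc, inv_mul_cancel_right]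
    exact ih fun i hi => h i (by omega)

theorem tailRemainder_mul_eval {n r : ℕ} {tail : Braid n} {t : ℕ → Braid n} {X : ℕ → List ℕ}
    (h : ∀ j, 1 ≤ j → j ≤ r → eval n (X j) = t j) {j : ℕ} (hj : j ≤ r) :
    tailRemainder tail t r 0 * eval n (ascWord X j) = tailRemainder tail t r j := by
  induction j with
  | zero => rw [ascWord_zero, eval_nil, mul_one]
  | succ j ih =>
    rw [ascWord_succ, eval_append, ← mul_assoc, ih (by omega), h _ (by omega) hj,
      tailRemainder_of_lt _ _ (by omega), inv_mul_cancel_right]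

theorem isPositiveWord_replicate (a : ℕ) : IsPositiveWord 2 (List.replicate a 1) := by
  intro b hb
  rw [List.eq_of_mem_replicate hb]; omega

theorem eval_replicate (a : ℕ) : eval 2 (List.replicate a 1) = sigma 2 1 ^ a := by
  simp [eval]

theorem exists_replicate {W : List ℕ} (h : IsPositiveWord 2 W) :
    W = List.replicate W.length 1 :=
  List.eq_replicate_iff.2 ⟨rfl, fun b hb => by have := h b hb; omega⟩

/-! #### The Φ-normal form -/

theorem isPhiNormalForm_nil {n : ℕ} (hn : 2 ≤ n) : IsPhiNormalForm n 1 [] := by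
  induction n, hn using Nat.le_induction with
  | base => exact IsPhiNormalForm.two 0
  | succ n hn ih =>
    have := IsPhiNormalForm.step hn 1 0 (fun _ => 1) (fun _ => [])
      (fun i hi => by
        obtain rfl : i = 0 := by omega
        exact isMaxRightDivisor_one_one _)
      (by simp [remainder]) (fun i _ => by simp [place_eq_map, eval_nil])
      (fun i _ => by simpa [eval_nil] using ih)
    simpa [descWord_zero, place_eq_map] using this

/-- The data of a Φ-normal form, with all sequences infinite. -/
structure PhiData (n : ℕ) (β : Braid (n + 1)) (W : List ℕ) (m : ℕ) (b : ℕ → Braid (n + 1))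
    (V : ℕ → List ℕ) : Prop where
  max : ∀ i, IsMaxRightDivisor (altSet (n + 1) i) (remainder β b i) (b i)
  nil : ∀ i, m < i → V i = []
  rem : remainder β b (m + 1) = 1
  eval : ∀ i, eval (n + 1) (place n i (V i)) = b i
  phi : ∀ i, IsPhiNormalForm n (BraidNF.eval n (V i)) (V i)
  word : W = descWord (fun i => place n i (V i)) m

theorem place_nil (n i : ℕ) : place n i [] = [] := by simp [place_eq_map]

theorem IsPhiNormalForm.two_le {n : ℕ} {β : Braid n} {W : List ℕ}
    (h : IsPhiNormalForm n β W) : 2 ≤ n := by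
  cases h <;> omega

theorem IsPhiNormalForm.exists_replicate {β : Braid 2} {W : List ℕ}
    (h : IsPhiNormalForm 2 β W) : ∃ p, β = sigma 2 1 ^ p ∧ W = List.replicate p 1 := by
  cases h with
  | two p => exact ⟨p, rfl, rfl⟩
  | step hn => omega

/-- Beyond `m` the decomposition is padded with trivial braids and empty words, so that
decompositions of different lengths can be compared factor by factor. -/
theorem IsPhiNormalForm.exists_data {n : ℕ} (hn : 2 ≤ n) {β : Braid (n + 1)} {W : List ℕ}
    (h : IsPhiNormalForm (n + 1) β W) : ∃ m b V, PhiData n β W m b V := by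
  cases h with
  | two p => omega
  | step _ _ m b V hb hm hVb hV =>
    have hrem : ∀ i, remainder β (fun i => if i ≤ m then b i else 1) i =
        if i ≤ m then remainder β b i else 1 := by
      intro i
      induction i with
      | zero => simp [remainder]
      | succ i ih =>
        rw [remainder, ih]
        by_cases h1 : i ≤ m
        · by_cases h2 : i + 1 ≤ m
          · simp [h1, h2, remainder]
          · obtain rfl : i = m := by omega
            simpa [remainder] using hm
        · simp [h1, show ¬ i + 1 ≤ m by omega]
    refine ⟨m, fun i => if i ≤ m then b i else 1, fun i => if i ≤ m then V i else [],
      ⟨fun i => ?_, fun i hi => if_neg (by omega), ?_, fun i => ?_, fun i => ?_, ?_⟩⟩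
    · rw [hrem]
      by_cases hi : i ≤ m
      · simpa [hi] using hb i hi
      · simpa [hi] using isMaxRightDivisor_one_one _
    · rw [hrem, if_neg (by omega)]
    · by_cases hi : i ≤ m
      · simpa [hi] using hVb i hi
      · simp [hi, place_nil, eval_nil]
    · by_cases hi : i ≤ m
      · simpa [hi] using hV i hi
      · simpa [hi, eval_nil] using isPhiNormalForm_nil hn
    · exact descWord_congr fun i hi => by simp [hi]

theorem IsPhiNormalForm.pos_and_eval {n : ℕ} {β : Braid n} {W : List ℕ}
    (h : IsPhiNormalForm n β W) : IsPositiveWord n W ∧ BraidNF.eval n W = β := by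
  have hn := h.two_le
  induction n, hn using Nat.le_induction generalizing W with
  | base =>
    obtain ⟨p, rfl, rfl⟩ := h.exists_replicate
    exact ⟨isPositiveWord_replicate p, eval_replicate p⟩
  | succ n hn ih =>
    obtain ⟨m, b, V, d⟩ := h.exists_data hn
    rw [d.word]
    refine ⟨isPositiveWord_descWord fun i _ => ?_, ?_⟩
    · rw [place_eq_map]
      exact (letterMap_place n i).isPositiveWord (ih (d.phi i)).1
    · have := remainder_mul_eval (β := β) (b := b) (m := m)
        (A := fun i => place n i (V i)) fun i _ => d.eval i
      rwa [d.rem, one_mul] at this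

theorem PhiData.isPositiveWord {n : ℕ} {β : Braid (n + 1)} {W : List ℕ} {m : ℕ}
    {b : ℕ → Braid (n + 1)} {V : ℕ → List ℕ} (d : PhiData n β W m b V) (i : ℕ) :
    IsPositiveWord n (V i) := (d.phi i).pos_and_eval.1

theorem PhiData.congr {n : ℕ} {β : Braid (n + 1)} {W W' : List ℕ} {m m' : ℕ}
    {b b' : ℕ → Braid (n + 1)} {V V' : ℕ → List ℕ} (d : PhiData n β W m b V)
    (d' : PhiData n β W' m' b' V') : b = b' := by
  have h : ∀ i, remainder β b i = remainder β b' i ∧ b i = b' i := by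
    intro i
    induction i with
    | zero => exact ⟨rfl, (d.max 0).unique (d'.max 0)⟩
    | succ i ih =>
      have e : remainder β b (i + 1) = remainder β b' (i + 1) := by
        rw [remainder, remainder, ih.1, ih.2]
      refine ⟨e, (d.max _).unique ?_⟩
      rw [e]
      exact d'.max _
  exact funext fun i => (h i).2

theorem IsPhiNormalForm.unique {n : ℕ} {β : Braid n} {W W' : List ℕ}
    (h : IsPhiNormalForm n β W) (h' : IsPhiNormalForm n β W') : W = W' := by
  have hn := h.two_le
  induction n, hn using Nat.le_induction generalizing W W' with
  | base =>
    obtain ⟨p, rfl, rfl⟩ := h.exists_replicate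
    obtain ⟨q, e, rfl⟩ := h'.exists_replicate
    rw [← eval_replicate, ← eval_replicate] at e
    have := length_eq_of_eval_eq (isPositiveWord_replicate p) (isPositiveWord_replicate q) e
    rw [List.length_replicate, List.length_replicate] at this
    rw [this]
  | succ n hn ih =>
    obtain ⟨m, b, V, d⟩ := h.exists_data hn
    obtain ⟨m', b', V', d'⟩ := h'.exists_data hn
    obtain rfl := d.congr d'
    have hV : V = V' := by
      funext i
      refine ih (d.phi i) ?_
      have e := (d.eval i).trans (d'.eval i).symm
      rw [place_eq_map, place_eq_map] at e
      rw [(letterMap_place n i).eval_eq (d.isPositiveWord i) (d'.isPositiveWord i) e]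
      exact d'.phi i
    subst hV
    -- The numbers of factors may differ by trailing empty ones; both words are extended to the
    -- larger number.
    rw [d.word, d'.word, ← descWord_of_nil (le_max_left m m'),
      ← descWord_of_nil (le_max_right m m')]
    · intro i hi; rw [d'.nil i hi, place_nil]
    · intro i hi; rw [d.nil i hi, place_nil]

/-! ### Length, and existence of the Φ-normal form -/

/-- The length of a braid. -/
def len {n : ℕ} (β : Braid n) : ℕ := (Multiplicative.toAdd (lengthHom n β)).toNat

theorem len_eval {n : ℕ} {W : List ℕ} (h : IsPositiveWord n W) : len (eval n W) = W.length := by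
  rw [len, lengthHom_eval h]; simp

theorem len_mul {n : ℕ} {x y : Braid n} (hx : x ∈ positiveBraids n)
    (hy : y ∈ positiveBraids n) : len (x * y) = len x + len y := by
  obtain ⟨U, hU, rfl⟩ := mem_positiveBraids.1 hx
  obtain ⟨V, hV, rfl⟩ := mem_positiveBraids.1 hy
  rw [← eval_append, len_eval hU, len_eval hV, len_eval (hU.append hV), List.length_append]

theorem eq_one_of_len {n : ℕ} {x : Braid n} (hx : x ∈ positiveBraids n) (h : len x = 0) :
    x = 1 := by
  obtain ⟨U, hU, rfl⟩ := mem_positiveBraids.1 hx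
  rw [len_eval hU] at h
  rw [List.length_eq_zero_iff.1 h, eval_nil]

/-- The maximal right divisor as a function. -/
noncomputable def maxDivisor {n : ℕ} (S : Set ℕ) (β : Braid n) : Braid n :=
  open Classical in
  if h : β ∈ positiveBraids n then (exists_isMaxRightDivisor S h).choose else 1

theorem maxDivisor_spec {n : ℕ} (S : Set ℕ) {β : Braid n} (h : β ∈ positiveBraids n) :
    IsMaxRightDivisor S β (maxDivisor S β) := by
  rw [maxDivisor, dif_pos h]
  exact (exists_isMaxRightDivisor S h).choose_spec

theorem altSet_cover {n a : ℕ} (hn : 2 ≤ n) (ha : 1 ≤ a ∧ a < n + 1) (i : ℕ) :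
    a ∈ altSet (n + 1) i ∨ a ∈ altSet (n + 1) (i + 1) := by
  unfold altSet
  by_cases h : i % 2 = 0
  · rw [if_pos h, if_neg (by omega)]
    simp only [Set.mem_ofPred_eq]; omega
  · rw [if_neg h, if_pos (by omega)]
    simp only [Set.mem_ofPred_eq]; omega

/-- Existence of the alternate decomposition. -/
theorem exists_alternate {n : ℕ} (hn : 2 ≤ n) {β : Braid (n + 1)}
    (hβ : β ∈ positiveBraids (n + 1)) : ∃ m b,
      (∀ i, IsMaxRightDivisor (altSet (n + 1) i) (remainder β b i) (b i)) ∧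
        remainder β b (m + 1) = 1 := by
  obtain ⟨ρ, rfl, hs⟩ : ∃ ρ : ℕ → Braid (n + 1), ρ 0 = β ∧
      ∀ i, ρ (i + 1) = ρ i * (maxDivisor (altSet (n + 1) i) (ρ i))⁻¹ :=
    ⟨fun i => Nat.rec β (fun i x => x * (maxDivisor (altSet (n + 1) i) x)⁻¹) i, rfl,
      fun _ => rfl⟩
  obtain ⟨b, hbρ⟩ : ∃ b : ℕ → Braid (n + 1), ∀ i, b i = maxDivisor (altSet (n + 1) i) (ρ i) :=
    ⟨_, fun _ => rfl⟩
  simp only [← hbρ] at hs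
  have hρ : ∀ i, remainder (ρ 0) b i = ρ i := by
    intro i
    induction i with
    | zero => rfl
    | succ i ih => rw [remainder, ih, hs]
  have hpos : ∀ i, ρ i ∈ positiveBraids (n + 1) := by
    intro i
    induction i with
    | zero => exact hβ
    | succ i ih => rw [hs, hbρ]; exact (maxDivisor_spec _ ih).dvd
  have hb : ∀ i, IsMaxRightDivisor (altSet (n + 1) i) (ρ i) (b i) :=
    fun i => by rw [hbρ]; exact maxDivisor_spec _ (hpos i)
  have hlen : ∀ i, len (ρ i) = len (ρ (i + 1)) + len (b i) := by
    intro i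
    rw [← len_mul (hpos _) (parabolic_le (hb i).mem), hs, inv_mul_cancel_right]
  -- Two consecutive trivial divisors are impossible: the two alternating index sets together
  -- contain every generator, so one of them would still catch the last letter.
  have hdec : ∀ i, ρ i ≠ 1 → len (ρ (i + 2)) < len (ρ i) := by
    intro i hi
    by_contra hlt
    have h1 := hlen i
    have h2 := hlen (i + 1)
    rw [show i + 1 + 1 = i + 2 by rfl] at h2
    have e1 := eq_one_of_len (parabolic_le (hb i).mem) (by omega)
    have e2 := eq_one_of_len (parabolic_le (hb (i + 1)).mem) (by omega)
    have e3 : ρ (i + 1) = ρ i := by rw [hs, e1]; simp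
    rcases mem_parabolic_cases (hpos i) with h | ⟨δ, hδ, a, -, ha, e⟩
    · exact hi h
    rcases altSet_cover hn ha i with h | h
    · refine sigma_ne_one ha ((hb i).eq_one (sigma_mem h ha) ?_)
      rw [e1, inv_one, mul_one, e, mul_inv_cancel_right]
      exact hδ
    · refine sigma_ne_one ha ((hb (i + 1)).eq_one (sigma_mem h ha) ?_)
      rw [e2, inv_one, mul_one, e3, e, mul_inv_cancel_right]
      exact hδ
  have hex : ∃ m, ρ m = 1 := by
    by_contra hne
    have hne : ∀ m, ρ m ≠ 1 := fun m h => hne ⟨m, h⟩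
    have : ∀ i, len (ρ (2 * i)) + i ≤ len (ρ 0) := by
      intro i
      induction i with
      | zero => simp
      | succ i ih =>
        have := hdec (2 * i) (hne _)
        rw [show 2 * (i + 1) = 2 * i + 2 by ring]
        omega
    have := this (len (ρ 0) + 1)
    omega
  obtain ⟨m, hm⟩ := hex
  refine ⟨m, b, fun i => by rw [hρ]; exact hb i, ?_⟩
  rw [hρ]
  -- The remainder is already trivial at `m`; the required index `m + 1` is one division further,
  -- where the length cannot have grown.
  refine eq_one_of_len (hpos _) ?_
  have h1 := hlen m
  have h0 : len (1 : Braid (n + 1)) = 0 := by simp [len]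
  rw [hm, h0] at h1
  omega

theorem exists_isPhiNormalForm {n : ℕ} (hn : 2 ≤ n) {β : Braid n}
    (hβ : β ∈ positiveBraids n) : ∃ W, IsPhiNormalForm n β W := by
  induction n, hn using Nat.le_induction with
  | base =>
    obtain ⟨W, hW, rfl⟩ := mem_positiveBraids.1 hβ
    rw [exists_replicate hW, eval_replicate]
    exact ⟨_, .two _⟩
  | succ n hn ih =>
    obtain ⟨m, b, hb, hm⟩ := exists_alternate hn hβ
    have hV : ∀ i, ∃ V, eval (n + 1) (place n i V) = b i ∧ IsPhiNormalForm n (eval n V) V := by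
      intro i
      obtain ⟨U, hU, e⟩ := (letterMap_place n i).exists_word (hb i).mem
      obtain ⟨V, hV⟩ := ih (eval_mem hU)
      obtain ⟨h1, h2⟩ := hV.pos_and_eval
      refine ⟨V, ?_, by rwa [h2]⟩
      rw [place_eq_map, ← e]
      exact (letterMap_place n i).eval_map_eq h1 h2 hU
    choose V hV1 hV2 using hV
    exact ⟨_, .step hn β m b V (fun i _ => hb i) hm (fun i _ => hV1 i) fun i _ => hV2 i⟩

/-! #### The tail-twisted Φ-normal form -/

/-- The data of a tail-twisted Φ-normal form. -/
structure TailData (n : ℕ) (k : List ℕ) (β : Braid (n + 1)) (W : List ℕ)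
    (tail main : Braid (n + 1)) (t : ℕ → Braid (n + 1)) (N : List ℕ) (V : ℕ → List ℕ) :
    Prop where
  htail : IsMaxRightDivisor {a | 1 ≤ a ∧ a ≤ n ∧ a ≠ kAt k 1} β tail
  ht0 : IsMaxRightDivisor {a | 2 ≤ a ∧ a ≤ n} (β * tail⁻¹) (t 0)
  hmain : main = β * tail⁻¹ * (t 0)⁻¹
  ht : ∀ j, 1 ≤ j → j ≤ n - 1 →
    IsMaxRightDivisor {a | lowerEnd k j ≤ a ∧ a ≤ upperEnd (n + 1) k j - 1}
      (tailRemainder tail t (n - 1) j) (t j)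
  hN : IsPhiNormalForm (n + 1) main N
  hV0t : eval (n + 1) (unshift 1 (V 0)) = t 0
  hV0 : IsTailTwistedNormalForm n (restPerm k) (eval n (V 0)) (V 0)
  hVt : ∀ j, 1 ≤ j → j ≤ n - 1 →
    eval (n + 1) (unshift (lowerEnd k j - 1) (V j)) = t j
  hV : ∀ j, 1 ≤ j → j ≤ n - 1 →
    IsTailTwistedNormalForm (strands (n + 1) k j) (tailPerm (n + 1) k j)
      (eval (strands (n + 1) k j) (V j)) (V j)
  word : W = N ++ unshift 1 (V 0) ++
    ascWord (fun j => unshift (lowerEnd k j - 1) (V j)) (n - 1)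

theorem TailData.isTailTwistedNormalForm {n : ℕ} (hn : 2 ≤ n) {k : List ℕ} {β : Braid (n + 1)}
    {W : List ℕ} {tail main : Braid (n + 1)} {t : ℕ → Braid (n + 1)} {N : List ℕ}
    {V : ℕ → List ℕ} (d : TailData n k β W tail main t N V) :
    IsTailTwistedNormalForm (n + 1) k β W := by
  rw [d.word]
  exact .step hn k β tail main t N V d.htail d.ht0 d.hmain d.ht d.hN d.hV0t d.hV0 d.hVt d.hV

namespace IsTailTwistedNormalForm

theorem two_le {n : ℕ} {k : List ℕ} {β : Braid n} {W : List ℕ}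
    (h : IsTailTwistedNormalForm n k β W) : 2 ≤ n := by
  cases h <;> omega

theorem exists_replicate {k : List ℕ} {β : Braid 2} {W : List ℕ}
    (h : IsTailTwistedNormalForm 2 k β W) :
    ∃ p, β = sigma 2 1 ^ p ∧ W = List.replicate p 1 := by
  cases h with
  | two k p => exact ⟨p, rfl, rfl⟩
  | step hn => omega

theorem exists_data {n : ℕ} (hn : 2 ≤ n) {k : List ℕ} {β : Braid (n + 1)} {W : List ℕ}
    (h : IsTailTwistedNormalForm (n + 1) k β W) :
    ∃ tail main t N V, TailData n k β W tail main t N V := by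
  cases h with
  | two k p => omega
  | step _ _ _ tail main t N V h1 h2 h3 h4 h5 h6 h7 h8 h9 =>
    exact ⟨tail, main, t, N, V, h1, h2, h3, h4, h5, h6, h7, h8, h9, rfl⟩

end IsTailTwistedNormalForm

theorem letterMap_one (n : ℕ) : LetterMap n (n + 1) {a | 2 ≤ a ∧ a ≤ n} (· + 1) := by
  have := letterMap_shift (p := 1) (s := n) (n := n + 1) (by omega)
  rwa [show 1 + n - 1 = n by omega] at this

/-- An interval with `j ≥ 1` has `k(1)` cut off on one side. This makes the recursion through the
tail factors well founded. -/
theorem IsPermutation.strands_lt {n : ℕ} {k : List ℕ} (h : IsPermutation n k) {j : ℕ}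
    (hj1 : 1 ≤ j) (hj : j < n - 1) : strands n k j < n := by
  have h1 := h.not_mem_of_mem_take hj
    ((mem_take_iff_kAt (by rw [h.length]; omega)).2 ⟨0, hj1, rfl⟩)
  have h2 := h.kAt_bounds (j := 0) (by omega)
  have h3 := upperEnd_le n k j
  have h4 := one_le_lowerEnd k j
  simp only [zero_add] at *
  unfold strands
  omega

theorem IsTailTwistedNormalForm.pos_and_eval {n : ℕ} {k : List ℕ} (hk : IsPermutation n k)
    {β : Braid n} {W : List ℕ} (h : IsTailTwistedNormalForm n k β W) :
    IsPositiveWord n W ∧ eval n W = β := by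
  have hn := h.two_le
  induction n using Nat.strong_induction_on generalizing W k with
  | _ n ih =>
  rcases hn.eq_or_lt with rfl | hn
  · obtain ⟨p, rfl, rfl⟩ := h.exists_replicate
    exact ⟨isPositiveWord_replicate p, eval_replicate p⟩
  obtain ⟨n, rfl⟩ : ∃ m, n = m + 1 := ⟨n - 1, by omega⟩
  obtain ⟨tail, main, t, N, V, d⟩ := h.exists_data (by omega)
  have hV0 := (ih n (by omega) hk.restPerm d.hV0 (by omega)).1
  have hV : ∀ j, 1 ≤ j → j ≤ n - 1 → IsPositiveWord (strands (n + 1) k j) (V j) :=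
    fun j h1 h2 => (ih _ (hk.strands_lt h1 (by omega)) (hk.tailPerm (by omega)) (d.hV j h1 h2)
      (d.hV j h1 h2).two_le).1
  have hX : ∀ j, 1 ≤ j → j ≤ n - 1 →
      IsPositiveWord (n + 1) (unshift (lowerEnd k j - 1) (V j)) :=
    fun j h1 h2 => (hk.letterMap_interval (by omega)).isPositiveWord (hV j h1 h2)
  rw [d.word]
  refine ⟨(d.hN.pos_and_eval.1.append ((letterMap_one n).isPositiveWord hV0)).append
    (isPositiveWord_ascWord hX), ?_⟩
  have h0 := tailRemainder_zero hk d.htail.mem d.ht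
  have h1 := tailRemainder_mul_eval (tail := tail) d.hVt le_rfl
  rw [h0, one_mul, tailRemainder_self] at h1
  rw [eval_append, eval_append, h1, d.hN.pos_and_eval.2, d.hmain, d.hV0t]
  group

theorem TailData.isPositiveWord_zero {n : ℕ} {k : List ℕ} (hk : IsPermutation (n + 1) k)
    {β : Braid (n + 1)} {W : List ℕ} {tail main : Braid (n + 1)} {t : ℕ → Braid (n + 1)}
    {N : List ℕ} {V : ℕ → List ℕ} (d : TailData n k β W tail main t N V) :
    IsPositiveWord n (V 0) := (d.hV0.pos_and_eval hk.restPerm).1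

theorem TailData.isPositiveWord {n : ℕ} {k : List ℕ} (hk : IsPermutation (n + 1) k)
    {β : Braid (n + 1)} {W : List ℕ} {tail main : Braid (n + 1)} {t : ℕ → Braid (n + 1)}
    {N : List ℕ} {V : ℕ → List ℕ} (d : TailData n k β W tail main t N V) {j : ℕ} (h1 : 1 ≤ j)
    (h2 : j ≤ n - 1) : IsPositiveWord (strands (n + 1) k j) (V j) :=
  ((d.hV j h1 h2).pos_and_eval (hk.tailPerm (by omega))).1

theorem tailRemainder_congr {n r : ℕ} {tail : Braid n} {t t' : ℕ → Braid n} {j : ℕ}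
    (h : ∀ l, j < l → l ≤ r → t l = t' l) :
    tailRemainder tail t r j = tailRemainder tail t' r j := by
  unfold tailRemainder
  congr 2
  refine List.map_congr_left fun l hl => ?_
  rw [List.mem_reverse, List.mem_range'_1] at hl
  rw [h l (by omega) (by omega)]

/-- The remainder at `j` involves only factors of larger index, so the sequence is determined
downwards from `r`. -/
theorem eq_of_isMaxRightDivisor_tailRemainder {n r : ℕ} {T : ℕ → Set ℕ} {tail : Braid n}
    {t t' : ℕ → Braid n}
    (ht : ∀ j, 1 ≤ j → j ≤ r → IsMaxRightDivisor (T j) (tailRemainder tail t r j) (t j))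
    (ht' : ∀ j, 1 ≤ j → j ≤ r → IsMaxRightDivisor (T j) (tailRemainder tail t' r j) (t' j)) :
    ∀ j, 1 ≤ j → j ≤ r → t j = t' j := by
  suffices ∀ d j, r - j = d → 1 ≤ j → j ≤ r → t j = t' j from fun j => this _ j rfl
  intro d
  induction d using Nat.strong_induction_on with
  | _ d ih =>
  intro j hd h1 h2
  refine (ht j h1 h2).unique ?_
  rw [tailRemainder_congr fun l hl hl' => ih (r - l) (by omega) l rfl (by omega) hl']
  exact ht' j h1 h2

theorem IsTailTwistedNormalForm.unique {n : ℕ} {k : List ℕ} (hk : IsPermutation n k)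
    {β : Braid n} {W W' : List ℕ} (h : IsTailTwistedNormalForm n k β W)
    (h' : IsTailTwistedNormalForm n k β W') : W = W' := by
  have hn := h.two_le
  induction n using Nat.strong_induction_on generalizing W W' k with
  | _ n ih =>
  rcases hn.eq_or_lt with rfl | hn
  · obtain ⟨p, rfl, rfl⟩ := h.exists_replicate
    obtain ⟨q, e, rfl⟩ := h'.exists_replicate
    rw [← eval_replicate, ← eval_replicate] at e
    have := length_eq_of_eval_eq (isPositiveWord_replicate p) (isPositiveWord_replicate q) e
    rw [List.length_replicate, List.length_replicate] at this
    rw [this]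
  obtain ⟨n, rfl⟩ : ∃ m, n = m + 1 := ⟨n - 1, by omega⟩
  obtain ⟨tail, main, t, N, V, d⟩ := h.exists_data (by omega)
  obtain ⟨tail', main', t', N', V', d'⟩ := h'.exists_data (by omega)
  obtain rfl := d.htail.unique d'.htail
  have e0 := d.ht0.unique d'.ht0
  have em : main = main' := by rw [d.hmain, d'.hmain, e0]
  subst em
  have et := eq_of_isMaxRightDivisor_tailRemainder d.ht d'.ht
  rw [d.word, d'.word, d.hN.unique d'.hN]
  have eV0 : V 0 = V' 0 := by
    refine ih n (by omega) hk.restPerm d.hV0 ?_ (by omega)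
    rw [(letterMap_one n).eval_eq (d.isPositiveWord_zero hk) (d'.isPositiveWord_zero hk)
      ((d.hV0t.trans e0).trans d'.hV0t.symm)]
    exact d'.hV0
  rw [eV0]
  congr 1
  refine ascWord_congr fun j h1 h2 => ?_
  congr 1
  refine ih _ (hk.strands_lt h1 (by omega)) (hk.tailPerm (by omega)) (d.hV j h1 h2) ?_
    (d.hV j h1 h2).two_le
  rw [(hk.letterMap_interval (by omega)).eval_eq (d.isPositiveWord hk h1 h2)
    (d'.isPositiveWord hk h1 h2)
    (((d.hVt j h1 h2).trans (et j h1 h2)).trans (d'.hVt j h1 h2).symm)]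
  exact d'.hV j h1 h2

/-- Successive division from index `r` down, with `q d` the remainder after `d` divisions. These
divisions never use the entry at `0`, which is left free to hold `β_{T_0}`. -/
theorem exists_tail_sequence {n : ℕ} (r : ℕ) (T : ℕ → Set ℕ) {tail : Braid n} (t₀ : Braid n)
    (h : tail ∈ positiveBraids n) : ∃ t : ℕ → Braid n, t 0 = t₀ ∧ ∀ j, 1 ≤ j → j ≤ r →
      IsMaxRightDivisor (T j) (tailRemainder tail t r j) (t j) := by
  let q : ℕ → Braid n := fun d =>
    Nat.rec tail (fun d x => x * (maxDivisor (T (r - d)) x)⁻¹) d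
  have hpos : ∀ d, q d ∈ positiveBraids n := by
    intro d
    induction d with
    | zero => exact h
    | succ d ih => exact (maxDivisor_spec _ ih).dvd
  have hs : ∀ d, q (d + 1) = q d * (maxDivisor (T (r - d)) (q d))⁻¹ := fun _ => rfl
  let t : ℕ → Braid n := fun j => if j = 0 then t₀ else maxDivisor (T j) (q (r - j))
  have hrem : ∀ d ≤ r, tailRemainder tail t r (r - d) = q d := by
    intro d hd
    induction d with
    | zero => exact tailRemainder_self _ _ _
    | succ d ih =>
      rw [tailRemainder_of_lt _ _ (by omega), show r - (d + 1) + 1 = r - d by omega,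
        ih (by omega), hs]
      simp only [t]
      rw [if_neg (by omega), show r - (r - d) = d by omega]
  refine ⟨t, if_pos rfl, fun j h1 h2 => ?_⟩
  have := hrem (r - j) (by omega)
  rw [show r - (r - j) = j by omega] at this
  rw [this]
  simp only [t]
  rw [if_neg (by omega)]
  exact maxDivisor_spec _ (hpos _)

theorem exists_isTailTwistedNormalForm {n : ℕ} (hn : 2 ≤ n) {k : List ℕ}
    (hk : IsPermutation n k) {β : Braid n} (hβ : β ∈ positiveBraids n) :
    ∃ W, IsTailTwistedNormalForm n k β W := by
  induction n using Nat.strong_induction_on generalizing k with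
  | _ n ih =>
  rcases hn.eq_or_lt with rfl | hn
  · obtain ⟨W, hW, rfl⟩ := mem_positiveBraids.1 hβ
    rw [exists_replicate hW, eval_replicate]
    exact ⟨_, .two _ _⟩
  obtain ⟨n, rfl⟩ : ∃ m, n = m + 1 := ⟨n - 1, by omega⟩
  obtain ⟨tail, htail⟩ := exists_isMaxRightDivisor {a | 1 ≤ a ∧ a ≤ n ∧ a ≠ kAt k 1} hβ
  obtain ⟨t₀, ht₀⟩ := exists_isMaxRightDivisor {a | 2 ≤ a ∧ a ≤ n} htail.dvd
  obtain ⟨t, rfl, ht⟩ := exists_tail_sequence (n - 1)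
    (fun j => {a | lowerEnd k j ≤ a ∧ a ≤ upperEnd (n + 1) k j - 1}) t₀ (parabolic_le htail.mem)
  obtain ⟨N, hN⟩ := exists_isPhiNormalForm (by omega) ht₀.dvd
  obtain ⟨V₀, hV0t, hV0⟩ : ∃ V, eval (n + 1) (unshift 1 V) = t 0 ∧
      IsTailTwistedNormalForm n (restPerm k) (eval n V) V := by
    obtain ⟨U, hU, e⟩ := (letterMap_one n).exists_word ht₀.mem
    obtain ⟨V, hV⟩ := ih n (by omega) (by omega) hk.restPerm (eval_mem hU)
    obtain ⟨h1, h2⟩ := hV.pos_and_eval hk.restPerm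
    exact ⟨V, ((letterMap_one n).eval_map_eq h1 h2 hU).trans e, by rwa [h2]⟩
  have hV : ∀ j, ∃ V, (j = 0 → V = V₀) ∧ (1 ≤ j → j ≤ n - 1 →
      eval (n + 1) (unshift (lowerEnd k j - 1) V) = t j ∧
      IsTailTwistedNormalForm (strands (n + 1) k j) (tailPerm (n + 1) k j)
        (eval (strands (n + 1) k j) V) V) := by
    intro j
    by_cases hj : 1 ≤ j ∧ j ≤ n - 1
    · have hj' : j < n + 1 - 1 := by omega
      obtain ⟨U, hU, e⟩ := (hk.letterMap_interval hj').exists_word (ht j hj.1 hj.2).mem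
      obtain ⟨V, hV⟩ := ih _ (hk.strands_lt hj.1 hj') (hk.strands_bounds hj').1
        (hk.tailPerm hj') (eval_mem hU)
      obtain ⟨h1, h2⟩ := hV.pos_and_eval (hk.tailPerm hj')
      exact ⟨V, fun h => by omega, fun _ _ =>
        ⟨((hk.letterMap_interval hj').eval_map_eq h1 h2 hU).trans e, by rwa [h2]⟩⟩
    · exact ⟨V₀, fun _ => rfl, fun h1 h2 => absurd ⟨h1, h2⟩ hj⟩
  choose V hV0' hV' using hV
  obtain rfl := hV0' 0 rfl
  exact ⟨_, TailData.isTailTwistedNormalForm (by omega) ⟨htail, ht₀, rfl, ht, hN, hV0t, hV0,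
    fun j h1 h2 => (hV' j h1 h2).1, fun j h1 h2 => (hV' j h1 h2).2, rfl⟩⟩

/-! ### The Φ-normal form is the tail-twisted one of the trivial permutation -/

theorem isPermutation_range' (n : ℕ) : IsPermutation n (List.range' 1 (n - 1)) :=
  List.Perm.refl _

theorem kAt_range' {n j : ℕ} (hj : j < n) : kAt (List.range' 1 n) (j + 1) = j + 1 := by
  rw [kAt, Nat.add_sub_cancel, List.getD_eq_getElem _ _ (by simpa using hj)]
  simp [add_comm]

theorem mem_take_range' {n j a : ℕ} (hj : j < n) :
    a ∈ (List.range' 1 n).take j ↔ 1 ≤ a ∧ a ≤ j := by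
  rw [mem_take_iff_kAt (by simpa using hj.le)]
  constructor
  · rintro ⟨i, hi, rfl⟩
    rw [kAt_range' (by omega)]; omega
  · intro h
    exact ⟨a - 1, by omega, by rw [kAt_range' (by omega)]; omega⟩

theorem lowerEnd_range' {n j : ℕ} (hj : j < n) : lowerEnd (List.range' 1 n) j = j + 1 := by
  apply le_antisymm
  · refine lowerEnd_le (by omega) fun a ha _ => ?_
    rw [mem_take_range' hj] at ha; omega
  · rcases Nat.eq_zero_or_pos j with rfl | h
    · exact one_le_lowerEnd _ _
    · exact lt_lowerEnd ((mem_take_range' hj).2 ⟨h, le_rfl⟩) (by rw [kAt_range' hj]; omega)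

theorem upperEnd_range' {n j : ℕ} (hj : j < n) :
    upperEnd (n + 1) (List.range' 1 n) j = n + 1 := by
  rcases upperEnd_cases (n + 1) (List.range' 1 n) j with h | ⟨h, h'⟩
  · exact h
  · rw [mem_take_range' hj] at h
    rw [kAt_range' hj] at h'
    omega

theorem strands_range' {n j : ℕ} (hj : j < n) :
    strands (n + 1) (List.range' 1 n) j = n - j + 1 := by
  rw [strands, lowerEnd_range' hj, upperEnd_range' hj]; omega

theorem tailPerm_range' {n j : ℕ} (hj : j < n) :
    tailPerm (n + 1) (List.range' 1 n) j = List.range' 1 (n - j) := by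
  rw [tailPerm, lowerEnd_range' hj, upperEnd_range' hj, List.drop_range', Nat.add_sub_cancel,
    List.filter_eq_self.2]
  · rw [List.map_sub_range' (by omega)]; congr 1; omega
  · intro a ha
    rw [List.mem_range'_1] at ha
    simp only [decide_eq_true_eq]; omega

theorem isTailTwistedNormalForm_nil {n : ℕ} (hn : 2 ≤ n) {k : List ℕ} (hk : IsPermutation n k) :
    IsTailTwistedNormalForm n k 1 [] := by
  obtain ⟨W, hW⟩ := exists_isTailTwistedNormalForm hn hk (one_mem _)
  obtain ⟨h1, h2⟩ := hW.pos_and_eval hk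
  rwa [eq_nil_of_eval_eq_one h1 h2] at hW

theorem descWord_eq_append (A : ℕ → List ℕ) (m : ℕ) :
    descWord A m = descWord (fun i => if i = 0 then [] else A i) m ++ A 0 := by
  induction m with
  | zero => simp [descWord_zero]
  | succ m ih => rw [descWord_succ, ih, descWord_succ]; simp

theorem ascWord_succ' (X : ℕ → List ℕ) (r : ℕ) :
    ascWord X (r + 1) = X 1 ++ ascWord (fun j => X (j + 1)) r := by
  induction r with
  | zero => simp [ascWord_succ, ascWord_zero]
  | succ r ih => rw [ascWord_succ, ih, ascWord_succ, List.append_assoc]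

/-- Once `b 0` has been split off, the first maximal divisor is trivial and the later ones are
unchanged. -/
theorem PhiData.isPhiNormalForm_remainder {n : ℕ} (hn : 2 ≤ n) {β : Braid (n + 1)} {W : List ℕ}
    {m : ℕ} {b : ℕ → Braid (n + 1)} {V : ℕ → List ℕ} (d : PhiData n β W m b V) :
    IsPhiNormalForm (n + 1) (β * (b 0)⁻¹)
      (descWord (fun i => if i = 0 then [] else place n i (V i)) m) := by
  have hrem : ∀ i, remainder (β * (b 0)⁻¹) (fun i => if i = 0 then 1 else b i) (i + 1) =
      remainder β b (i + 1) := by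
    intro i
    induction i with
    | zero => simp [remainder]
    | succ i ih => rw [remainder, ih, if_neg (by omega)]; rfl
  have := IsPhiNormalForm.step hn (β * (b 0)⁻¹) m (fun i => if i = 0 then 1 else b i)
    (fun i => if i = 0 then [] else V i) ?_ ?_ ?_ ?_
  · convert this using 2
    funext i
    split_ifs with h
    · rw [place_nil]
    · rfl
  · intro i _
    cases i with
    | zero => exact .one (d.max 0).dvd fun δ hδ h => (d.max 0).eq_one hδ h
    | succ i => rw [hrem, if_neg (by omega)]; exact d.max _
  · rw [hrem, d.rem]
  · intro i _
    by_cases h : i = 0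
    · simp [h, place_nil, eval_nil]
    · simpa [h] using d.eval i
  · intro i _
    by_cases h : i = 0
    · simpa [h, eval_nil] using isPhiNormalForm_nil hn
    · simpa [h] using d.phi i

theorem tailRemainder_eq_eval {n r : ℕ} {tail : Braid n} {t : ℕ → Braid n} {X : ℕ → List ℕ}
    (h : ∀ j, 1 ≤ j → j ≤ r → eval n (X j) = t j) (htail : eval n (ascWord X r) = tail) {j : ℕ}
    (hj : j ≤ r) : tailRemainder tail t r j = eval n (ascWord X j) := by
  have h0 := tailRemainder_mul_eval (tail := tail) h le_rfl
  rw [tailRemainder_self, htail, mul_eq_right] at h0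
  rw [← tailRemainder_mul_eval h hj, h0, one_mul]

theorem TailData.tailRemainder_eq {n : ℕ} {k : List ℕ} (hk : IsPermutation (n + 1) k)
    {β : Braid (n + 1)} {W : List ℕ} {tail main : Braid (n + 1)} {t : ℕ → Braid (n + 1)}
    {N : List ℕ} {V : ℕ → List ℕ} (d : TailData n k β W tail main t N V) {j : ℕ}
    (hj : j ≤ n - 1) : tailRemainder tail t (n - 1) j =
      eval (n + 1) (ascWord (fun j => unshift (lowerEnd k j - 1) (V j)) j) := by
  rw [← tailRemainder_mul_eval d.hVt hj, tailRemainder_zero hk d.htail.mem d.ht, one_mul]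

/-- Maximal right divisors of the partial tails are also maximal right divisors of the whole
remaining braid. -/
theorem IsMaxRightDivisor.of_tail {n : ℕ} {S T : Set ℕ} {β tail ρ t : Braid n}
    (h : IsMaxRightDivisor S β tail) (hs : ρ⁻¹ * tail ∈ parabolic n S)
    (hTS : ∀ a ∈ T, 1 ≤ a → a < n → a ∈ S) (ht : IsMaxRightDivisor T ρ t) :
    IsMaxRightDivisor T (β * tail⁻¹ * ρ) t where
  mem := ht.mem
  dvd := by rw [mul_assoc]; exact mul_mem h.dvd ht.dvd
  max δ hδ hd := by
    refine ht.max δ hδ ?_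
    have := h.max (δ * (ρ⁻¹ * tail)) (mul_mem (parabolic_mono hTS hδ) hs) (by
      have e : β * (δ * (ρ⁻¹ * tail))⁻¹ = β * tail⁻¹ * ρ * δ⁻¹ := by group
      rwa [e])
    have e : tail * (δ * (ρ⁻¹ * tail))⁻¹ = ρ * δ⁻¹ := by group
    rw [e] at this
    exact parabolic_le this

theorem inv_tailRemainder_mul_mem {n r : ℕ} {S : Set ℕ} {tail : Braid n} {t : ℕ → Braid n}
    (h : ∀ l, 1 ≤ l → l ≤ r → t l ∈ parabolic n S) {j : ℕ} (hj : j ≤ r) :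
    (tailRemainder tail t r j)⁻¹ * tail ∈ parabolic n S := by
  obtain ⟨d, rfl⟩ : ∃ d, r = j + d := ⟨r - j, by omega⟩
  induction d generalizing j with
  | zero => simp [tailRemainder_self]
  | succ d ih =>
    have h1 := ih (j := j + 1) (by rwa [show j + 1 + d = j + (d + 1) by omega]) (by omega)
    rw [show j + 1 + d = j + (d + 1) by omega] at h1
    rw [tailRemainder_of_lt _ _ (by omega), mul_inv_rev, inv_inv, mul_assoc]
    exact mul_mem (h _ (by omega) (by omega)) h1

/-- The factors of the tail remain maximal divisors when the main part is present. -/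
theorem TailData.isMaxRightDivisor {n : ℕ} {k : List ℕ} (hk : IsPermutation (n + 1) k)
    {β : Braid (n + 1)} {W : List ℕ} {tail main : Braid (n + 1)} {t : ℕ → Braid (n + 1)}
    {N : List ℕ} {V : ℕ → List ℕ} (d : TailData n k β W tail main t N V) {j : ℕ} (h1 : 1 ≤ j)
    (hj : j ≤ n - 1) :
    IsMaxRightDivisor {a | lowerEnd k j ≤ a ∧ a ≤ upperEnd (n + 1) k j - 1}
      (β * tail⁻¹ * tailRemainder tail t (n - 1) j) (t j) := by
  have hsub : ∀ l, 1 ≤ l → l ≤ n - 1 →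
      ∀ a ∈ {a | lowerEnd k l ≤ a ∧ a ≤ upperEnd (n + 1) k l - 1}, 1 ≤ a → a < n + 1 →
      a ∈ {a | 1 ≤ a ∧ a ≤ n ∧ a ≠ kAt k 1} := fun l hl hl' a ha h1 h2 =>
    ⟨h1, by omega, hk.interval_ne hl (by omega) ha⟩
  exact d.htail.of_tail (inv_tailRemainder_mul_mem
    (fun l hl hl' => parabolic_mono (hsub l hl hl') (d.ht l hl hl').mem) hj)
    (hsub j h1 hj) (d.ht j h1 hj)

/-- For the trivial permutation `k(1) = 1`, so the tail is cut out by the same generators as `b 0`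
and equals it; `β_{T_0}` is then trivial and the main part is the product of the other factors. The
hypotheses on `X` say that the word of `b 0` splits correctly into tail factors. -/
theorem PhiData.isTailTwistedNormalForm {n : ℕ} (hn : 2 ≤ n) {β : Braid (n + 1)} {W : List ℕ}
    {m : ℕ} {b : ℕ → Braid (n + 1)} {V : ℕ → List ℕ} (d : PhiData n β W m b V)
    (X : ℕ → List ℕ) (hX : unshift 1 (V 0) = ascWord (fun j => unshift j (X j)) (n - 1))
    (hmax : ∀ j, 1 ≤ j → j ≤ n - 1 → IsMaxRightDivisor {a | j + 1 ≤ a ∧ a ≤ n}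
      (BraidNF.eval (n + 1) (ascWord (fun j => unshift j (X j)) j))
      (BraidNF.eval (n + 1) (unshift j (X j))))
    (hTT : ∀ j, 1 ≤ j → j ≤ n - 1 → IsTailTwistedNormalForm (n - j + 1) (List.range' 1 (n - j))
      (BraidNF.eval (n - j + 1) (X j)) (X j)) :
    IsTailTwistedNormalForm (n + 1) (List.range' 1 n) β W := by
  have hk := isPermutation_range' (n + 1)
  simp only [Nat.add_sub_cancel] at hk
  have hset : {a | 1 ≤ a ∧ a ≤ n ∧ a ≠ kAt (List.range' 1 n) 1} = altSet (n + 1) 0 := by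
    have := kAt_range' (n := n) (j := 0) (by omega)
    rw [zero_add] at this
    ext a
    simp only [this, altSet, Set.mem_ofPred_eq]
    simp only [if_true, Set.mem_ofPred_eq]
    omega
  have hset' : {a | 2 ≤ a ∧ a ≤ n} = altSet (n + 1) 0 := by simp [altSet]
  have hl : ∀ j, j ≤ n - 1 → lowerEnd (List.range' 1 n) j - 1 = j := fun j hj => by
    rw [lowerEnd_range' (by omega)]; rfl
  let t : ℕ → Braid (n + 1) := fun j => if j = 0 then 1 else BraidNF.eval (n + 1) (unshift j (X j))
  let Y : ℕ → List ℕ := fun j => if j = 0 then [] else X j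
  have ht : ∀ j, 1 ≤ j → t j = BraidNF.eval (n + 1) (unshift j (X j)) :=
    fun j hj => if_neg (by omega)
  have hY : ∀ j, 1 ≤ j → Y j = X j := fun j hj => if_neg (by omega)
  have hb0 : BraidNF.eval (n + 1) (ascWord (fun j => unshift j (X j)) (n - 1)) = b 0 := by
    rw [← hX, ← d.eval 0]; simp [place]
  refine TailData.isTailTwistedNormalForm hn (tail := b 0) (t := t) (main := β * (b 0)⁻¹)
    (N := descWord (fun i => if i = 0 then [] else place n i (V i)) m) (V := Y)
    { htail := by rw [hset]; exact d.max 0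
      ht0 := by
        rw [hset']
        exact .one (d.max 0).dvd fun δ hδ h => (d.max 0).eq_one hδ h
      hmain := by simp [t]
      ht := fun j h1 h2 => by
        rw [lowerEnd_range' (by omega), upperEnd_range' (by omega), Nat.add_sub_cancel, ht j h1,
          tailRemainder_eq_eval (fun j h _ => (ht j h).symm) hb0 h2]
        exact hmax j h1 h2
      hN := d.isPhiNormalForm_remainder hn
      hV0t := by simp [Y, t, unshift, eval_nil]
      hV0 := by
        simpa [Y, eval_nil] using isTailTwistedNormalForm_nil hn hk.restPerm
      hVt := fun j h1 h2 => by rw [hY j h1, ht j h1, hl j h2]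
      hV := fun j h1 h2 => by
        rw [strands_range' (by omega), tailPerm_range' (by omega), hY j h1]
        exact hTT j h1 h2
      word := ?_ }
  have e : ascWord (fun j => unshift (lowerEnd (List.range' 1 n) j - 1) (Y j)) (n - 1) =
      unshift 1 (V 0) := by
    rw [hX]
    exact ascWord_congr fun j h1 h2 => by rw [hl j h2, hY j h1]
  rw [e, d.word, descWord_eq_append]
  simp [Y, place, unshift]

theorem unshift_append (p : ℕ) (U V : List ℕ) : unshift p (U ++ V) = unshift p U ++ unshift p V := by
  simp [unshift]

theorem unshift_ascWord (p : ℕ) (X : ℕ → List ℕ) (r : ℕ) :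
    unshift p (ascWord X r) = ascWord (fun j => unshift p (X j)) r := by
  induction r with
  | zero => rfl
  | succ r ih => rw [ascWord_succ, ascWord_succ, unshift_append, ih]

theorem unshift_unshift (p q : ℕ) (V : List ℕ) : unshift p (unshift q V) = unshift (q + p) V := by
  simp [unshift]

/-- By induction the Φ-word of the first factor `b 0` is tail-twisted on one strand fewer. Its main
part becomes the first tail factor of `β`, and its `j`-th tail factor becomes the `(j+1)`-st. -/
theorem IsPhiNormalForm.isTailTwistedNormalForm {n : ℕ} {β : Braid n} {W : List ℕ}
    (h : IsPhiNormalForm n β W) : IsTailTwistedNormalForm n (List.range' 1 (n - 1)) β W := by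
  have hn := h.two_le
  induction n, hn using Nat.le_induction generalizing W with
  | base =>
    obtain ⟨p, rfl, rfl⟩ := h.exists_replicate
    exact .two _ p
  | succ n hn ih =>
    obtain ⟨m, b, V, d⟩ := h.exists_data hn
    have hV0 := ih (d.phi 0)
    rw [Nat.add_sub_cancel]
    -- On three strands there is a single tail factor, and it is all of `b 0`.
    rcases hn.eq_or_lt with rfl | hn'
    · refine d.isTailTwistedNormalForm hn (fun _ => V 0) (by simp [ascWord_succ, ascWord_zero])
        (fun j h1 h2 => ?_) (fun j h1 h2 => ?_)
      · obtain rfl : j = 1 := by omega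
        simp only [ascWord_succ, ascWord_zero, List.nil_append, zero_add]
        exact .self ((letterMap_one 2).eval_mem (d.isPositiveWord 0))
      · obtain rfl : j = 1 := by omega
        exact hV0
    obtain ⟨n, rfl⟩ : ∃ l, n = l + 1 := ⟨n - 1, by omega⟩
    obtain ⟨tail, main, t, N, U, d'⟩ := hV0.exists_data (by omega)
    have hk := isPermutation_range' (n + 1)
    simp only [Nat.add_sub_cancel] at hk d'
    have hl : ∀ j, j ≤ n - 1 → lowerEnd (List.range' 1 n) j - 1 = j := fun j hj => by
      rw [lowerEnd_range' (by omega)]; rfl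
    -- For the trivial permutation the tail has already removed everything that `β_{T_0}` could
    -- contain.
    have hU0 : U 0 = [] := by
      have h1 : t 0 = 1 := by
        refine d'.htail.eq_one (parabolic_mono ?_ d'.ht0.mem) d'.ht0.dvd
        intro a ha h1 h2
        have := kAt_range' (n := n) (j := 0) (by omega)
        rw [zero_add] at this
        rw [Set.mem_ofPred_eq, this]
        simp only [Set.mem_ofPred_eq] at ha
        omega
      have h2 := d'.hV0t
      rw [h1] at h2
      have := eq_nil_of_eval_eq_one
        ((letterMap_one n).isPositiveWord (d'.isPositiveWord_zero hk)) h2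
      exact List.map_eq_nil_iff.1 this
    have hasc : ∀ j ≤ n - 1, ascWord (fun j => unshift (lowerEnd (List.range' 1 n) j - 1) (U j)) j
        = ascWord (fun j => unshift j (U j)) j := fun j hj =>
      ascWord_congr fun l h1 h2 => by rw [hl l (by omega)]
    have hword : V 0 = N ++ ascWord (fun j => unshift j (U j)) (n - 1) := by
      rw [d'.word, hU0, hasc _ le_rfl]; simp [unshift]
    let X : ℕ → List ℕ := fun j => if j = 1 then N else U (j - 1)
    have hX1 : ∀ j, 1 ≤ j → X (j + 1) = U j := fun j hj => if_neg (by omega)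
    have hXasc : ∀ j, ascWord (fun j => unshift j (X j)) (j + 1) =
        unshift 1 (N ++ ascWord (fun j => unshift j (U j)) j) := by
      intro j
      rw [ascWord_succ', unshift_append, unshift_ascWord]
      congr 1
      refine ascWord_congr fun l h1 _ => ?_
      rw [hX1 l h1, unshift_unshift]
    refine d.isTailTwistedNormalForm hn X ?_ (fun j h1 h2 => ?_) (fun j h1 h2 => ?_)
    · rw [hword, Nat.add_sub_cancel]
      have := hXasc (n - 1)
      rwa [Nat.sub_add_cancel (by omega), eq_comm] at this
    · obtain ⟨j, rfl⟩ : ∃ l, j = l + 1 := ⟨j - 1, by omega⟩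
      rw [hXasc]
      rcases Nat.eq_zero_or_pos j with rfl | hj
      · rw [ascWord_zero, List.append_nil]
        exact .self ((letterMap_one (n + 1)).eval_mem d'.hN.pos_and_eval.1)
      · have h3 := d'.isMaxRightDivisor hk hj (by omega)
        have h4 := d'.tailRemainder_eq hk (j := j) (by omega)
        have hUj : IsPositiveWord (n + 1) (unshift j (U j)) := by
          have := (hk.letterMap_interval (j := j) (by omega)).isPositiveWord
            (d'.isPositiveWord hk hj (by omega))
          rwa [hl j (by omega)] at this
        rw [h4, hasc j (by omega), ← d'.hVt j hj (by omega), hl j (by omega)] at h3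
        have e : eval (n + 1) (V 0) * tail⁻¹ = eval (n + 1) N := by
          have := d'.tailRemainder_eq hk le_rfl
          rw [tailRemainder_self, hasc _ le_rfl] at this
          rw [hword, eval_append, ← this, mul_inv_cancel_right]
        rw [e, ← eval_append] at h3
        rw [hX1 j hj, ← unshift_unshift]
        refine (letterMap_one (n + 1)).isMaxRightDivisor (d'.hN.pos_and_eval.1.append ?_) hUj
          ?_ ?_ h3
        · refine isPositiveWord_ascWord fun l h1 h2 => ?_
          have := (hk.letterMap_interval (j := l) (by omega)).isPositiveWord
            (d'.isPositiveWord hk h1 (by omega))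
          rwa [hl l (by omega)] at this
        · intro a _ _
          rw [lowerEnd_range' (by omega), upperEnd_range' (by omega)]
          simp only [Set.mem_ofPred_eq]
          omega
        · intro a ha _ _
          simp only [Set.mem_ofPred_eq] at ha ⊢
          omega
    · obtain ⟨j, rfl⟩ : ∃ l, j = l + 1 := ⟨j - 1, by omega⟩
      rcases Nat.eq_zero_or_pos j with rfl | hj
      · have := ih d'.hN
        rw [← d'.hN.pos_and_eval.2] at this
        exact this
      · have := d'.hV j hj (by omega)
        rw [strands_range' (by omega), tailPerm_range' (by omega)] at this
        rw [hX1 j hj, show n + 1 - (j + 1) = n - j by omega]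
        exact this

/-! ### Codes -/

theorem Code.RightLT.ne {c d : Code} (h : Code.RightLT c d) : c ≠ d := by
  induction h with
  | num h => intro e; injection e; omega
  | seq l _ _ ih => intro e; injection e with e; exact ih (congrFun e l)

theorem Code.RightLT.asymm {c d : Code} (h : Code.RightLT c d) : ¬ Code.RightLT d c := by
  induction h with
  | num h => intro h'; cases h'; omega
  | seq l he hl ih =>
    intro h'
    cases h' with
    | seq l' he' hl' =>
      rcases lt_trichotomy l l' with h | rfl | h
      · exact hl.ne (he' l h).symm
      · exact ih hl'
      · exact hl'.ne (he l' h).symm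

theorem IsCode.two_le {n : ℕ} {lt : Braid n → Braid n → Prop} {W : List ℕ} {c : Code}
    (h : IsCode n lt W c) : 2 ≤ n := by
  cases h <;> omega

theorem IsCode.exists_replicate {lt : Braid 2 → Braid 2 → Prop} {W : List ℕ} {c : Code}
    (h : IsCode 2 lt W c) : ∃ a, W = List.replicate a 1 ∧ c = .num a := by
  cases h with
  | two _ _ a => exact ⟨a, rfl, rfl⟩
  | step hn => omega

/-- The data of a code with respect to the ordering given by `k`. -/
structure CodeData (n : ℕ) (k : List ℕ) (W : List ℕ) (c : Code) (m : ℕ) (V Y : ℕ → List ℕ)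
    (C E : ℕ → Code) : Prop where
  nil : ∀ i, m < i → V i = []
  code_zero : IsCode n (normalLT n (restPerm k)) (V 0) (C 0)
  code : ∀ i, 1 ≤ i → IsCode n (normalLT n (List.range' 1 (n - 1))) (V i) (C i)
  code_tail : ∀ j, 1 ≤ j → j ≤ n - 1 → IsCode (strands (n + 1) k j)
    (normalLT (strands (n + 1) k j) (tailPerm (n + 1) k j)) (Y j) (E j)
  word : W = descWord (fun i => place n i (V i)) m ++
    ascWord (fun j => unshift (lowerEnd k j - 1) (Y j)) (n - 1)
  eq_mkCode : c = mkCode (n - 1) C E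

theorem CodeData.isCode {n : ℕ} (hn : 2 ≤ n) {k : List ℕ} (hk : IsPermutation (n + 1) k)
    {W : List ℕ} {c : Code} {m : ℕ} {V Y : ℕ → List ℕ} {C E : ℕ → Code}
    (d : CodeData n k W c m V Y C E) : IsCode (n + 1) (normalLT (n + 1) k) W c := by
  rw [d.word, d.eq_mkCode]
  refine .step hn _ k hk rfl m V Y C E d.nil ?_ d.code fun j h1 h2 => ?_
  · rw [hk.restrictLT_one]; exact d.code_zero
  · rw [hk.restrictLT_interval (by omega)]; exact d.code_tail j h1 h2

/-- A code remembers only the ordering, not the permutation that produced it. Because orderings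
determine permutations, its decomposition uses the intervals of the given `k`. -/
theorem IsCode.exists_data {n : ℕ} (hn : 2 ≤ n) {k : List ℕ} (hk : IsPermutation (n + 1) k)
    {W : List ℕ} {c : Code} (h : IsCode (n + 1) (normalLT (n + 1) k) W c) :
    ∃ m V Y C E, CodeData n k W c m V Y C E := by
  generalize hlt : normalLT (n + 1) k = lt at h
  cases h with
  | two => omega
  | step _ _ k' hk' hlt' m V Y C E h1 h2 h3 h4 =>
    rw [hlt'] at hlt
    obtain rfl := normalLT_injective hk hk' hlt
    subst hlt'
    refine ⟨m, V, Y, C, E, h1, ?_, h3, fun j hj hj' => ?_, rfl, rfl⟩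
    · rw [← hk.restrictLT_one]; exact h2
    · rw [← hk.restrictLT_interval (by omega)]; exact h4 j hj hj'

theorem IsCode.isPositiveWord {n : ℕ} {k : List ℕ} (hk : IsPermutation n k) {W : List ℕ}
    {c : Code} (h : IsCode n (normalLT n k) W c) : IsPositiveWord n W := by
  have hn := h.two_le
  induction n using Nat.strong_induction_on generalizing W k c with
  | _ n ih =>
  rcases hn.eq_or_lt with rfl | hn
  · obtain ⟨a, rfl, rfl⟩ := h.exists_replicate
    exact isPositiveWord_replicate a
  obtain ⟨n, rfl⟩ : ∃ m, n = m + 1 := ⟨n - 1, by omega⟩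
  obtain ⟨m, V, Y, C, E, d⟩ := h.exists_data (by omega) hk
  rw [d.word]
  refine (isPositiveWord_descWord fun i _ => ?_).append
    (isPositiveWord_ascWord fun j h1 h2 => ?_)
  · rw [place_eq_map]
    refine (letterMap_place n i).isPositiveWord ?_
    rcases Nat.eq_zero_or_pos i with rfl | hi
    · exact ih n (by omega) hk.restPerm d.code_zero (by omega)
    · exact ih n (by omega) (isPermutation_range' n) (d.code i hi) (by omega)
  · exact (hk.letterMap_interval (by omega)).isPositiveWord (ih _ (hk.strands_lt h1 (by omega))
      (hk.tailPerm (by omega)) (d.code_tail j h1 h2) (d.code_tail j h1 h2).two_le)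

theorem mkCode_inj {r : ℕ} {C C' E E' : ℕ → Code} (h : mkCode r C E = mkCode r C' E') :
    C = C' ∧ ∀ j, 1 ≤ j → j ≤ r → E j = E' j := by
  injection h with h
  constructor
  · funext i
    have := congrFun h (i + r)
    simpa using this
  · intro j h1 h2
    have := congrFun h (r - j)
    rwa [if_pos (by omega), if_pos (by omega), show r - (r - j) = j by omega] at this

/-- A code determines the word. -/
theorem IsCode.word_unique {n : ℕ} {k : List ℕ} (hk : IsPermutation n k) {W W' : List ℕ}
    {c : Code} (h : IsCode n (normalLT n k) W c) (h' : IsCode n (normalLT n k) W' c) :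
    W = W' := by
  have hn := h.two_le
  induction n using Nat.strong_induction_on generalizing W W' k c with
  | _ n ih =>
  rcases hn.eq_or_lt with rfl | hn
  · obtain ⟨a, rfl, rfl⟩ := h.exists_replicate
    obtain ⟨b, rfl, e⟩ := h'.exists_replicate
    injection e with e
    rw [e]
  obtain ⟨n, rfl⟩ : ∃ m, n = m + 1 := ⟨n - 1, by omega⟩
  obtain ⟨m, V, Y, C, E, d⟩ := h.exists_data (by omega) hk
  obtain ⟨m', V', Y', C', E', d'⟩ := h'.exists_data (by omega) hk
  obtain ⟨rfl, hE⟩ := mkCode_inj (d.eq_mkCode.symm.trans d'.eq_mkCode)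
  have hV : V = V' := by
    funext i
    rcases Nat.eq_zero_or_pos i with rfl | hi
    · exact ih n (by omega) hk.restPerm d.code_zero d'.code_zero (by omega)
    · exact ih n (by omega) (isPermutation_range' n) (d.code i hi) (d'.code i hi) (by omega)
  subst hV
  rw [d.word, d'.word]
  congr 1
  · rw [← descWord_of_nil (le_max_left m m'), ← descWord_of_nil (le_max_right m m')]
    · intro i hi; rw [d'.nil i hi, place_nil]
    · intro i hi; rw [d.nil i hi, place_nil]
  · refine ascWord_congr fun j h1 h2 => ?_
    congr 1
    have h3 := d'.code_tail j h1 h2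
    rw [← hE j h1 h2] at h3
    exact ih _ (hk.strands_lt h1 (by omega)) (hk.tailPerm (by omega)) (d.code_tail j h1 h2) h3
      (d.code_tail j h1 h2).two_le

/-! ### The tail-twisted normal form has the largest code -/

/-- The code `c` is at least as large as all codes of words that represent right divisors of
`β`. -/
def Dominates (n : ℕ) (k : List ℕ) (β : Braid n) (c : Code) : Prop :=
  ∀ W' c', IsCode n (normalLT n k) W' c' → β * (eval n W')⁻¹ ∈ positiveBraids n →
    c' = c ∨ Code.RightLT c' c

/-- The factors below `i` agree and can be cancelled on the right. Then `A' i` stands at the right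
end, with only positive factors before it. -/
theorem remainder_mul_eval_descWord {n i : ℕ} {γ : Braid n} {b : ℕ → Braid n}
    {A A' : ℕ → List ℕ} {m : ℕ} (hA : ∀ l, eval n (A l) = b l) (hA' : ∀ l < i, A' l = A l)
    (hpos : ∀ l, IsPositiveWord n (A' l)) (hi : i ≤ m) {μ : Braid n}
    (hμ : μ ∈ positiveBraids n) (hγ : γ = μ * eval n (descWord A' m)) :
    remainder γ b i * (eval n (A' i))⁻¹ ∈ positiveBraids n := by
  induction m generalizing μ with
  | zero =>
    obtain rfl : i = 0 := by omega
    rw [remainder, hγ, descWord_zero, mul_inv_cancel_right]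
    exact hμ
  | succ m ih =>
    rcases hi.eq_or_lt with rfl | hi
    · have h := remainder_mul_eval (β := γ) (b := b) (A := A') (m := m)
        fun l hl => by rw [hA' l (by omega), hA]
      have e := h.trans hγ
      rw [descWord_succ, eval_append, ← mul_assoc] at e
      rw [mul_right_cancel e, mul_inv_cancel_right]
      exact hμ
    · refine ih (μ := μ * eval n (A' (m + 1))) (by omega)
        (mul_mem hμ (eval_mem (hpos (m + 1)))) ?_
      rw [hγ, descWord_succ, eval_append, mul_assoc]

/-- Both sides are the inverse of the common suffix formed by the factors of index greater than `j`.
-/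
theorem eval_ascWord_of_eq {n r j : ℕ} {X X' : ℕ → List ℕ} (hj : j ≤ r)
    (h : ∀ l, j < l → l ≤ r → X' l = X l) :
    (eval n (ascWord X r))⁻¹ * eval n (ascWord X j) =
      (eval n (ascWord X' r))⁻¹ * eval n (ascWord X' j) := by
  obtain ⟨d, rfl⟩ := Nat.exists_eq_add_of_le hj
  induction d with
  | zero => simp
  | succ d ih =>
    rw [← add_assoc, ascWord_succ, ascWord_succ, eval_append, eval_append, mul_inv_rev,
      mul_inv_rev, mul_assoc, ih (by omega) (fun l h1 h2 => h l h1 (by omega)), mul_assoc,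
      h (j + d + 1) (by omega) (by omega)]

/-- The competing factor lies in the standard submonoid, so it right-divides the maximal divisor.
Pulled back to `s` strands, this is a situation covered by the domination of `c`, which is why
domination has to speak of right divisors. -/
theorem Dominates.of_dvd {s n : ℕ} {k : List ℕ} {S : Set ℕ} {f : ℕ → ℕ} (hf : LetterMap s n S f)
    (hk : IsPermutation s k) {V V' : List ℕ} {c c' : Code} {ρ : Braid n}
    (hV : IsPositiveWord s V) (hc : Dominates s k (eval s V) c)
    (hc' : IsCode s (normalLT s k) V' c') (hm : IsMaxRightDivisor S ρ (eval n (V.map f)))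
    (hd : ρ * (eval n (V'.map f))⁻¹ ∈ positiveBraids n) : c' = c ∨ Code.RightLT c' c :=
  have hV' := hc'.isPositiveWord hk
  hc V' c' hc' (hf.dvd_of_dvd hV hV' (parabolic_le (hm.max _ (hf.eval_mem hV') hd)))

/-- The alternate decomposition of the braid without its tail. -/
theorem TailData.exists_phiData {n : ℕ} (hn : 2 ≤ n) {k : List ℕ}
    {β : Braid (n + 1)} {W : List ℕ} {tail main : Braid (n + 1)} {t : ℕ → Braid (n + 1)}
    {N : List ℕ} {V : ℕ → List ℕ} (d : TailData n k β W tail main t N V) :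
    ∃ (m : ℕ) (b : ℕ → Braid (n + 1)) (U : ℕ → List ℕ), U 0 = V 0 ∧
      (∀ i, m < i → U i = []) ∧
      (∀ i, IsMaxRightDivisor (altSet (n + 1) i) (remainder (β * tail⁻¹) b i) (b i)) ∧
      (∀ i, eval (n + 1) (place n i (U i)) = b i) ∧
      (∀ i, 1 ≤ i → IsPhiNormalForm n (eval n (U i)) (U i)) ∧
      N ++ unshift 1 (V 0) = descWord (fun i => place n i (U i)) m := by
  obtain ⟨m, b, U, e⟩ := d.hN.exists_data hn
  have hset : {a | 2 ≤ a ∧ a ≤ n} = altSet (n + 1) 0 := by simp [altSet]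
  -- `β_{T_0}` has taken away every right divisor in these generators, so the first slot in the
  -- decomposition of the main part is empty and can be filled with `t 0`.
  have hb0 : b 0 = 1 := by
    refine d.ht0.eq_one ?_ ?_
    · rw [hset]; exact (e.max 0).mem
    · have := (e.max 0).dvd
      rwa [remainder, d.hmain] at this
  have hU0 : U 0 = [] := by
    have h1 := e.eval 0
    rw [hb0, place_eq_map] at h1
    exact List.map_eq_nil_iff.1 (eq_nil_of_eval_eq_one
      ((letterMap_place n 0).isPositiveWord (e.isPositiveWord 0)) h1)
  have hrem : ∀ i, remainder (β * tail⁻¹) (fun i => if i = 0 then t 0 else b i) (i + 1) =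
      remainder main b (i + 1) := by
    intro i
    induction i with
    | zero => simp [remainder, hb0, d.hmain]
    | succ i ih => rw [remainder, ih, if_neg (by omega)]; rfl
  refine ⟨m, fun i => if i = 0 then t 0 else b i, fun i => if i = 0 then V 0 else U i,
    rfl, fun i hi => ?_, fun i => ?_, fun i => ?_, fun i hi => ?_, ?_⟩
  · simpa [show i ≠ 0 by omega] using e.nil i hi
  · cases i with
    | zero => rw [← hset]; exact d.ht0
    | succ i => rw [hrem]; exact e.max _
  · cases i with
    | zero => exact d.hV0t
    | succ i => exact e.eval _
  · simpa [show i ≠ 0 by omega] using e.phi i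
  · rw [e.word, descWord_eq_append, descWord_eq_append (fun i => place n i _), hU0, place_nil,
      List.append_nil]
    congr 1
    refine descWord_congr fun i _ => ?_
    split_ifs <;> rfl

/-- Induction on the number of strands supplies dominating codes for all factors, each relative to
its own permutation, and the assembled code dominates because it is compared lexicographically from
the right. At the first difference, the competing word has the same factors further right, so its
own factor there right-divides the greedy one. -/
theorem IsTailTwistedNormalForm.exists_code {n : ℕ} {k : List ℕ} (hk : IsPermutation n k)
    {β : Braid n} {W : List ℕ} (h : IsTailTwistedNormalForm n k β W) :
    ∃ c, IsCode n (normalLT n k) W c ∧ Dominates n k β c := by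
  have hn := h.two_le
  induction n using Nat.strong_induction_on generalizing W k with
  | _ n ih =>
  rcases hn.eq_or_lt with rfl | hn
  · obtain ⟨p, rfl, rfl⟩ := h.exists_replicate
    obtain rfl : k = List.range' 1 1 := List.perm_singleton.1 hk
    refine ⟨.num p, .two _ rfl p, fun W' c' h' hd => ?_⟩
    obtain ⟨a, rfl, rfl⟩ := h'.exists_replicate
    have h1 := len_mul hd (eval_mem (isPositiveWord_replicate a))
    rw [inv_mul_cancel_right, ← eval_replicate, len_eval (isPositiveWord_replicate p),
      len_eval (isPositiveWord_replicate a), List.length_replicate, List.length_replicate] at h1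
    rcases (show a ≤ p by omega).eq_or_lt with rfl | h2
    · exact .inl rfl
    · exact .inr (.num h2)
  obtain ⟨n, rfl⟩ : ∃ m, n = m + 1 := ⟨n - 1, by omega⟩
  have hn2 : 2 ≤ n := by omega
  obtain ⟨tail, main, t, N, V, d⟩ := h.exists_data hn2
  obtain ⟨m, b, U, hU0, hUnil, hmax, hUb, hUphi, hword⟩ := d.exists_phiData hn2
  obtain ⟨C₀, hC₀, hC₀'⟩ := ih n (by omega) hk.restPerm d.hV0 hn2
  -- The factor at `0` is in tail-twisted form for `restPerm k`; the later ones are in Φ-normal form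
  -- and are covered as tail-twisted forms of the trivial permutation.
  have hC : ∀ i, ∃ c, (i = 0 → c = C₀) ∧ (1 ≤ i →
      IsCode n (normalLT n (List.range' 1 (n - 1))) (U i) c ∧
      Dominates n (List.range' 1 (n - 1)) (eval n (U i)) c) := by
    intro i
    by_cases hi : i = 0
    · exact ⟨C₀, fun _ => rfl, fun h => by omega⟩
    · obtain ⟨c, hc⟩ := ih n (by omega) (isPermutation_range' n)
        (hUphi i (by omega)).isTailTwistedNormalForm hn2
      exact ⟨c, fun h => absurd h hi, fun _ => hc⟩
  choose C hC0 hC using hC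
  have hE : ∀ j, ∃ c, 1 ≤ j → j ≤ n - 1 →
      IsCode (strands (n + 1) k j)
        (normalLT (strands (n + 1) k j) (tailPerm (n + 1) k j)) (V j) c ∧
      Dominates (strands (n + 1) k j) (tailPerm (n + 1) k j)
        (eval (strands (n + 1) k j) (V j)) c := by
    intro j
    by_cases hj : 1 ≤ j ∧ j ≤ n - 1
    · obtain ⟨c, hc⟩ := ih _ (hk.strands_lt hj.1 (by omega)) (hk.tailPerm (by omega))
        (d.hV j hj.1 hj.2) (d.hV j hj.1 hj.2).two_le
      exact ⟨c, fun _ _ => hc⟩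
    · exact ⟨C₀, fun h1 h2 => absurd ⟨h1, h2⟩ hj⟩
  choose E hE using hE
  have hcode : CodeData n k W (mkCode (n - 1) C E) m U V C E :=
    { nil := hUnil
      code_zero := by rw [hU0, hC0 0 rfl]; exact hC₀
      code := fun i hi => (hC i hi).1
      code_tail := fun j h1 h2 => (hE j h1 h2).1
      word := by rw [← hword]; exact d.word
      eq_mkCode := rfl }
  refine ⟨_, hcode.isCode hn2 hk, fun W' c' h' hd => ?_⟩
  have hW' := h'.isPositiveWord hk
  obtain ⟨m', U', V', C', E', d'⟩ := h'.exists_data hn2 hk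
  have hU' : ∀ i, IsPositiveWord (n + 1) (place n i (U' i)) := by
    intro i
    rw [place_eq_map]
    refine (letterMap_place n i).isPositiveWord ?_
    rcases Nat.eq_zero_or_pos i with rfl | hi
    · exact d'.code_zero.isPositiveWord hk.restPerm
    · exact (d'.code i hi).isPositiveWord (isPermutation_range' n)
  have hV' : ∀ j, 1 ≤ j → j ≤ n - 1 →
      IsPositiveWord (n + 1) (unshift (lowerEnd k j - 1) (V' j)) := fun j h1 h2 =>
    (hk.letterMap_interval (by omega)).isPositiveWord
      ((d'.code_tail j h1 h2).isPositiveWord (hk.tailPerm (by omega)))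
  obtain ⟨μ, hμ, hβ⟩ : ∃ μ ∈ positiveBraids (n + 1), β = μ * eval (n + 1) W' :=
    ⟨_, hd, by simp⟩
  rw [d'.word, eval_append] at hβ
  have htail := d.tailRemainder_eq hk le_rfl
  rw [tailRemainder_self] at htail
  -- Equal codes to the right mean equal words there. After cancelling this common suffix from `β`,
  -- the `j`-th tail factor of the competing word is a right divisor of the braid in which `t j` is
  -- maximal.
  have keyE : ∀ j, 1 ≤ j → j ≤ n - 1 → (∀ l, j < l → l ≤ n - 1 → E' l = E l) →
      E' j = E j ∨ Code.RightLT (E' j) (E j) := by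
    intro j h1 h2 heq
    have hYV : ∀ l, j < l → l ≤ n - 1 → V' l = V l := fun l hl hl' => by
      have h3 := d'.code_tail l (by omega) hl'
      rw [heq l hl hl'] at h3
      exact h3.word_unique (hk.tailPerm (by omega)) (hE l (by omega) hl').1
    have hm := d.isMaxRightDivisor hk h1 h2
    rw [← d.hVt j h1 h2] at hm
    refine Dominates.of_dvd (hk.letterMap_interval (by omega)) (hk.tailPerm (by omega))
      (d.isPositiveWord hk h1 h2) (hE j h1 h2).2 (d'.code_tail j h1 h2) hm ?_
    rw [d.tailRemainder_eq hk h2, htail, mul_assoc β,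
      eval_ascWord_of_eq h2 (X' := fun j => unshift (lowerEnd k j - 1) (V' j))
        (fun l hl hl' => by rw [hYV l hl hl']), hβ]
    obtain ⟨i, rfl⟩ : ∃ i, j = i + 1 := ⟨j - 1, by omega⟩
    rw [ascWord_succ _ i, eval_append]
    simp only [mul_assoc, mul_inv_cancel_left]
    rw [show List.map (fun x => x + (lowerEnd k (i + 1) - 1)) (V' (i + 1)) =
      unshift (lowerEnd k (i + 1) - 1) (V' (i + 1)) from rfl, mul_inv_cancel, mul_one]
    exact mul_mem hμ (mul_mem (eval_mem (isPositiveWord_descWord fun i _ => hU' i))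
      (eval_mem (isPositiveWord_ascWord fun l h3 h4 => hV' l h3 (by omega))))
  -- When all tail codes agree, so do the tail words. Cancelling them leaves `β * tail⁻¹`, whose
  -- alternating decomposition is compared with the remaining factors.
  have keyC : ∀ i, (∀ j, 1 ≤ j → j ≤ n - 1 → E' j = E j) → (∀ l < i, C' l = C l) →
      C' i = C i ∨ Code.RightLT (C' i) (C i) := by
    intro i heE heC
    have hasc : ascWord (fun j => unshift (lowerEnd k j - 1) (V' j)) (n - 1) =
        ascWord (fun j => unshift (lowerEnd k j - 1) (V j)) (n - 1) :=
      ascWord_congr fun l hl hl' => by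
        have h3 := d'.code_tail l hl hl'
        rw [heE l hl hl'] at h3
        rw [h3.word_unique (hk.tailPerm (by omega)) (hE l hl hl').1]
    have hUU : ∀ l < i, U' l = U l := by
      intro l hl
      rcases Nat.eq_zero_or_pos l with rfl | hpos
      · have h3 := d'.code_zero
        rw [heC 0 hl] at h3
        exact h3.word_unique hk.restPerm hcode.code_zero
      · have h3 := d'.code l hpos
        rw [heC l hl] at h3
        exact h3.word_unique (isPermutation_range' n) (hcode.code l hpos)
    -- The competing word may have fewer than `i + 1` factors; it is padded with empty ones so that
    -- a factor exists at place `i`.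
    have hγ : β * tail⁻¹ =
        μ * eval (n + 1) (descWord (fun i => place n i (U' i)) (max m' i)) := by
      rw [descWord_of_nil (le_max_left m' i)
        (fun l hl => by rw [d'.nil l hl, place_nil]), htail, ← hasc, hβ]
      simp [mul_assoc]
    have hdvd := remainder_mul_eval_descWord (A := fun i => place n i (U i)) hUb
      (A' := fun i => place n i (U' i)) (i := i) (fun l hl => by rw [hUU l hl]) hU'
      (le_max_right m' i) hμ hγ
    have hm := hmax i
    rw [← hUb i, place_eq_map] at hm
    rw [place_eq_map] at hdvd
    rcases Nat.eq_zero_or_pos i with rfl | hpos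
    · refine Dominates.of_dvd (letterMap_place n 0) hk.restPerm
        (hcode.code_zero.isPositiveWord hk.restPerm) ?_ d'.code_zero hm hdvd
      rw [hU0, hC0 0 rfl]; exact hC₀'
    · exact Dominates.of_dvd (letterMap_place n i) (isPermutation_range' n)
        ((hcode.code i hpos).isPositiveWord (isPermutation_range' n)) (hC i hpos).2
        (d'.code i hpos) hm hdvd
  rw [d'.eq_mkCode]
  -- Positions are counted from the right end of the code: first the tail codes from index `n - 1`
  -- down to `1`, then the codes of `A_0`, `A_1`, and so on.
  have key : ∀ p, (∀ q < p, (if q < n - 1 then E' (n - 1 - q) else C' (q - (n - 1))) =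
      if q < n - 1 then E (n - 1 - q) else C (q - (n - 1))) →
      (if p < n - 1 then E' (n - 1 - p) else C' (p - (n - 1))) =
        (if p < n - 1 then E (n - 1 - p) else C (p - (n - 1))) ∨
      Code.RightLT (if p < n - 1 then E' (n - 1 - p) else C' (p - (n - 1)))
        (if p < n - 1 then E (n - 1 - p) else C (p - (n - 1))) := by
    intro p hq
    by_cases hp : p < n - 1
    · rw [if_pos hp, if_pos hp]
      refine keyE _ (by omega) (by omega) fun l hl hl' => ?_
      have := hq (n - 1 - l) (by omega)
      rwa [if_pos (by omega), if_pos (by omega), show n - 1 - (n - 1 - l) = l by omega] at this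
    · rw [if_neg hp, if_neg hp]
      refine keyC _ (fun j h1 h2 => ?_) fun l hl => ?_
      · have := hq (n - 1 - j) (by omega)
        rwa [if_pos (by omega), if_pos (by omega), show n - 1 - (n - 1 - j) = j by omega] at this
      · have := hq (l + (n - 1)) (by omega)
        rwa [if_neg (by omega), if_neg (by omega), Nat.add_sub_cancel] at this
  unfold mkCode
  -- Either no position differs and the codes are equal, or the first difference from the right
  -- decides.
  by_cases hall : ∀ p, (if p < n - 1 then E' (n - 1 - p) else C' (p - (n - 1))) =
      if p < n - 1 then E (n - 1 - p) else C (p - (n - 1))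
  · exact .inl (congrArg Code.seq (funext hall))
  · have hex := not_forall.1 hall
    classical
    have hmin : ∀ q < Nat.find hex, _ := fun q hq => not_not.1 (Nat.find_min hex hq)
    exact .inr (.seq (Nat.find hex) hmin ((key _ hmin).resolve_left (Nat.find_spec hex)))

end BraidNF

theorem mainTheorem5 (n : ℕ) (hn : 2 ≤ n) (k : List ℕ) (hk : BraidNF.IsPermutation n k)
    (lt : BraidNF.Braid n → BraidNF.Braid n → Prop) (hlt : lt = BraidNF.normalLT n k)
    (β : BraidNF.Braid n) (hβ : β ∈ BraidNF.positiveBraids n) :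
    ∃ W : List ℕ, BraidNF.IsPositiveWord n W ∧ BraidNF.eval n W = β ∧
      (∀ V, BraidNF.IsTailTwistedNormalForm n k β V ↔ V = W) ∧
      (∀ V, BraidNF.IsCNormalForm n lt β V ↔ V = W) := by
  subst hlt
  obtain ⟨W, hW⟩ := BraidNF.exists_isTailTwistedNormalForm hn hk hβ
  obtain ⟨hpos, heval⟩ := hW.pos_and_eval hk
  obtain ⟨c, hc, hdom⟩ := hW.exists_code hk
  have hmax : ∀ W' c', BraidNF.IsCode n (BraidNF.normalLT n k) W' c' →
      BraidNF.eval n W' = β → c' = c ∨ BraidNF.Code.RightLT c' c := fun W' c' h' e =>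
    hdom W' c' h' (by rw [e, mul_inv_cancel]; exact one_mem _)
  refine ⟨W, hpos, heval, fun V => ⟨fun hV => hV.unique hk hW, fun e => e ▸ hW⟩,
    fun V => ⟨?_, fun e => e ▸ ⟨c, hc, heval, hmax⟩⟩⟩
  rintro ⟨c', hc', e', hmax'⟩
  -- Both codes are maximal, so each is at most the other; asymmetry leaves only equality, and equal
  -- codes come from equal words.
  have : c' = c := by
    rcases hmax V c' hc' e' with h | h
    · exact h
    · rcases hmax' W c hc heval with h' | h'
      · exact h'.symm
      · exact absurd h' h.asymm
  subst this
  exact hc'.word_unique hk hc
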